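/- Let $T>0$, let $(\Omega,\mathcal F,\mathbb P)$ be a probability space with a filtration $\mathbb F=(\mathcal F_t)_{t\in[0,T]}$ satisfying the usual conditions, and let $L$ be a real random variable. Put $\mathcal G_t=\bigcap_{T\ge s>t}(\mathcal F_s\vee\sigma(L))$ for $t<T$, $\mathcal G_T=\mathcal F_T\vee\sigma(L)$, and $\mathbb G=(\mathcal G_t)_{t\in[0,T]}$. Let $Q_t(\omega,\mathrm dx)$ be a regular version of the conditional law of $L$ given $\mathcal F_t$, chosen such that $t\mapsto Q_t(\omega,\cdot)$ is almost surely càdlàg for the weak topology, with left limits $Q_{t-}(\omega,\mathrm dx)$. (No domination of the random measures $Q_t$ by a deterministic measure is assumed.) Let $M=(M_t)_{t\in[0,T]}$ be a càdlàg $\mathbb F$-local martingale whose predictable quadratic variation $\langle M,M\rangle$ exists (for instance $M$ continuous or locally bounded); here $\langle X,Y\rangle$ denotes the predictable càdlàg process of finite variation, null at $0$, such that $XY-\langle X,Y\rangle$ is an $\mathbb F$-local martingale, and $\langle M,M\rangle$ is nondecreasing. Let $(t,\omega,x)\mapsto\alpha_t^x(\omega)$ be real-valued and measurable for the product of the $\mathbb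 F$-predictable and the Borel $\sigma$-algebras. Assume that for every $a\in\mathbb R$, almost surely, $$\int_0^T\int_{(a,\infty)}|\alpha_s^x|\,Q_{s-}(\cdot,\mathrm dx)\,\mathrm d\langle M,M\rangle_s<\infty ,$$ and that for every $a\in\mathbb R$ the predictable covariation of $\left(Q_t(\cdot,(a,\infty))\right)_t$ and $M$ exists and satisfies, up to indistinguishability, $$\Big\langle \int_{(a,\infty)}Q_{\cdot}(\cdot,\mathrm dx),M\Big\rangle_t=\int_0^t\int_{(a,\infty)}\alpha_s^x\,Q_{s-}(\cdot,\mathrm dx)\,\mathrm d\langle M,M\rangle_s ,\qquad t\in[0,T].$$ Then $\int_0^T|\alpha_s^L|\,\mathrm d\langle M,M\rangle_s<\infty$ almost surely, and $$M_{\cdot}-\int_0^{\cdot}\alpha_s^L\,\mathrm d\langle M,M\rangle_s$$ is a $\mathbb G$-local martingale. If moreover $M$ is an $\mathbb F$-martingale and $\mathbb E\int_0^T|\alpha_s^L|\,\mathrm d\langle M,M\rangle_s<\infty$, then it is a $\mathbb G$-martingale. -/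

import Mathlib

open MeasureTheory ProbabilityTheory Filter Set Topology
open scoped NNReal ENNReal

noncomputable section

namespace Enlargement

/-- The time interval `[0, T]`. -/
abbrev Time (T : ℝ≥0) : Type := Set.Iic T

variable {Ω : Type*} {m : MeasurableSpace Ω} {T : ℝ≥0}

/-- Right-continuity with left limits. -/
def IsCadlag {E : Type*} [TopologicalSpace E] (f : Time T → E) : Prop :=
  ∀ t, ContinuousWithinAt f (Ici t) t ∧ ∃ l, Tendsto f (𝓝[<] t) (𝓝 l)

/-- The usual conditions: right-continuity, and every (outer) null set, measurable or not,
belongs to the initial σ-algebra. -/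
structure UsualConditions (𝓕 : Filtration (Time T) m) (P : Measure Ω) : Prop where
  rightCont : 𝓕.IsRightContinuous
  null : ∀ s : Set Ω, P s = 0 → MeasurableSet[𝓕 ⊥] s

/-- The initial enlargement `𝓖 t = ⋂_{T ≥ s > t} (𝓕 s ∨ σ(L))` for `t < T`,
and `𝓖 T = 𝓕 T ∨ σ(L)`. -/
def enlarge (𝓕 : Filtration (Time T) m) (L : Ω → ℝ) (hL : Measurable L) :
    Filtration (Time T) m :=
  (𝓕 ⊔ Filtration.const (Time T) (MeasurableSpace.comap L inferInstance) hL.comap_le).rightCont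

/-- Local martingales on the closed interval `[0, T]` with almost surely càdlàg paths.
The initial value need not be integrable. -/
def IsLocalMartingale (𝓕 : Filtration (Time T) m) (P : Measure Ω) (X : Time T → Ω → ℝ) : Prop :=
  (∀ᵐ ω ∂P, IsCadlag fun t ↦ X t ω) ∧ Locally (fun Y ↦ Martingale Y 𝓕 P) 𝓕 X P

/-- `A` is a version of the predictable covariation `⟨X, Y⟩` : a predictable càdlàg process of
finite variation, null at time `0`, such that `X Y - A` is a local martingale. -/
structure IsPredictableCovariation (𝓕 : Filtration (Time T) m) (P : Measure Ω)
    (X Y A : Time T → Ω → ℝ) : Prop where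
  predictable : IsStronglyPredictable 𝓕 A
  zero : ∀ᵐ ω ∂P, A ⊥ ω = 0
  cadlag : ∀ᵐ ω ∂P, IsCadlag fun t ↦ A t ω
  finiteVariation : ∀ᵐ ω ∂P, BoundedVariationOn (fun t ↦ A t ω) univ
  localMartingale : IsLocalMartingale 𝓕 P fun t ω ↦ X t ω * Y t ω - A t ω

/-- `C` is a version of the predictable quadratic variation `⟨X, X⟩`, with nondecreasing paths. -/
structure IsPredictableQuadraticVariation (𝓕 : Filtration (Time T) m) (P : Measure Ω)
    (X C : Time T → Ω → ℝ) : Prop extends IsPredictableCovariation 𝓕 P X X C where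
  mono : ∀ᵐ ω ∂P, Monotone fun t ↦ C t ω

instance : CompactIccSpace (Time T) where
  isCompact_Icc {a b} := by
    have h := (Topology.IsClosedEmbedding.subtypeVal
      (isClosed_Iic (a := T))).isCompact_preimage (isCompact_Icc (a := (a : ℝ≥0)) (b := b))
    exact h

open Classical in
/-- The Lebesgue–Stieltjes measure `df` on `[0, T]` of a nondecreasing right-continuous function,
with `df (s, t] = f t - f s` and no mass at time `0` (and the zero measure for any other `f`). -/
def stieltjes (f : Time T → ℝ) : Measure (Time T) :=
  if h : Monotone f ∧ ∀ t, ContinuousWithinAt f (Ici t) t then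
    (StieltjesFunction.mk f h.1 h.2).measure
  else 0

/-- `Q t ω` is a regular version of the conditional law of `L` given `𝓕 t`, chosen such that
`t ↦ Q t ω` is almost surely càdlàg for the weak topology, so that the left limits `Q_{t-}` make
sense. -/
structure IsRegularConditionalLaw (𝓕 : Filtration (Time T) m) (P : Measure Ω) (L : Ω → ℝ)
    (Q : Time T → Ω → ProbabilityMeasure ℝ) : Prop where
  measurable : ∀ t, ∀ B : Set ℝ, MeasurableSet B →
    Measurable[𝓕 t] fun ω ↦ (Q t ω : Measure ℝ) B
  condProb : ∀ t, ∀ B : Set ℝ, MeasurableSet B →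
    (fun ω ↦ (Q t ω : Measure ℝ).real B) =ᵐ[P] P⟦L ⁻¹' B | 𝓕 t⟧
  cadlag : ∀ᵐ ω ∂P, IsCadlag fun t ↦ Q t ω

/-- The left limit `Q_{t-}(ω, dx)` in the weak topology (and `Q_0` at `t = 0`). -/
def leftLaw (Q : Time T → Ω → ProbabilityMeasure ℝ) (t : Time T) (ω : Ω) : Measure ℝ :=
  (Function.leftLim (fun s ↦ Q s ω) t : ProbabilityMeasure ℝ)

/-- The tail process `∫_a^∞ Q_t(ω, dx) = Q_t(ω, (a, ∞))`. -/
def tail (Q : Time T → Ω → ProbabilityMeasure ℝ) (a : ℝ) (t : Time T) (ω : Ω) : ℝ :=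
  (Q t ω : Measure ℝ).real (Ioi a)

/-- `∫_0^t ∫_a^∞ α_s^x(ω) Q_{s-}(ω, dx) dC_s(ω)`; the process `α_s^x(ω)` is written `α s x ω`. -/
def tailIntegral (Q : Time T → Ω → ProbabilityMeasure ℝ) (C : Time T → Ω → ℝ)
    (α : Time T → ℝ → Ω → ℝ) (a : ℝ) (t : Time T) (ω : Ω) : ℝ :=
  ∫ s in Ioc ⊥ t, ∫ x in Ioi a, α s x ω ∂(leftLaw Q s ω) ∂(stieltjes fun u ↦ C u ω)

/-- The compensated process `M_t - ∫_0^t α_s^L dC_s`. -/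
def compensated (M C : Time T → Ω → ℝ) (α : Time T → ℝ → Ω → ℝ) (L : Ω → ℝ)
    (t : Time T) (ω : Ω) : ℝ :=
  M t ω - ∫ s in Ioc ⊥ t, α s (L ω) ω ∂(stieltjes fun u ↦ C u ω)

end Enlargement

end

/-!
Write `C = ⟨M, M⟩`, let `A ∈ 𝓕 s` and let `τ` be a stopping time that reduces the processes
involved. Since `Q_t(a, ∞)` is the conditional probability of `{L > a}`, the local martingale
`Q(a, ∞) M - ∫ ∫_{(a, ∞)} α_u^x Q_{u-}(dx) dC_u` yields
`E[1_{A ∩ {L > a}} (M_{t∧τ} - M_{s∧τ})] = E[1_A ∫_{s∧τ}^{t∧τ} ∫_{(a, ∞)} α_u^x Q_{u-}(dx) dC_u]`.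
The right-hand side equals `E[1_{A ∩ {L > a}} ∫_{s∧τ}^{t∧τ} α_u^L dC_u]` because, for predictable
`H ≥ 0`, `E ∫ H_u(L) dC_u = E ∫ ∫ H_u(x) Q_{u-}(dx) dC_u`. The sets `A ∩ {L > a}` generate
`𝓕 s ∨ σ(L)`, and right-continuity carries the martingale property over to the right-continuous
enlargement.

For the identity about `H`, the time change `c ↦ inf {t | c ≤ C_t}` turns `dC` into Lebesgue
measure, so it suffices that `Q_{r-}` integrates like the law of `L` at the first-passage times `r`
of `C`. The graph of `r` is a predictable set. Up to a small probability, it can be replaced by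
a set whose debut is known strictly ahead of time, and `Q_{r-}` is then the limit of the
conditional laws of `L` just before `r`.
-/

noncomputable section

namespace Enlargement

variable {Ω : Type*} {m : MeasurableSpace Ω} {T : ℝ≥0}

/-! ### Discretisation of time -/

section Grid

instance : Inhabited (Time T) := ⟨⊥⟩

lemma coe_bot : ((⊥ : Time T) : ℝ≥0) = 0 := rfl

/-- The smallest point of the grid `{k / (n + 1)}` above `t`, truncated at `T`: right-continuous
processes are evaluated along these points. -/
def gridAbove (n : ℕ) (t : Time T) : Time T :=
  ⟨min (⌈(t : ℝ≥0) * (n + 1)⌉₊ / (n + 1)) T, mem_Iic.2 (min_le_right _ _)⟩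

lemma coe_gridAbove (n : ℕ) (t : Time T) :
    (gridAbove n t : ℝ≥0) = min ((⌈(t : ℝ≥0) * (n + 1)⌉₊ : ℝ≥0) / (n + 1)) T := rfl

lemma le_gridAbove (n : ℕ) (t : Time T) : t ≤ gridAbove n t := by
  rw [← Subtype.coe_le_coe, coe_gridAbove]
  refine le_min ?_ (mem_Iic.1 t.2)
  rw [le_div_iff₀ (by positivity)]
  exact Nat.le_ceil _

lemma monotone_gridAbove (n : ℕ) : Monotone (gridAbove n : Time T → Time T) := by
  intro s t hst
  rw [← Subtype.coe_le_coe, coe_gridAbove, coe_gridAbove]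
  have : (s : ℝ≥0) ≤ t := hst
  gcongr

lemma finite_range_gridAbove (n : ℕ) : (range (gridAbove n : Time T → Time T)).Finite := by
  refine ((Set.finite_Iic ⌈(T : ℝ≥0) * (n + 1)⌉₊).image
    fun k : ℕ ↦ (⟨min (k / (n + 1)) T, mem_Iic.2 (min_le_right _ _)⟩ : Time T)).subset ?_
  rintro _ ⟨t, rfl⟩
  refine ⟨⌈(t : ℝ≥0) * (n + 1)⌉₊, ?_, rfl⟩
  have : (t : ℝ≥0) ≤ T := t.2
  simp only [mem_Iic]
  gcongr

lemma finite_range_gridAbove_min {A : Type*} (r : A → Time T) (n : ℕ) (t : Time T) :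
    (range fun a ↦ min (gridAbove n (r a)) t).Finite :=
  ((finite_range_gridAbove n).image fun s ↦ min s t).subset <| by
    rintro _ ⟨a, rfl⟩
    exact ⟨_, ⟨_, rfl⟩, rfl⟩

lemma tendsto_gridAbove (t : Time T) : Tendsto (fun n ↦ gridAbove n t) atTop (𝓝 t) := by
  rw [tendsto_subtype_rng]
  have hmesh : Tendsto (fun n : ℕ ↦ (t : ℝ≥0) + 1 / ((n : ℝ≥0) + 1)) atTop (𝓝 t) := by
    simpa using tendsto_const_nhds.add (tendsto_one_div_add_atTop_nhds_zero_nat (𝕜 := ℝ≥0))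
  refine tendsto_of_tendsto_of_tendsto_of_le_of_le tendsto_const_nhds hmesh
    (fun n ↦ le_gridAbove n t) fun n ↦ (min_le_left _ _).trans ?_
  rw [div_le_iff₀ (by positivity), add_mul, one_div, inv_mul_cancel₀ (by positivity)]
  exact (Nat.ceil_lt_add_one (by positivity)).le

lemma tendsto_gridAbove_min {s t : Time T} (hst : s ≤ t) :
    Tendsto (fun n ↦ min (gridAbove n s) t) atTop (𝓝[≥] s) := by
  refine tendsto_nhdsWithin_iff.2 ⟨?_, .of_forall fun n ↦ le_min (le_gridAbove n s) hst⟩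
  simpa only [min_eq_left hst] using (tendsto_gridAbove s).min (tendsto_const_nhds (x := t))

/-- The largest point of the grid `{k / (n + 1)}` strictly below `t` (and `0` at `t = 0`): left
limits of processes are evaluated along these points. -/
def gridBelow (n : ℕ) (t : Time T) : Time T :=
  ⟨min ((⌈(t : ℝ≥0) * (n + 1)⌉₊ - 1 : ℕ) / (n + 1)) t, mem_Iic.2 ((min_le_right _ _).trans t.2)⟩

lemma gridBelow_bot (n : ℕ) : gridBelow n (⊥ : Time T) = ⊥ :=
  le_bot_iff.1 <| Subtype.coe_le_coe.1 (min_le_right _ _)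

lemma natCeil_sub_one_div_lt {t : ℝ≥0} (ht : 0 < t) (n : ℕ) :
    ((⌈t * (n + 1)⌉₊ - 1 : ℕ) : ℝ≥0) / (n + 1) < t := by
  rw [div_lt_iff₀ (by positivity)]
  exact Nat.lt_ceil.1 (Nat.sub_lt (Nat.ceil_pos.2 (by positivity)) one_pos)

lemma coe_gridBelow (n : ℕ) (t : Time T) :
    (gridBelow n t : ℝ≥0) = (⌈(t : ℝ≥0) * (n + 1)⌉₊ - 1 : ℕ) / (n + 1) := by
  refine min_eq_left ?_
  rcases eq_zero_or_pos (t : ℝ≥0) with ht | ht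
  · simp [ht]
  · exact (natCeil_sub_one_div_lt ht n).le

lemma gridBelow_lt (n : ℕ) {t : Time T} (ht : ⊥ < t) : gridBelow n t < t := by
  rw [← Subtype.coe_lt_coe, coe_gridBelow]
  exact natCeil_sub_one_div_lt (Subtype.coe_lt_coe.2 ht) n

lemma tendsto_gridBelow {t : Time T} (ht : ⊥ < t) :
    Tendsto (fun n ↦ gridBelow n t) atTop (𝓝[<] t) := by
  refine tendsto_nhdsWithin_iff.2 ⟨?_, .of_forall fun n ↦ gridBelow_lt n ht⟩
  rw [tendsto_subtype_rng]
  have hmesh : Tendsto (fun n : ℕ ↦ (t : ℝ≥0) - 1 / ((n : ℝ≥0) + 1)) atTop (𝓝 t) := by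
    simpa using tendsto_const_nhds.sub (tendsto_one_div_add_atTop_nhds_zero_nat (𝕜 := ℝ≥0))
  refine tendsto_of_tendsto_of_tendsto_of_le_of_le hmesh tendsto_const_nhds
    (fun n ↦ ?_) fun n ↦ (gridBelow_lt n ht).le
  rw [coe_gridBelow, tsub_le_iff_right, ← add_div, le_div_iff₀ (by positivity)]
  refine (Nat.le_ceil _).trans ?_
  exact_mod_cast (by omega : ⌈(t : ℝ≥0) * (n + 1)⌉₊ ≤ ⌈(t : ℝ≥0) * (n + 1)⌉₊ - 1 + 1)

lemma measurable_gridBelow (n : ℕ) : Measurable (gridBelow n : Time T → Time T) := by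
  refine Measurable.subtype_mk (Measurable.min (Measurable.div_const ?_ _) measurable_subtype_coe)
  have h : Measurable fun k : ℕ ↦ ((k - 1 : ℕ) : ℝ≥0) := measurable_from_nat
  exact h.comp (Nat.measurable_ceil.comp (measurable_subtype_coe.mul_const _))

lemma finite_range_gridBelow (n : ℕ) : (range (gridBelow n : Time T → Time T)).Finite := by
  refine Finite.of_finite_image (f := ((↑) : Time T → ℝ≥0)) ?_ Subtype.val_injective.injOn
  refine ((Set.finite_Iic (⌈(T : ℝ≥0) * (n + 1)⌉₊ - 1)).image
    fun k : ℕ ↦ (k : ℝ≥0) / (n + 1)).subset ?_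
  rintro _ ⟨_, ⟨t, rfl⟩, rfl⟩
  refine ⟨⌈(t : ℝ≥0) * (n + 1)⌉₊ - 1, ?_, (coe_gridBelow n t).symm⟩
  have : (t : ℝ≥0) ≤ T := t.2
  simp only [mem_Iic]
  gcongr

end Grid

/-! ### Predictable and progressive processes -/

section Predictable

variable {ι : Type*} [LinearOrder ι] [OrderBot ι] {𝓕 𝓖 : Filtration ι m}

lemma predictable_mono (h : 𝓕 ≤ 𝓖) : 𝓕.predictable ≤ 𝓖.predictable :=
  measurableSpace_le_predictable_of_measurableSet
    (fun _ hA ↦ measurableSet_predictable_singleton_bot_prod (h _ _ hA))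
    fun i _ hA ↦ measurableSet_predictable_Ioi_prod (h i _ hA)

lemma measurableSet_snd_predictable {A : Set Ω} (hA : MeasurableSet[𝓕 ⊥] A) :
    MeasurableSet[𝓕.predictable] {p : ι × Ω | p.2 ∈ A} := by
  convert! (measurableSet_predictable_singleton_bot_prod hA).union
    (measurableSet_predictable_Ioi_prod (i := ⊥) hA) using 1
  ext ⟨t, ω⟩
  by_cases h : t = ⊥ <;> simp [h, bot_lt_iff_ne_bot]

variable [TopologicalSpace ι] [OrderTopology ι] [MeasurableSpace ι] [BorelSpace ι]

lemma predictable_le (𝓕 : Filtration ι m) :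
    𝓕.predictable ≤ (inferInstance : MeasurableSpace (ι × Ω)) :=
  measurableSpace_le_predictable_of_measurableSet
    (fun _ hA ↦ (measurableSet_singleton _).prod (𝓕.le _ _ hA))
    fun _ _ hA ↦ measurableSet_Ioi.prod (𝓕.le _ _ hA)

variable [SecondCountableTopology ι]

lemma measurable_fst_predictable (𝓕 : Filtration ι m) :
    Measurable[𝓕.predictable] (Prod.fst : ι × Ω → ι) := by
  refine measurable_of_Ioi fun t ↦ ?_
  convert! measurableSet_predictable_Ioi_prod (𝓕 := 𝓕) (i := t) MeasurableSet.univ using 1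
  ext; simp

lemma measurableSet_predictable_prod {t : ι} {B : Set ι} (hB : MeasurableSet B) (hBt : B ⊆ Ioi t)
    {A : Set Ω} (hA : MeasurableSet[𝓕 t] A) : MeasurableSet[𝓕.predictable] (B ×ˢ A) := by
  convert! (measurable_fst_predictable 𝓕 hB).inter
    (measurableSet_predictable_Ioi_prod (i := t) hA) using 1
  ext ⟨s, ω⟩
  simp only [mem_prod, mem_inter_iff, mem_preimage, mem_Ioi]
  exact ⟨fun h ↦ ⟨h.1, hBt h.1, h.2⟩, fun h ↦ ⟨h.1, h.2.2⟩⟩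

end Predictable

lemma preimage_uncurry_comp {A ι B : Type*} (g : A → ι) (u : ι → Ω → B) (s : Set B) :
    (fun p : A × Ω ↦ u (g p.1) p.2) ⁻¹' s = ⋃ i ∈ range g, (g ⁻¹' {i}) ×ˢ (u i ⁻¹' s) := by
  ext ⟨a, ω⟩
  simp only [mem_preimage, mem_iUnion, mem_prod, mem_singleton_iff, exists_prop]
  exact ⟨fun h ↦ ⟨_, ⟨a, rfl⟩, rfl, h⟩, fun ⟨i, _, h, h'⟩ ↦ by rwa [h]⟩

lemma measurable_uncurry_comp {A ι B : Type*} [MeasurableSpace A] [MeasurableSpace B]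
    {m' : MeasurableSpace Ω} {g : A → ι} (hg : (range g).Countable)
    (hgm : ∀ i, MeasurableSet (g ⁻¹' {i})) {u : ι → Ω → B} (hu : ∀ a, Measurable (u (g a))) :
    Measurable fun p : A × Ω ↦ u (g p.1) p.2 := by
  intro s hs
  rw [preimage_uncurry_comp]
  refine MeasurableSet.biUnion hg ?_
  rintro _ ⟨a, rfl⟩
  exact (hgm _).prod (hu a hs)

/-- Right-continuity of a path, the first half of `IsCadlag`. -/
abbrev RightContinuous {ι E : Type*} [Preorder ι] [TopologicalSpace ι] [TopologicalSpace E]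
    (f : ι → E) : Prop :=
  ∀ t, ContinuousWithinAt f (Ici t) t

lemma IsCadlag.rightContinuous {E : Type*} [TopologicalSpace E] {f : Time T → E}
    (hf : IsCadlag f) : RightContinuous f :=
  fun t ↦ (hf t).1

lemma isStronglyProgressive_of_rightContinuous {E : Type*} [TopologicalSpace E]
    [TopologicalSpace.PseudoMetrizableSpace E] [SecondCountableTopology E]
    {𝓕 : Filtration (Time T) m} {X : Time T → Ω → E} (hX : StronglyAdapted 𝓕 X)
    (hc : ∀ ω, RightContinuous fun t ↦ X t ω) :
    IsStronglyProgressive 𝓕 X := by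
  intro t
  borelize E
  refine Measurable.stronglyMeasurable ?_
  let g : ℕ → Iic t → Time T := fun n s ↦ min (gridAbove n s) t
  refine @measurable_of_tendsto_metrizable _ _ (_) _ _ _ _
    (fun n (p : Iic t × Ω) ↦ X (g n p.1) p.2) _ (fun n ↦ ?_) ?_
  · refine measurable_uncurry_comp (g := g n) (finite_range_gridAbove_min _ n t).countable
      (fun i ↦ ?_) fun s ↦ (hX.stronglyMeasurable_le (min_le_right _ _)).measurable
    have hg : Measurable (g n) :=
      ((monotone_gridAbove n).measurable.comp measurable_subtype_coe).min measurable_const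
    exact hg (measurableSet_singleton i)
  · rw [tendsto_pi_nhds]
    rintro ⟨⟨s, hs⟩, ω⟩
    exact (hc ω s).tendsto.comp (tendsto_gridAbove_min hs)

lemma measurableSet_predictable_gridBelow {𝓕 : Filtration (Time T) m} {A : Set Ω} (n : ℕ)
    (i : Time T) (hA : MeasurableSet[𝓕 i] A) :
    MeasurableSet[𝓕.predictable] ((gridBelow n ⁻¹' {i}) ×ˢ A) := by
  have hm : MeasurableSet (gridBelow n ⁻¹' {i}) :=
    measurable_gridBelow n (measurableSet_singleton i)
  rcases eq_or_ne i ⊥ with rfl | hi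
  · exact (measurable_fst_predictable 𝓕 hm).inter (measurableSet_snd_predictable hA)
  · refine measurableSet_predictable_prod hm ?_ hA
    rintro t rfl
    exact gridBelow_lt n (bot_lt_iff_ne_bot.2 fun ht ↦ hi (by rw [ht, gridBelow_bot]))

lemma measurable_predictable_leftLimit {𝓕 : Filtration (Time T) m} {B : Type*}
    [TopologicalSpace B] [TopologicalSpace.PseudoMetrizableSpace B] [MeasurableSpace B]
    [BorelSpace B] {X Y : Time T → Ω → B} (hX : ∀ t, Measurable[𝓕 t] (X t))
    (h0 : ∀ ω, Y ⊥ ω = X ⊥ ω)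
    (hY : ∀ ω t, ⊥ < t → Tendsto (fun s ↦ X s ω) (𝓝[<] t) (𝓝 (Y t ω))) :
    Measurable[𝓕.predictable] fun p : Time T × Ω ↦ Y p.1 p.2 := by
  refine @measurable_of_tendsto_metrizable _ _ 𝓕.predictable _ _ _ _
    (fun n p ↦ X (gridBelow n p.1) p.2) _ (fun n s hs ↦ ?_) ?_
  · rw [preimage_uncurry_comp]
    exact MeasurableSet.biUnion (finite_range_gridBelow n).countable fun i _ ↦
      measurableSet_predictable_gridBelow n i (hX i hs)
  · rw [tendsto_pi_nhds]
    rintro ⟨t, ω⟩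
    rcases eq_or_ne t ⊥ with rfl | ht
    · simpa only [gridBelow_bot, h0] using tendsto_const_nhds
    · exact (hY ω t (bot_lt_iff_ne_bot.2 ht)).comp (tendsto_gridBelow (bot_lt_iff_ne_bot.2 ht))

/-! ### Complete filtrations -/

lemma measurable_of_ae_eq {P : Measure Ω} {m' : MeasurableSpace Ω}
    (hnull : ∀ s, P s = 0 → MeasurableSet[m'] s) {B : Type*} [MeasurableSpace B] {f g : Ω → B}
    (hf : Measurable[m'] f) (hfg : f =ᵐ[P] g) : Measurable[m'] g := by
  intro s hs
  have hg : g ⁻¹' s = (f ⁻¹' s \ {ω | f ω ≠ g ω}) ∪ (g ⁻¹' s ∩ {ω | f ω ≠ g ω}) := by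
    ext ω
    by_cases hω : f ω = g ω <;> simp [hω]
  have hne : P {ω | f ω ≠ g ω} = 0 := ae_iff.1 hfg
  rw [hg]
  exact ((hf hs).diff (hnull _ hne)).union (hnull _ (measure_mono_null inter_subset_right hne))

section Complete

variable {𝓕 : Filtration (Time T) m} {P : Measure Ω}

lemma UsualConditions.measurable_congr (h𝓕 : UsualConditions 𝓕 P) {B : Type*}
    [MeasurableSpace B] {f g : Ω → B} {t : Time T} (hf : Measurable[𝓕 t] f)
    (hfg : f =ᵐ[P] g) : Measurable[𝓕 t] g :=
  measurable_of_ae_eq (fun s hs ↦ 𝓕.mono bot_le s (h𝓕.null s hs)) hf hfg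

lemma UsualConditions.stronglyMeasurable_congr (h𝓕 : UsualConditions 𝓕 P) {f g : Ω → ℝ}
    {t : Time T} (hf : StronglyMeasurable[𝓕 t] f) (hfg : f =ᵐ[P] g) :
    StronglyMeasurable[𝓕 t] g :=
  (h𝓕.measurable_congr hf.measurable hfg).stronglyMeasurable

lemma UsualConditions.martingale_congr (h𝓕 : UsualConditions 𝓕 P) {X Y : Time T → Ω → ℝ}
    (hX : Martingale X 𝓕 P) (hXY : ∀ t, X t =ᵐ[P] Y t) : Martingale Y 𝓕 P :=
  ⟨fun t ↦ h𝓕.stronglyMeasurable_congr (hX.1 t) (hXY t), fun s t hst ↦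
    (condExp_congr_ae (hXY t).symm).trans ((hX.2 s t hst).trans (hXY s))⟩

lemma UsualConditions.exists_modification (h𝓕 : UsualConditions 𝓕 P) {X : Time T → Ω → ℝ}
    (hX : StronglyAdapted 𝓕 X) {p : (Time T → ℝ) → Prop} (h0 : p fun _ ↦ 0)
    (hp : ∀ᵐ ω ∂P, p fun t ↦ X t ω) :
    ∃ Y : Time T → Ω → ℝ, StronglyAdapted 𝓕 Y ∧ (∀ ω, p fun t ↦ Y t ω) ∧
      ∀ᵐ ω ∂P, ∀ t, X t ω = Y t ω := by
  classical
  let Y : Time T → Ω → ℝ := fun t ω ↦ if p fun t ↦ X t ω then X t ω else 0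
  have hXY : ∀ᵐ ω ∂P, ∀ t, X t ω = Y t ω := by
    filter_upwards [hp] with ω hω t
    rw [show Y t ω = X t ω from if_pos hω]
  refine ⟨Y, fun t ↦ h𝓕.stronglyMeasurable_congr (hX t) (hXY.mono fun ω hω ↦ hω t),
    fun ω ↦ ?_, hXY⟩
  by_cases hω : p fun t ↦ X t ω
  · simpa only [Y, if_pos hω] using hω
  · simpa only [Y, if_neg hω] using h0

end Complete

/-! ### Optional sampling -/

lemma tendsto_setIntegral_of_ae_eq_condExp {P : Measure Ω} [IsFiniteMeasure P] {Z : Ω → ℝ}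
    (hZ : Integrable Z P) {M : ℕ → MeasurableSpace Ω} (hM : ∀ n, M n ≤ m) {Y : ℕ → Ω → ℝ}
    {y : Ω → ℝ} (hY : ∀ n, Y n =ᵐ[P] P[Z | M n])
    (hy : ∀ᵐ ω ∂P, Tendsto (fun n ↦ Y n ω) atTop (𝓝 (y ω))) :
    Integrable y P ∧ ∀ s, Tendsto (fun n ↦ ∫ ω in s, Y n ω ∂P) atTop (𝓝 (∫ ω in s, y ω ∂P)) := by
  have hui : UniformIntegrable Y 1 P := (hZ.uniformIntegrable_condExp hM).ae_eq fun n ↦ (hY n).symm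
  have hint : Integrable y P := memLp_one_iff_integrable.1 (hui.memLp_of_ae_tendsto hy)
  refine ⟨hint, tendsto_setIntegral_of_L1' _ hint.1
    (Eventually.of_forall fun n ↦ integrable_condExp.congr (hY n).symm) ?_⟩
  exact tendsto_Lp_finite_of_tendsto_ae le_rfl ENNReal.one_ne_top hui.1
    (memLp_one_iff_integrable.2 hint) hui.2.1 hy

section OptionalSampling

variable {𝓕 : Filtration (Time T) m} {r : Ω → Time T}

lemma measurable_of_isStoppingTime_of_le
    (hr : IsStoppingTime 𝓕 fun ω ↦ (r ω : WithTop (Time T)))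
    {t : Time T} (hle : ∀ ω, r ω ≤ t) : Measurable[𝓕 t] r := by
  simpa only [WithTop.untopD_coe] using
    (hr.measurable_of_le fun ω ↦ WithTop.coe_le_coe.2 (hle ω)).untopA

lemma measurableSet_preimage_of_isStoppingTime
    (hr : IsStoppingTime 𝓕 fun ω ↦ (r ω : WithTop (Time T)))
    {t : Time T} {B : Set (Time T)} (hB : MeasurableSet B) (hBt : B ⊆ Iic t) :
    MeasurableSet[𝓕 t] (r ⁻¹' B) := by
  have hmin : Measurable[𝓕 t] fun ω ↦ min (r ω) t :=
    measurable_of_isStoppingTime_of_le (by simpa only [WithTop.coe_min] using hr.min_const t)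
      fun ω ↦ min_le_right _ _
  have hrB : r ⁻¹' B = {ω | (r ω : WithTop (Time T)) ≤ t} ∩ (fun ω ↦ min (r ω) t) ⁻¹' B := by
    ext ω
    simp only [mem_preimage, mem_inter_iff, mem_ofPred_eq, WithTop.coe_le_coe]
    refine ⟨fun hω ↦ ⟨hBt hω, by rwa [min_eq_left (hBt hω)]⟩, fun ⟨hle, hω⟩ ↦ ?_⟩
    rwa [min_eq_left hle] at hω
  rw [hrB]
  exact (hr.measurableSet_le t).inter (hmin hB)

lemma isStoppingTime_gridAbove_min (hr : IsStoppingTime 𝓕 fun ω ↦ (r ω : WithTop (Time T)))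
    (n : ℕ) (t : Time T) :
    IsStoppingTime 𝓕 fun ω ↦ ((min (gridAbove n (r ω)) t : Time T) : WithTop (Time T)) := by
  have h : IsStoppingTime 𝓕 fun ω ↦ ((gridAbove n (r ω) : Time T) : WithTop (Time T)) := by
    intro u
    simp only [WithTop.coe_le_coe]
    exact measurableSet_preimage_of_isStoppingTime (B := {s | gridAbove n s ≤ u}) hr
      ((monotone_gridAbove n).measurable measurableSet_Iic) fun s hs ↦ (le_gridAbove n s).trans hs
  simpa only [WithTop.coe_min] using h.min_const t

variable {P : Measure Ω} {X : Time T → Ω → ℝ}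

lemma exists_measurable_ae_eq_sampled (h𝓕 : UsualConditions 𝓕 P) (hX : StronglyAdapted 𝓕 X)
    (hc : ∀ᵐ ω ∂P, RightContinuous fun t ↦ X t ω)
    (hr : IsStoppingTime 𝓕 fun ω ↦ (r ω : WithTop (Time T))) :
    ∃ Y : Ω → ℝ, Measurable[hr.measurableSpace] Y ∧ (fun ω ↦ X (r ω) ω) =ᵐ[P] Y := by
  obtain ⟨Y, hY, hYc, hXY⟩ := h𝓕.exists_modification hX (fun t ↦ continuousWithinAt_const) hc
  refine ⟨_, measurable_stoppedValue (isStronglyProgressive_of_rightContinuous hY hYc) hr, ?_⟩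
  filter_upwards [hXY] with ω hω
  simp only [stoppedValue, WithTop.untopD_coe, hω]

lemma stronglyMeasurable_sampled_of_le (h𝓕 : UsualConditions 𝓕 P) (hX : StronglyAdapted 𝓕 X)
    (hc : ∀ᵐ ω ∂P, RightContinuous fun t ↦ X t ω)
    (hr : IsStoppingTime 𝓕 fun ω ↦ (r ω : WithTop (Time T))) {t : Time T} (hle : ∀ ω, r ω ≤ t) :
    StronglyMeasurable[𝓕 t] fun ω ↦ X (r ω) ω := by
  obtain ⟨Y, hY, hXY⟩ := exists_measurable_ae_eq_sampled h𝓕 hX hc hr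
  refine h𝓕.stronglyMeasurable_congr (Measurable.stronglyMeasurable (hY.mono ?_ le_rfl)) hXY.symm
  exact hr.measurableSpace_le_of_le_const fun ω ↦ WithTop.coe_le_coe.2 (hle ω)

lemma martingale_gridAbove_ae_eq_condExp [IsFiniteMeasure P] (hX : Martingale X 𝓕 P)
    (hr : IsStoppingTime 𝓕 fun ω ↦ (r ω : WithTop (Time T))) (n : ℕ) (t : Time T) :
    (fun ω ↦ X (min (gridAbove n (r ω)) t) ω)
      =ᵐ[P] P[X t | (isStoppingTime_gridAbove_min hr n t).measurableSpace] := by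
  have hcount : (range fun ω ↦
      ((min (gridAbove n (r ω)) t : Time T) : WithTop (Time T))).Countable := by
    rw [range_comp' (fun s : Time T ↦ (s : WithTop (Time T))) fun ω ↦ min (gridAbove n (r ω)) t]
    exact ((finite_range_gridAbove_min r n t).image _).countable
  simpa +unfoldPartialApp only [stoppedValue, WithTop.untopD_coe] using
    hX.stoppedValue_ae_eq_condExp_of_le_const_of_countable_range
      (isStoppingTime_gridAbove_min hr n t)
      (fun ω ↦ WithTop.coe_le_coe.2 (min_le_right _ _)) hcount

-- Approximating `r` by grid-valued times from above reduces to the countable optional sampling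
-- theorem; conditional expectations of `X t` are uniformly integrable, so the limit is in `L¹`.
theorem martingale_sampled_ae_eq_condExp [IsFiniteMeasure P] (h𝓕 : UsualConditions 𝓕 P)
    (hX : Martingale X 𝓕 P) (hc : ∀ᵐ ω ∂P, RightContinuous fun t ↦ X t ω)
    (hr : IsStoppingTime 𝓕 fun ω ↦ (r ω : WithTop (Time T))) {t : Time T} (hle : ∀ ω, r ω ≤ t) :
    (fun ω ↦ X (r ω) ω) =ᵐ[P] P[X t | hr.measurableSpace] := by
  let q : ℕ → Ω → Time T := fun n ω ↦ min (gridAbove n (r ω)) t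
  have hq := fun n ↦ isStoppingTime_gridAbove_min hr n t
  have hrq : ∀ n, (fun ω ↦ (r ω : WithTop (Time T))) ≤ fun ω ↦ (q n ω : WithTop (Time T)) :=
    fun n ω ↦ WithTop.coe_le_coe.2 (le_min (le_gridAbove n _) (hle ω))
  have hY : ∀ n, (fun ω ↦ X (q n ω) ω) =ᵐ[P] P[X t | (hq n).measurableSpace] :=
    fun n ↦ martingale_gridAbove_ae_eq_condExp hX hr n t
  have hqr : ∀ᵐ ω ∂P, Tendsto (fun n ↦ X (q n ω) ω) atTop (𝓝 (X (r ω) ω)) := by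
    filter_upwards [hc] with ω hω
    exact (hω (r ω)).tendsto.comp (tendsto_gridAbove_min (hle ω))
  obtain ⟨hint, hlim⟩ := tendsto_setIntegral_of_ae_eq_condExp (hX.integrable t)
    (fun n ↦ (hq n).measurableSpace_le) hY hqr
  obtain ⟨Y, hYm, hXY⟩ := exists_measurable_ae_eq_sampled h𝓕 hX.1 hc hr
  refine ae_eq_condExp_of_forall_setIntegral_eq hr.measurableSpace_le (hX.integrable t)
    (fun s _ _ ↦ hint.integrableOn) (fun s hs _ ↦ ?_) ⟨Y, hYm.stronglyMeasurable, hXY⟩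
  refine tendsto_nhds_unique (hlim s) (tendsto_const_nhds.congr fun n ↦ ?_)
  rw [← setIntegral_condExp (hq n).measurableSpace_le (hX.integrable t)
    (IsStoppingTime.measurableSpace_mono hr (hq n) (hrq n) s hs)]
  exact setIntegral_congr_ae (hr.measurableSpace_le s hs) ((hY n).mono fun ω hω _ ↦ hω.symm)

end OptionalSampling

/-! ### Stopped processes -/

lemma martingale_of_setIntegral_sub {ι : Type*} [LinearOrder ι] {𝓕 : Filtration ι m}
    {P : Measure Ω} [IsFiniteMeasure P] {X : ι → Ω → ℝ}
    (hX : StronglyAdapted 𝓕 X) (hi : ∀ t, Integrable (X t) P)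
    (h : ∀ s t, s < t → ∀ B, MeasurableSet[𝓕 s] B → ∫ ω in B, (X t ω - X s ω) ∂P = 0) :
    Martingale X 𝓕 P := by
  refine ⟨hX, fun s t hst ↦ ?_⟩
  rcases hst.eq_or_lt with rfl | hst
  · exact (condExp_of_stronglyMeasurable (𝓕.le _) (hX _) (hi _)).eventuallyEq
  refine (ae_eq_condExp_of_forall_setIntegral_eq (𝓕.le s) (hi t)
    (fun _ _ _ ↦ (hi s).integrableOn) (fun B hB _ ↦ ?_) (hX s).aestronglyMeasurable).symm
  rw [eq_comm, ← sub_eq_zero, ← integral_sub (hi t).integrableOn (hi s).integrableOn]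
  exact h s t hst B hB

section StopAt

variable {ι : Type*} [LinearOrder ι] [Nonempty ι] {τ : Ω → WithTop ι} {s t : ι} {ω : Ω}

/-- The time `t ∧ τ`, as an element of the index set, so that `X (stopAt τ t ω) ω` is the value at
time `t` of the process `X` stopped at `τ`. -/
def stopAt (τ : Ω → WithTop ι) (t : ι) (ω : Ω) : ι :=
  (min (t : WithTop ι) (τ ω)).untopA

lemma coe_stopAt (τ : Ω → WithTop ι) (t : ι) (ω : Ω) :
    ((stopAt τ t ω : ι) : WithTop ι) = min (t : WithTop ι) (τ ω) := by
  cases h : τ ω with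
  | top => simp only [stopAt, h, min_top_right, WithTop.untopD_coe]
  | coe u => simp only [stopAt, h, ← WithTop.coe_min, WithTop.untopD_coe]

lemma stopAt_le (τ : Ω → WithTop ι) (t : ι) (ω : Ω) : stopAt τ t ω ≤ t := by
  rw [← WithTop.coe_le_coe, coe_stopAt]
  exact min_le_left _ _

lemma coe_stopAt_le (τ : Ω → WithTop ι) (t : ι) (ω : Ω) :
    ((stopAt τ t ω : ι) : WithTop ι) ≤ τ ω := by
  rw [coe_stopAt]
  exact min_le_right _ _

lemma stopAt_of_le (h : (t : WithTop ι) ≤ τ ω) : stopAt τ t ω = t := by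
  rw [← WithTop.coe_inj, coe_stopAt, min_eq_left h]

lemma stopAt_of_ge (h : τ ω = s) (hst : s ≤ t) : stopAt τ t ω = s := by
  rw [← WithTop.coe_inj, coe_stopAt, h, min_eq_right (WithTop.coe_le_coe.2 hst)]

lemma stopAt_eq_of_le (hst : s ≤ t) (h : τ ω ≤ s) : stopAt τ t ω = stopAt τ s ω := by
  rw [← WithTop.coe_inj, coe_stopAt, coe_stopAt, min_eq_right h,
    min_eq_right (h.trans (WithTop.coe_le_coe.2 hst))]

lemma monotone_stopAt (τ : Ω → WithTop ι) (ω : Ω) : Monotone fun t ↦ stopAt τ t ω := by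
  intro s t hst
  beta_reduce
  rw [← WithTop.coe_le_coe, coe_stopAt, coe_stopAt]
  exact min_le_min (WithTop.coe_le_coe.2 hst) le_rfl

lemma le_stopAt (hst : s ≤ t) (h : (s : WithTop ι) ≤ τ ω) : s ≤ stopAt τ t ω := by
  rw [← WithTop.coe_le_coe, coe_stopAt]
  exact le_min (WithTop.coe_le_coe.2 hst) h

lemma isStoppingTime_stopAt {𝓕 : Filtration ι m} (hτ : IsStoppingTime 𝓕 τ) (t : ι) :
    IsStoppingTime 𝓕 fun ω ↦ ((stopAt τ t ω : ι) : WithTop ι) := by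
  simp_rw [coe_stopAt, min_comm (t : WithTop ι)]
  exact hτ.min_const t

variable [TopologicalSpace ι]

lemma continuous_stopAt [OrderClosedTopology ι] (τ : Ω → WithTop ι) (ω : Ω) :
    Continuous fun t ↦ stopAt τ t ω := by
  cases h : τ ω with
  | top =>
    simpa only [stopAt, h, min_top_right, WithTop.untopD_coe] using continuous_id'
  | coe u =>
    simpa only [stopAt, h, ← WithTop.coe_min, WithTop.untopD_coe] using
      continuous_id'.min continuous_const

lemma rightContinuous_stopAt [OrderClosedTopology ι] {E : Type*} [TopologicalSpace E] {f : ι → E}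
    (hf : RightContinuous f) (τ : Ω → WithTop ι) (ω : Ω) :
    RightContinuous fun t ↦ f (stopAt τ t ω) :=
  fun _ ↦ (hf _).comp (continuous_stopAt τ ω).continuousWithinAt
    fun _ hs ↦ monotone_stopAt τ ω hs

end StopAt

section Stopped

variable {ι : Type*} [LinearOrder ι] [OrderBot ι] {τ : Ω → WithTop ι}

/-- The process `1_{τ > 0} X_{t ∧ τ}`, through which local martingales are localized so that the
initial value need not be integrable. -/
def stopped (τ : Ω → WithTop ι) (X : ι → Ω → ℝ) (t : ι) (ω : Ω) : ℝ :=
  {ω | ⊥ < τ ω}.indicator (fun ω ↦ X (stopAt τ t ω) ω) ω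

lemma stoppedProcess_indicator (τ : Ω → WithTop ι) (X : ι → Ω → ℝ) :
    stoppedProcess (fun i ↦ {ω | ⊥ < τ ω}.indicator (X i)) τ = stopped τ X :=
  rfl

lemma stopped_of_lt {X : ι → Ω → ℝ} {t s : ι} {ω : Ω} (h : (s : WithTop ι) < τ ω) :
    stopped τ X t ω = X (stopAt τ t ω) ω :=
  indicator_of_mem (s := {ω | ⊥ < τ ω}) (bot_le.trans_lt h) _

lemma stopped_eq_of_le {X : ι → Ω → ℝ} {s t : ι} {ω : Ω} (hst : s ≤ t) (h : τ ω ≤ s) :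
    stopped τ X t ω = stopped τ X s ω := by
  simp only [stopped, indicator, stopAt_eq_of_le hst h]

lemma rightContinuous_stopped [TopologicalSpace ι] [OrderClosedTopology ι] {X : ι → Ω → ℝ}
    {ω : Ω} (hc : RightContinuous fun t ↦ X t ω) : RightContinuous fun t ↦ stopped τ X t ω := by
  by_cases h : ω ∈ {ω | ⊥ < τ ω}
  · simpa only [stopped, indicator_of_mem h] using rightContinuous_stopAt hc τ ω
  · simpa only [stopped, indicator_of_notMem h] using fun t ↦ continuousWithinAt_const

variable {𝓕 : Filtration ι m}

lemma measurableSet_bot_lt (hτ : IsStoppingTime 𝓕 τ) : MeasurableSet[𝓕 ⊥] {ω | ⊥ < τ ω} :=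
  hτ.measurableSet_gt ⊥

lemma measurableSet_inter_lt_stopAt (hτ : IsStoppingTime 𝓕 τ) {s t : ι} (hst : s ≤ t)
    {B : Set Ω} (hB : MeasurableSet[𝓕 s] B) :
    MeasurableSet[(isStoppingTime_stopAt hτ t).measurableSpace] (B ∩ {ω | s < τ ω}) := by
  have h : MeasurableSet[𝓕 s] (B ∩ {ω | s < τ ω}) := hB.inter (hτ.measurableSet_gt s)
  refine ⟨le_iSup 𝓕.seq s _ h, fun i ↦ ?_⟩
  rcases le_or_gt s i with hi | hi
  · exact (𝓕.mono hi _ h).inter (isStoppingTime_stopAt hτ t i)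
  · have hempty : B ∩ {ω | (s : WithTop ι) < τ ω} ∩
        {ω | ((stopAt τ t ω : ι) : WithTop ι) ≤ i} = ∅ :=
      eq_empty_of_forall_notMem fun ω ⟨⟨_, hs⟩, hle⟩ ↦
        hi.not_ge ((le_stopAt hst hs.le).trans (WithTop.coe_le_coe.1 hle))
    rw [hempty]
    exact @MeasurableSet.empty _ (𝓕 i)

end Stopped

section StoppedMartingale

variable {𝓕 : Filtration (Time T) m} {P : Measure Ω} [IsFiniteMeasure P]
  {τ : Ω → WithTop (Time T)} {X : Time T → Ω → ℝ}

lemma integrable_stopAt (h𝓕 : UsualConditions 𝓕 P) (hX : Martingale X 𝓕 P)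
    (hc : ∀ᵐ ω ∂P, RightContinuous fun t ↦ X t ω) (hτ : IsStoppingTime 𝓕 τ) (t : Time T) :
    Integrable (fun ω ↦ X (stopAt τ t ω) ω) P :=
  integrable_condExp.congr (martingale_sampled_ae_eq_condExp h𝓕 hX hc (isStoppingTime_stopAt hτ t)
    fun ω ↦ stopAt_le τ t ω).symm

lemma setIntegral_stopAt (h𝓕 : UsualConditions 𝓕 P) (hX : Martingale X 𝓕 P)
    (hc : ∀ᵐ ω ∂P, RightContinuous fun t ↦ X t ω) (hτ : IsStoppingTime 𝓕 τ) {s t : Time T}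
    (hst : s ≤ t) {B : Set Ω} (hB : MeasurableSet[𝓕 s] B) :
    ∫ ω in B ∩ {ω | s < τ ω}, X (stopAt τ t ω) ω ∂P = ∫ ω in B ∩ {ω | s < τ ω}, X s ω ∂P := by
  have h := martingale_sampled_ae_eq_condExp h𝓕 hX hc (isStoppingTime_stopAt hτ t)
    fun ω ↦ stopAt_le τ t ω
  have hm := measurableSet_inter_lt_stopAt hτ hst hB
  rw [hX.setIntegral_eq hst (hB.inter (hτ.measurableSet_gt s)),
    ← setIntegral_condExp (isStoppingTime_stopAt hτ t).measurableSpace_le (hX.integrable t) hm]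
  exact setIntegral_congr_ae ((isStoppingTime_stopAt hτ t).measurableSpace_le _ hm)
    (h.mono fun ω hω _ ↦ hω)

theorem martingale_stopped (h𝓕 : UsualConditions 𝓕 P) (hX : Martingale X 𝓕 P)
    (hc : ∀ᵐ ω ∂P, RightContinuous fun t ↦ X t ω) (hτ : IsStoppingTime 𝓕 τ) :
    Martingale (stopped τ X) 𝓕 P := by
  have hint : ∀ t, Integrable (stopped τ X t) P := fun t ↦
    (integrable_stopAt h𝓕 hX hc hτ t).indicator (𝓕.le _ _ (measurableSet_bot_lt hτ))
  refine martingale_of_setIntegral_sub (fun t ↦ ?_) hint fun s t hst B hB ↦ ?_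
  · exact (stronglyMeasurable_sampled_of_le h𝓕 hX.1 hc (isStoppingTime_stopAt hτ t)
      fun ω ↦ stopAt_le τ t ω).indicator (𝓕.mono bot_le _ (measurableSet_bot_lt hτ))
  have hS : MeasurableSet (B ∩ {ω | s < τ ω}) := 𝓕.le s _ (hB.inter (hτ.measurableSet_gt s))
  have hzero : ∀ ω ∈ B \ (B ∩ {ω | s < τ ω}), stopped τ X t ω - stopped τ X s ω = 0 := by
    intro ω hω
    rw [stopped_eq_of_le hst.le (not_lt.1 fun h ↦ hω.2 ⟨hω.1, h⟩), sub_self]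
  calc ∫ ω in B, (stopped τ X t ω - stopped τ X s ω) ∂P
      = ∫ ω in B ∩ {ω | s < τ ω}, (stopped τ X t ω - stopped τ X s ω) ∂P :=
        setIntegral_eq_of_subset_of_forall_sdiff_eq_zero (𝓕.le s B hB) inter_subset_left hzero
    _ = ∫ ω in B ∩ {ω | s < τ ω}, (X (stopAt τ t ω) ω - X s ω) ∂P :=
        setIntegral_congr_fun hS fun ω hω ↦ by
          simp only [stopped_of_lt hω.2, stopAt_of_le hω.2.le]
    _ = 0 := by
        rw [integral_sub (integrable_stopAt h𝓕 hX hc hτ t).integrableOn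
          (hX.integrable s).integrableOn, setIntegral_stopAt h𝓕 hX hc hτ hst.le hB, sub_self]

end StoppedMartingale

/-! ### Inner approximation of predictable sets by foretold sets -/

section Foretold

/-- The time `t - δ`, truncated at `0`. -/
def shiftBack (t : Time T) (δ : ℝ≥0) : Time T := ⟨t - δ, mem_Iic.2 (tsub_le_self.trans t.2)⟩

lemma coe_shiftBack (t : Time T) (δ : ℝ≥0) : (shiftBack t δ : ℝ≥0) = t - δ := rfl

lemma shiftBack_le (t : Time T) (δ : ℝ≥0) : shiftBack t δ ≤ t := by
  rw [← Subtype.coe_le_coe, coe_shiftBack]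
  exact tsub_le_self

lemma shiftBack_anti (t : Time T) {δ δ' : ℝ≥0} (h : δ ≤ δ') : shiftBack t δ' ≤ shiftBack t δ := by
  rw [← Subtype.coe_le_coe, coe_shiftBack, coe_shiftBack]
  exact tsub_le_tsub_left h _

lemma shiftBack_lt {t : Time T} {δ : ℝ≥0} (ht : ⊥ < t) (hδ : 0 < δ) : shiftBack t δ < t := by
  rw [← Subtype.coe_lt_coe, coe_bot] at ht
  rw [← Subtype.coe_lt_coe, coe_shiftBack]
  exact tsub_lt_self ht hδ

lemma shiftBack_mono (δ : ℝ≥0) : Monotone fun t : Time T ↦ shiftBack t δ := by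
  intro s t h
  rw [← Subtype.coe_le_coe, coe_shiftBack, coe_shiftBack]
  exact tsub_le_tsub_right (Subtype.coe_le_coe.2 h) _

/-- Sets whose paths are finite unions of closed intervals with left end points in a fixed finite
set, and whose value at time `t` is known `δ` before `t`. -/
def IsForetold (𝓕 : Filtration (Time T) m) (E : Set (Time T × Ω)) : Prop :=
  ∃ δ : ℝ≥0, 0 < δ ∧ (∀ t, MeasurableSet[𝓕 (shiftBack t δ)] {ω | (t, ω) ∈ E}) ∧
    (∀ ω, IsClosed {t | (t, ω) ∈ E}) ∧ ∃ F : Finset (Time T),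
      ∀ t ω, (t, ω) ∈ E → ∃ f ∈ F, f ≤ t ∧ ∀ u, f ≤ u → u ≤ t → (u, ω) ∈ E

variable {𝓕 : Filtration (Time T) m}

lemma IsForetold.empty : IsForetold 𝓕 (∅ : Set (Time T × Ω)) :=
  ⟨1, one_pos, by simp, by simp, ∅, by simp⟩

lemma IsForetold.union {E F : Set (Time T × Ω)} (hE : IsForetold 𝓕 E) (hF : IsForetold 𝓕 F) :
    IsForetold 𝓕 (E ∪ F) := by
  classical
  obtain ⟨δ, hδ, hm, hc, S, hS⟩ := hE
  obtain ⟨δ', hδ', hm', hc', S', hS'⟩ := hF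
  refine ⟨min δ δ', lt_min hδ hδ', fun t ↦ ?_, fun ω ↦ (hc ω).union (hc' ω), S ∪ S', ?_⟩
  · exact (𝓕.mono (shiftBack_anti t (min_le_left _ _)) _ (hm t)).union
      (𝓕.mono (shiftBack_anti t (min_le_right _ _)) _ (hm' t))
  · rintro t ω (h | h)
    · obtain ⟨f, hf, hft, h⟩ := hS t ω h
      exact ⟨f, Finset.mem_union_left _ hf, hft, fun u h1 h2 ↦ Or.inl (h u h1 h2)⟩
    · obtain ⟨f, hf, hft, h⟩ := hS' t ω h
      exact ⟨f, Finset.mem_union_right _ hf, hft, fun u h1 h2 ↦ Or.inr (h u h1 h2)⟩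

lemma IsForetold.inter {E F : Set (Time T × Ω)} (hE : IsForetold 𝓕 E) (hF : IsForetold 𝓕 F) :
    IsForetold 𝓕 (E ∩ F) := by
  classical
  obtain ⟨δ, hδ, hm, hc, S, hS⟩ := hE
  obtain ⟨δ', hδ', hm', hc', S', hS'⟩ := hF
  refine ⟨min δ δ', lt_min hδ hδ', fun t ↦ ?_, fun ω ↦ (hc ω).inter (hc' ω), S ∪ S', ?_⟩
  · exact (𝓕.mono (shiftBack_anti t (min_le_left _ _)) _ (hm t)).inter
      (𝓕.mono (shiftBack_anti t (min_le_right _ _)) _ (hm' t))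
  · rintro t ω ⟨h, h'⟩
    obtain ⟨f, hf, hft, h⟩ := hS t ω h
    obtain ⟨f', hf', hft', h'⟩ := hS' t ω h'
    refine ⟨max f f', ?_, max_le hft hft', fun u h1 h2 ↦
      ⟨h u ((le_max_left _ _).trans h1) h2, h' u ((le_max_right _ _).trans h1) h2⟩⟩
    rcases max_choice f f' with h | h <;> simp [h, hf, hf']

lemma isForetold_bot_prod {A : Set Ω} (hA : MeasurableSet[𝓕 ⊥] A) :
    IsForetold 𝓕 ({⊥} ×ˢ A) := by
  refine ⟨1, one_pos, fun t ↦ ?_, fun ω ↦ ?_, {⊥}, ?_⟩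
  · by_cases ht : t = ⊥
    · simpa [ht] using 𝓕.mono bot_le _ hA
    · simp [ht]
  · by_cases h : ω ∈ A <;> simp [h]
  · rintro t ω ⟨h, h'⟩
    simp only [mem_singleton_iff] at h
    subst h
    exact ⟨⊥, by simp, le_rfl, fun u _ hu ↦ ⟨le_bot_iff.1 hu, h'⟩⟩

lemma isForetold_Icc_prod {i s t : Time T} (his : i < s) {A : Set Ω} (hA : MeasurableSet[𝓕 i] A) :
    IsForetold 𝓕 (Icc s t ×ˢ A) := by
  have his' : (i : ℝ≥0) < s := his
  refine ⟨s - i, tsub_pos_of_lt his', fun u ↦ ?_, fun ω ↦ ?_, {s}, ?_⟩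
  · by_cases hu : u ∈ Icc s t
    · simp only [mem_prod, hu, true_and]
      refine 𝓕.mono ?_ _ hA
      rw [← Subtype.coe_le_coe, coe_shiftBack]
      have : (s : ℝ≥0) ≤ u := hu.1
      refine le_tsub_of_add_le_left ?_
      rwa [tsub_add_cancel_of_le his'.le]
    · simp only [mem_prod, hu, false_and]
      exact @MeasurableSet.empty _ (_)
  · by_cases h : ω ∈ A
    · simp only [mem_prod, h, and_true]
      exact isClosed_Icc
    · simp [h]
  · rintro u ω ⟨h, h'⟩
    exact ⟨s, by simp, h.1, fun v hv hvu ↦ ⟨⟨hv, hvu.trans h.2⟩, h'⟩⟩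

/-- The first point of `F` at which the path `ω` is in `E`, and `⊤` if there is none. -/
def firstEntrance {ι : Type*} [LinearOrder ι] (F : Finset ι) (E : Set (ι × Ω)) (ω : Ω) :
    WithTop ι :=
  open Classical in (F.filter fun f ↦ (f, ω) ∈ E).min

section

variable {ι : Type*} [LinearOrder ι] {F : Finset ι} {E : Set (ι × Ω)}

lemma finite_range_firstEntrance (F : Finset ι) (E : Set (ι × Ω)) :
    (range (firstEntrance F E)).Finite := by
  classical
  refine (F.powerset.finite_toSet.image Finset.min).subset ?_
  rintro _ ⟨ω, rfl⟩
  exact ⟨_, Finset.mem_coe.2 (Finset.mem_powerset.2 (Finset.filter_subset _ F)), rfl⟩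

lemma firstEntrance_eq_coe_iff {ω : Ω} {f : ι} :
    firstEntrance F E ω = f ↔ (f ∈ F ∧ (f, ω) ∈ E) ∧ ∀ g ∈ F, g < f → (g, ω) ∉ E := by
  classical
  constructor
  · intro h
    refine ⟨Finset.mem_filter.1 (Finset.mem_of_min h), fun g hg hgf hgE ↦ ?_⟩
    exact (Finset.min_le_of_eq (Finset.mem_filter.2 ⟨hg, hgE⟩) h).not_gt hgf
  · rintro ⟨hf, hmin⟩
    refine le_antisymm (Finset.min_le (Finset.mem_filter.2 hf)) (Finset.le_min fun g hg ↦ ?_)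
    obtain ⟨hg, hgE⟩ := Finset.mem_filter.1 hg
    exact WithTop.coe_le_coe.2 <| le_of_not_gt fun hgf ↦ hmin g hg hgf hgE

lemma firstEntrance_le {ω : Ω} {f : ι} (hf : f ∈ F) (hfE : (f, ω) ∈ E) :
    firstEntrance F E ω ≤ f := by
  classical
  exact Finset.min_le (Finset.mem_filter.2 ⟨hf, hfE⟩)

end

/-- A random time `d` with finitely many values, such that `d = f` is known at time `f - δ`. -/
structure IsKnownAhead (𝓕 : Filtration (Time T) m) (δ : ℝ≥0) (d : Ω → WithTop (Time T)) :
    Prop where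
  finite_range : (range d).Finite
  measurableSet_eq : ∀ f : Time T, MeasurableSet[𝓕 (shiftBack f δ)] {ω | d ω = f}

lemma IsKnownAhead.mono {δ δ' : ℝ≥0} {d : Ω → WithTop (Time T)} (hd : IsKnownAhead 𝓕 δ d)
    (h : δ' ≤ δ) : IsKnownAhead 𝓕 δ' d :=
  ⟨hd.finite_range, fun f ↦ 𝓕.mono (shiftBack_anti f h) _ (hd.measurableSet_eq f)⟩

lemma isKnownAhead_firstEntrance {δ : ℝ≥0} {E : Set (Time T × Ω)}
    (hE : ∀ t, MeasurableSet[𝓕 (shiftBack t δ)] {ω | (t, ω) ∈ E}) (F : Finset (Time T)) :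
    IsKnownAhead 𝓕 δ (firstEntrance F E) := by
  refine ⟨finite_range_firstEntrance F E, fun f ↦ ?_⟩
  have heq : {ω | firstEntrance F E ω = f} = {ω | f ∈ F ∧ (f, ω) ∈ E} ∩
      ⋂ g ∈ F, {ω | g < f ∧ (g, ω) ∈ E}ᶜ := by
    ext ω
    simp [firstEntrance_eq_coe_iff]
  rw [heq]
  refine .inter ?_ (Finset.measurableSet_biInter _ fun g _ ↦ .compl ?_)
  · by_cases hf : f ∈ F <;> simp [hf, hE f]
  · by_cases hgf : g < f
    · simpa [hgf] using 𝓕.mono (shiftBack_mono δ hgf.le) _ (hE g)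
    · simp [hgf]

lemma IsForetold.exists_debut {E : Set (Time T × Ω)} (hE : IsForetold 𝓕 E) :
    ∃ δ : ℝ≥0, 0 < δ ∧ ∃ d : Ω → WithTop (Time T), IsKnownAhead 𝓕 δ d ∧
      (∀ ω, ∀ f : Time T, d ω = f → (f, ω) ∈ E) ∧ ∀ ω t, (t, ω) ∈ E → d ω ≤ t := by
  obtain ⟨δ, hδ, hm, -, F, hF⟩ := hE
  refine ⟨δ, hδ, firstEntrance F E, isKnownAhead_firstEntrance hm F,
    fun ω f h ↦ (firstEntrance_eq_coe_iff.1 h).1.2, fun ω t h ↦ ?_⟩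
  obtain ⟨f, hf, hft, h'⟩ := hF t ω h
  exact (firstEntrance_le hf (h' f le_rfl hft)).trans (WithTop.coe_le_coe.2 hft)

/-- Countable intersections of foretold sets. -/
def IsForetoldInter (𝓕 : Filtration (Time T) m) (K : Set (Time T × Ω)) : Prop :=
  ∃ E : ℕ → Set (Time T × Ω), (∀ n, IsForetold 𝓕 (E n)) ∧ K = ⋂ n, E n

lemma IsForetold.isForetoldInter {E : Set (Time T × Ω)} (hE : IsForetold 𝓕 E) :
    IsForetoldInter 𝓕 E := ⟨fun _ ↦ E, fun _ ↦ hE, (iInter_const E).symm⟩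

lemma IsForetoldInter.union {K L : Set (Time T × Ω)} (hK : IsForetoldInter 𝓕 K)
    (hL : IsForetoldInter 𝓕 L) : IsForetoldInter 𝓕 (K ∪ L) := by
  obtain ⟨E, hE, rfl⟩ := hK
  obtain ⟨F, hF, rfl⟩ := hL
  refine ⟨fun n ↦ E n.unpair.1 ∪ F n.unpair.2, fun n ↦ (hE _).union (hF _), ?_⟩
  ext p
  simp only [mem_union, mem_iInter]
  refine ⟨fun h n ↦ h.imp (fun h ↦ h _) fun h ↦ h _, fun h ↦ ?_⟩
  by_contra! hne
  obtain ⟨⟨i, hi⟩, j, hj⟩ := hne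
  have := h (Nat.pair i j)
  simp [hi, hj] at this

lemma IsForetoldInter.iInter {K : ℕ → Set (Time T × Ω)} (hK : ∀ n, IsForetoldInter 𝓕 (K n)) :
    IsForetoldInter 𝓕 (⋂ n, K n) := by
  choose E hE hKE using hK
  refine ⟨fun n ↦ E n.unpair.1 n.unpair.2, fun n ↦ hE _ _, ?_⟩
  ext p
  simp only [hKE, mem_iInter]
  refine ⟨fun h n ↦ h _ _, fun h i j ↦ ?_⟩
  simpa using h (Nat.pair i j)

/-- Inner approximability by countable intersections of foretold sets. -/
def IsApproximable (𝓕 : Filtration (Time T) m) (ν : @Measure (Time T × Ω) 𝓕.predictable)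
    (S : Set (Time T × Ω)) : Prop :=
  ∀ ε : ℝ≥0∞, ε ≠ 0 → ∃ K, IsForetoldInter 𝓕 K ∧ K ⊆ S ∧ ν (S \ K) ≤ ε

variable {ν : @Measure (Time T × Ω) 𝓕.predictable}

lemma IsForetold.isApproximable {E : Set (Time T × Ω)} (hE : IsForetold 𝓕 E) :
    IsApproximable 𝓕 ν E := fun ε _ ↦ ⟨E, hE.isForetoldInter, subset_rfl, by simp⟩

lemma IsApproximable.iInter {S : ℕ → Set (Time T × Ω)} (hS : ∀ n, IsApproximable 𝓕 ν (S n)) :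
    IsApproximable 𝓕 ν (⋂ n, S n) := by
  intro ε hε
  obtain ⟨ε', hε', hsum⟩ := ENNReal.exists_pos_sum_of_countable' hε ℕ
  choose K hK hKS hν using fun n ↦ hS n (ε' n) (hε' n).ne'
  refine ⟨⋂ n, K n, IsForetoldInter.iInter hK, iInter_mono hKS, ?_⟩
  calc ν ((⋂ n, S n) \ ⋂ n, K n) ≤ ν (⋃ n, S n \ K n) := by
        refine measure_mono fun p ⟨h1, h2⟩ ↦ ?_
        simp only [mem_iInter, not_forall] at h1 h2
        obtain ⟨n, hn⟩ := h2
        exact mem_iUnion.2 ⟨n, h1 n, hn⟩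
    _ ≤ ∑' n, ν (S n \ K n) := measure_iUnion_le _
    _ ≤ ∑' n, ε' n := ENNReal.tsum_le_tsum hν
    _ ≤ ε := hsum.le

lemma IsApproximable.union {S S' : Set (Time T × Ω)} (hS : IsApproximable 𝓕 ν S)
    (hS' : IsApproximable 𝓕 ν S') : IsApproximable 𝓕 ν (S ∪ S') := by
  intro ε hε
  have hε2 : ε / 2 ≠ 0 := (ENNReal.half_pos hε).ne'
  obtain ⟨K, hK, hKS, hν⟩ := hS _ hε2
  obtain ⟨K', hK', hKS', hν'⟩ := hS' _ hε2
  refine ⟨K ∪ K', hK.union hK', union_subset_union hKS hKS', ?_⟩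
  calc ν ((S ∪ S') \ (K ∪ K')) ≤ ν ((S \ K) ∪ (S' \ K')) := by
        refine measure_mono ?_
        rintro p ⟨h | h, h'⟩
        · exact Or.inl ⟨h, fun h'' ↦ h' (Or.inl h'')⟩
        · exact Or.inr ⟨h, fun h'' ↦ h' (Or.inr h'')⟩
    _ ≤ ν (S \ K) + ν (S' \ K') := measure_union_le _ _
    _ ≤ ε / 2 + ε / 2 := add_le_add hν hν'
    _ = ε := ENNReal.add_halves ε

lemma IsApproximable.iUnion [IsFiniteMeasure ν] {S : ℕ → Set (Time T × Ω)}
    (hm : ∀ n, MeasurableSet[𝓕.predictable] (S n)) (hS : ∀ n, IsApproximable 𝓕 ν (S n)) :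
    IsApproximable 𝓕 ν (⋃ n, S n) := by
  intro ε hε
  have hε2 : ε / 2 ≠ 0 := (ENNReal.half_pos hε).ne'
  have hacc : ∀ n, IsApproximable 𝓕 ν (accumulate S n) := by
    intro n
    induction n with
    | zero => simpa using hS 0
    | succ n ih => rw [accumulate_succ]; exact ih.union (hS _)
  have hlim : Tendsto (fun n ↦ ν ((⋃ n, S n) \ accumulate S n)) atTop (𝓝 0) := by
    have := tendsto_measure_iInter_atTop (μ := ν) (s := fun n ↦ (⋃ n, S n) \ accumulate S n)
      (fun n ↦ ((MeasurableSet.iUnion hm).diff (by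
        rw [accumulate_def]
        exact MeasurableSet.biUnion (to_countable _) fun i _ ↦ hm i)).nullMeasurableSet)
      (fun i j hij ↦ sdiff_subset_sdiff_right (monotone_accumulate hij))
      ⟨0, measure_ne_top _ _⟩
    rw [← sdiff_iUnion, iUnion_accumulate, sdiff_self] at this
    rw [measure_empty] at this
    exact this
  obtain ⟨n, hn⟩ := (hlim.eventually_lt_const (pos_iff_ne_zero.2 hε2)).exists
  obtain ⟨K, hK, hKS, hν⟩ := hacc n _ hε2
  have hsub : accumulate S n ⊆ ⋃ n, S n := by
    rw [accumulate_def]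
    exact iUnion₂_subset fun i _ ↦ subset_iUnion S i
  refine ⟨K, hK, hKS.trans hsub, ?_⟩
  calc ν ((⋃ n, S n) \ K) ≤ ν (((⋃ n, S n) \ accumulate S n) ∪ (accumulate S n \ K)) := by
        refine measure_mono fun p ⟨h1, h2⟩ ↦ ?_
        by_cases h : p ∈ accumulate S n
        · exact Or.inr ⟨h, h2⟩
        · exact Or.inl ⟨h1, h⟩
    _ ≤ _ := measure_union_le _ _
    _ ≤ ε / 2 + ε / 2 := add_le_add hn.le hν
    _ = ε := ENNReal.add_halves ε

lemma isApproximable_Ioc_prod [IsFiniteMeasure ν] (i j : Time T) {A : Set Ω}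
    (hA : MeasurableSet[𝓕 i] A) : IsApproximable 𝓕 ν (Ioc i j ×ˢ A) := by
  by_cases hij : i < j
  · obtain ⟨u, -, hu, hlim⟩ := exists_seq_strictAnti_tendsto' hij
    have : Ioc i j ×ˢ A = ⋃ n, Icc (u n) j ×ˢ A := by
      rw [← iUnion_prod_const]
      congr 1
      ext t
      simp only [mem_Ioc, mem_iUnion, mem_Icc, exists_and_right]
      refine and_congr_left fun _ ↦ ⟨fun h ↦ ?_, fun ⟨n, hn⟩ ↦ (hu n).1.trans_le hn⟩
      exact (hlim.eventually_lt_const h).exists.imp fun _ h ↦ h.le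
    rw [this]
    refine IsApproximable.iUnion (fun n ↦ ?_) fun n ↦
      (isForetold_Icc_prod (hu n).1 hA).isApproximable
    exact measurableSet_predictable_prod measurableSet_Icc
      (fun t ht ↦ (hu n).1.trans_le ht.1) hA
  · rw [Ioc_eq_empty hij, empty_prod]
    exact IsForetold.empty.isApproximable

lemma isApproximable_Ioi_prod [IsFiniteMeasure ν] (i : Time T) {A : Set Ω}
    (hA : MeasurableSet[𝓕 i] A) : IsApproximable 𝓕 ν (Ioi i ×ˢ A) := by
  have : (Ioi i : Set (Time T)) = Ioc i ⊤ := by ext; simp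
  rw [this]
  exact isApproximable_Ioc_prod i ⊤ hA

theorem isApproximable_of_measurableSet [IsFiniteMeasure ν] {S : Set (Time T × Ω)}
    (hS : MeasurableSet[𝓕.predictable] S) : IsApproximable 𝓕 ν S := by
  suffices IsApproximable 𝓕 ν S ∧ IsApproximable 𝓕 ν Sᶜ from this.1
  have hbot : ∀ A, MeasurableSet[𝓕 ⊥] A → IsApproximable 𝓕 ν ({⊥} ×ˢ A) :=
    fun A hA ↦ (isForetold_bot_prod hA).isApproximable
  induction S, hS using MeasurableSpace.generateFrom_induction with
  | hC S hS' _ =>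
    rcases hS' with ⟨A, hA, rfl⟩ | ⟨i, A, hA, rfl⟩
    · refine ⟨hbot A hA, ?_⟩
      convert! (hbot _ hA.compl).union (isApproximable_Ioi_prod ⊥ MeasurableSet.univ) using 1
      ext ⟨t, ω⟩
      by_cases h : t = ⊥ <;> simp [h, bot_lt_iff_ne_bot]
    · refine ⟨isApproximable_Ioi_prod i hA, ?_⟩
      convert! ((hbot _ MeasurableSet.univ).union
        (isApproximable_Ioc_prod ⊥ i MeasurableSet.univ)).union
        (isApproximable_Ioi_prod i hA.compl) using 1
      ext ⟨t, ω⟩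
      by_cases h : t = ⊥
      · simp [h]
      · by_cases h' : i < t <;> simp [h, h', bot_lt_iff_ne_bot, not_lt.1]
  | empty =>
    refine ⟨IsForetold.empty.isApproximable, ?_⟩
    convert! (hbot _ MeasurableSet.univ).union
      (isApproximable_Ioi_prod ⊥ MeasurableSet.univ) using 1
    ext ⟨t, ω⟩
    by_cases h : t = ⊥ <;> simp [h, bot_lt_iff_ne_bot]
  | compl S _ ih => exact ⟨ih.2, by rw [compl_compl]; exact ih.1⟩
  | iUnion S hS ih =>
    refine ⟨IsApproximable.iUnion hS fun n ↦ (ih n).1, ?_⟩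
    rw [compl_iUnion]
    exact IsApproximable.iInter fun n ↦ (ih n).2
lemma IsForetoldInter.exists_antitone {K : Set (Time T × Ω)} (hK : IsForetoldInter 𝓕 K) :
    ∃ E : ℕ → Set (Time T × Ω), (∀ n, IsForetold 𝓕 (E n)) ∧ Antitone E ∧ K = ⋂ n, E n := by
  obtain ⟨E, hE, rfl⟩ := hK
  refine ⟨dissipate E, fun n ↦ ?_, antitone_dissipate, iInter_dissipate.symm⟩
  induction n with
  | zero => simpa using hE 0
  | succ n ih => rw [dissipate_succ]; exact ih.inter (hE _)

/-- A nondecreasing sequence of random times, each of which is foreseeable; it is meant to announce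
its limit on the event where all its members are finite. -/
structure IsAnnouncing (𝓕 : Filtration (Time T) m) (δ : ℕ → ℝ≥0) (d : ℕ → Ω → WithTop (Time T)) :
    Prop where
  pos : ∀ n, 0 < δ n
  tendsto_zero : Tendsto δ atTop (𝓝 0)
  knownAhead : ∀ n, IsKnownAhead 𝓕 (δ n) (d n)
  monotone : Monotone d

lemma IsForetoldInter.exists_isAnnouncing {K : Set (Time T × Ω)} (hK : IsForetoldInter 𝓕 K) :
    ∃ δ d, IsAnnouncing 𝓕 δ d ∧ (∀ n ω t, (t, ω) ∈ K → d n ω ≤ t) ∧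
      ∀ ω, (∀ n, d n ω ≠ ⊤) → ∃ e : ℕ → Time T, (∀ n, d n ω = e n) ∧
        ∃ t, Tendsto e atTop (𝓝 t) ∧ (t, ω) ∈ K := by
  obtain ⟨E, hE, hanti, rfl⟩ := hK.exists_antitone
  have hclosed : ∀ n ω, IsClosed {t | (t, ω) ∈ E n} := fun n ω ↦ (hE n).choose_spec.2.2.1 ω
  choose δ hδ d hd hdE hdle using fun n ↦ (hE n).exists_debut
  have hmono : Monotone d := fun i j hij ω ↦ by
    induction h : d j ω using WithTop.recTopCoe with
    | top => exact le_top
    | coe f => exact hdle i ω f (hanti hij (hdE j ω f h))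
  refine ⟨fun n ↦ min (δ n) (1 / (n + 1)), d, ⟨fun n ↦ lt_min (hδ n) (by positivity), ?_,
    fun n ↦ (hd n).mono (min_le_left _ _), hmono⟩,
    fun n ω t h ↦ hdle n ω t (mem_iInter.1 h n), fun ω hω ↦ ?_⟩
  · exact tendsto_of_tendsto_of_tendsto_of_le_of_le tendsto_const_nhds
      (tendsto_one_div_add_atTop_nhds_zero_nat (𝕜 := ℝ≥0)) (fun _ ↦ zero_le)
      fun n ↦ min_le_right _ _
  · choose e he using fun n ↦ WithTop.ne_top_iff_exists.1 (hω n)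
    have hemono : Monotone e := fun i j hij ↦ by
      simpa only [← he, WithTop.coe_le_coe] using hmono hij ω
    have hlim := tendsto_atTop_ciSup hemono (OrderTop.bddAbove _)
    refine ⟨e, fun n ↦ (he n).symm, _, hlim, mem_iInter.2 fun n ↦ ?_⟩
    exact (hclosed n ω).mem_of_tendsto hlim <| (eventually_ge_atTop n).mono fun k hk ↦
      hanti hk (hdE k ω _ (he k).symm)

theorem exists_isAnnouncing_of_measurableSet_graph {P : Measure Ω} [IsFiniteMeasure P] {Ω₀ : Set Ω}
    {r : Ω → Time T} (hr : Measurable r)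
    (hG : MeasurableSet[𝓕.predictable] {p : Time T × Ω | p.2 ∈ Ω₀ ∧ p.1 = r p.2})
    {ε : ℝ≥0∞} (hε : ε ≠ 0) :
    ∃ δ d, IsAnnouncing 𝓕 δ d ∧ P (Ω₀ \ {ω | ∀ n, d n ω ≠ ⊤}) ≤ ε ∧
      ∀ ω, (∀ n, d n ω ≠ ⊤) → ω ∈ Ω₀ ∧ ∃ e : ℕ → Time T,
        (∀ n, d n ω = e n) ∧ Tendsto e atTop (𝓝 (r ω)) := by
  have hg : @Measurable Ω (Time T × Ω) m 𝓕.predictable fun ω ↦ (r ω, ω) :=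
    (hr.prodMk measurable_id).mono le_rfl (predictable_le 𝓕)
  -- the graph measure `S ↦ P(Ω₀ ∩ {ω | (r ω, ω) ∈ S})`
  let ν : @Measure (Time T × Ω) 𝓕.predictable :=
    @Measure.map Ω (Time T × Ω) m 𝓕.predictable (fun ω ↦ (r ω, ω)) (P.restrict Ω₀)
  have : IsFiniteMeasure ν := ⟨by
    rw [Measure.map_apply hg MeasurableSet.univ]
    exact measure_lt_top _ _⟩
  obtain ⟨K, hK, hKG, hνK⟩ := isApproximable_of_measurableSet (ν := ν) hG ε hε
  obtain ⟨δ, d, hd, hdle, hlim⟩ := hK.exists_isAnnouncing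
  refine ⟨δ, d, hd, ?_, fun ω hω ↦ ?_⟩
  · refine le_trans ?_ ((@Measure.le_map_apply Ω (Time T × Ω) m 𝓕.predictable (P.restrict Ω₀)
      _ ⟨_, hg, EventuallyEq.rfl⟩ _).trans hνK)
    refine (measure_mono ?_).trans (Measure.le_restrict_apply _ _)
    rintro ω ⟨h1, h2⟩
    refine ⟨⟨⟨h1, rfl⟩, fun hωK ↦ h2 fun n ↦ ?_⟩, h1⟩
    exact ne_top_of_le_ne_top WithTop.coe_ne_top (hdle n ω (r ω) hωK)
  · obtain ⟨e, he, t, ht, htK⟩ := hlim ω hω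
    obtain ⟨hω₀, rfl⟩ : ω ∈ Ω₀ ∧ t = r ω := hKG htK
    exact ⟨hω₀, e, he, ht⟩

end Foretold

/-! ### Conditional laws -/

section ConditionalLaw

section

variable {A E : Type*} [MeasurableSpace A] [MeasurableSpace E] [TopologicalSpace E]
  [HasOuterApproxClosed E] [BorelSpace E]

lemma measurable_of_lintegral_bcf {κ : A → Measure E} [∀ a, IsProbabilityMeasure (κ a)]
    (h : ∀ g : BoundedContinuousFunction E ℝ≥0, Measurable fun a ↦ ∫⁻ x, g x ∂(κ a)) :
    Measurable κ := by
  have hgen : (inferInstance : MeasurableSpace E) = .generateFrom {s : Set E | IsClosed s} := by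
    rw [BorelSpace.measurable_eq (α := E), borel_eq_generateFrom_isClosed]
  refine .measure_of_isPiSystem_of_isProbabilityMeasure hgen isPiSystem_isClosed fun s hs ↦ ?_
  refine measurable_of_tendsto_metrizable (fun n ↦ h (IsClosed.apprSeq hs n)) ?_
  rw [tendsto_pi_nhds]
  exact fun a ↦ HasOuterApproxClosed.tendsto_lintegral_apprSeq hs (κ a)

end

variable {Ω E : Type*} {𝒢 m : MeasurableSpace Ω} [MeasurableSpace E] {P : Measure Ω} {L : Ω → E}
  {κ : Ω → Measure E}

lemma setLIntegral_of_bind_eq_map (hL : Measurable L) (hκ : Measurable κ) {A : Set Ω}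
    (h : (P.restrict A).bind κ = (P.restrict A).map L) {f : E → ℝ≥0∞} (hf : Measurable f) :
    ∫⁻ ω in A, ∫⁻ x, f x ∂(κ ω) ∂P = ∫⁻ ω in A, f (L ω) ∂P := by
  rw [← Measure.lintegral_bind hκ.aemeasurable hf.aemeasurable, h, lintegral_map hf hL]

lemma setLIntegral_of_forall_bcf [TopologicalSpace E] [HasOuterApproxClosed E] [BorelSpace E]
    [IsFiniteMeasure P] (hL : Measurable L) (hκ : Measurable κ) {A : Set Ω}
    (h : ∀ g : BoundedContinuousFunction E ℝ≥0,
      ∫⁻ ω in A, ∫⁻ x, g x ∂(κ ω) ∂P = ∫⁻ ω in A, g (L ω) ∂P)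
    {f : E → ℝ≥0∞} (hf : Measurable f) :
    ∫⁻ ω in A, ∫⁻ x, f x ∂(κ ω) ∂P = ∫⁻ ω in A, f (L ω) ∂P := by
  refine setLIntegral_of_bind_eq_map hL hκ ?_ hf
  refine (ext_of_forall_lintegral_eq_of_IsFiniteMeasure fun g ↦ ?_).symm
  have hg : Measurable fun x ↦ (g x : ℝ≥0∞) := g.continuous.measurable.coe_nnreal_ennreal
  rw [Measure.lintegral_bind hκ.aemeasurable hg.aemeasurable, lintegral_map hg hL, h]

/-- `κ` is a conditional law of `L` given `𝒢`: integrals of functions of `L` over events of `𝒢` may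
be computed by averaging against `κ`. -/
def IsConditionalLaw (P : Measure Ω) (L : Ω → E) (𝒢 : MeasurableSpace Ω) (κ : Ω → Measure E) :
    Prop :=
  ∀ A, MeasurableSet[𝒢] A → ∀ f : E → ℝ≥0∞, Measurable f →
    ∫⁻ ω in A, ∫⁻ x, f x ∂(κ ω) ∂P = ∫⁻ ω in A, f (L ω) ∂P

variable [IsFiniteMeasure P]

lemma isConditionalLaw_of_condProb [∀ ω, IsProbabilityMeasure (κ ω)] (h𝒢 : 𝒢 ≤ m)
    (hL : Measurable L) (hκ : Measurable κ)
    (h : ∀ B, MeasurableSet B → (fun ω ↦ (κ ω).real B) =ᵐ[P] P⟦L ⁻¹' B | 𝒢⟧) :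
    IsConditionalLaw P L 𝒢 κ := by
  intro A hA f hf
  refine setLIntegral_of_bind_eq_map hL hκ (Measure.ext fun B hB ↦ ?_) hf
  have hκB : Measurable fun ω ↦ κ ω B := (Measure.measurable_coe hB).comp hκ
  rw [Measure.bind_apply hB hκ.aemeasurable, Measure.map_apply hL hB,
    Measure.restrict_apply (hL hB), inter_comm]
  have hreal : ∫ ω in A, (κ ω).real B ∂P = P.real (A ∩ L ⁻¹' B) := by
    rw [setIntegral_congr_ae (h𝒢 _ hA) ((h B hB).mono fun ω hω _ ↦ hω),
      setIntegral_condExp h𝒢 ((integrable_const 1).indicator (hL hB)) hA,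
      setIntegral_indicator (hL hB)]
    simp
  simp only [Measure.real] at hreal
  rw [integral_toReal hκB.aemeasurable (ae_of_all _ fun ω ↦ measure_lt_top _ _)] at hreal
  refine (ENNReal.toReal_eq_toReal_iff' ?_ (measure_ne_top _ _)).1 hreal
  refine ne_top_of_le_ne_top (measure_ne_top P A) ?_
  simpa using lintegral_mono (μ := P.restrict A) fun ω ↦ prob_le_one (μ := κ ω) (s := B)

lemma integrable_coe_comp_of_le (hL : Measurable L) {f : E → ℝ≥0} (hf : Measurable f) {c : ℝ≥0}
    (hc : ∀ x, f x ≤ c) : Integrable (fun ω ↦ (f (L ω) : ℝ)) P :=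
  Integrable.of_bound (hf.comp hL).coe_nnreal_real.aestronglyMeasurable c
    (ae_of_all _ fun ω ↦ by simpa using hc (L ω))

variable [∀ ω, IsProbabilityMeasure (κ ω)]

lemma lintegral_law_le {f : E → ℝ≥0} {c : ℝ≥0} (hc : ∀ x, f x ≤ c) (ω : Ω) :
    ∫⁻ x, f x ∂(κ ω) ≤ c :=
  lintegral_le_const (ae_of_all _ fun x ↦ ENNReal.coe_le_coe.2 (hc x))

lemma integrable_toReal_lintegral_law (hκ : Measurable κ) {f : E → ℝ≥0} (hf : Measurable f)
    {c : ℝ≥0} (hc : ∀ x, f x ≤ c) : Integrable (fun ω ↦ (∫⁻ x, f x ∂(κ ω)).toReal) P := by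
  refine Integrable.of_bound ((Measure.measurable_lintegral hf.coe_nnreal_ennreal).comp
    hκ).ennreal_toReal.aestronglyMeasurable c (ae_of_all _ fun ω ↦ ?_)
  simpa using ENNReal.toReal_mono ENNReal.coe_ne_top (lintegral_law_le hc ω)

lemma setIntegral_toReal_law_eq_iff (hL : Measurable L) (hκ : Measurable κ) {A : Set Ω}
    {f : E → ℝ≥0} (hf : Measurable f) {c : ℝ≥0} (hc : ∀ x, f x ≤ c) :
    ∫ ω in A, (∫⁻ x, f x ∂(κ ω)).toReal ∂P = ∫ ω in A, (f (L ω) : ℝ) ∂P ↔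
      ∫⁻ ω in A, ∫⁻ x, f x ∂(κ ω) ∂P = ∫⁻ ω in A, f (L ω) ∂P := by
  have hfin : ∀ F : Ω → ℝ≥0∞, (∀ ω, F ω ≤ c) → ∫⁻ ω in A, F ω ∂P ≠ ∞ := fun F hF ↦
    (setLIntegral_lt_top_of_le_nnreal (measure_ne_top P A) ⟨c, fun ω _ ↦ hF ω⟩).ne
  have hcoe : ∫ ω in A, (f (L ω) : ℝ) ∂P = (∫⁻ ω in A, f (L ω) ∂P).toReal :=
    integral_toReal (f := fun ω ↦ (f (L ω) : ℝ≥0∞)) (hf.comp hL).coe_nnreal_ennreal.aemeasurable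
      (ae_of_all _ fun _ ↦ ENNReal.coe_lt_top)
  have hm : Measurable fun ω ↦ ∫⁻ x, f x ∂(κ ω) :=
    (Measure.measurable_lintegral hf.coe_nnreal_ennreal).comp hκ
  rw [hcoe, integral_toReal hm.aemeasurable
    (ae_of_all _ fun ω ↦ (lintegral_law_le hc ω).trans_lt ENNReal.coe_lt_top)]
  exact ENNReal.toReal_eq_toReal_iff' (hfin _ (lintegral_law_le hc))
    (hfin _ fun ω ↦ ENNReal.coe_le_coe.2 (hc _))

lemma IsConditionalLaw.condExp (h𝒢 : 𝒢 ≤ m) (hL : Measurable L) (hκ : Measurable[𝒢] κ)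
    (h : IsConditionalLaw P L 𝒢 κ) {f : E → ℝ≥0} (hf : Measurable f) {c : ℝ≥0}
    (hc : ∀ x, f x ≤ c) :
    (fun ω ↦ (∫⁻ x, f x ∂(κ ω)).toReal) =ᵐ[P] P[fun ω ↦ (f (L ω) : ℝ) | 𝒢] := by
  have hκm : Measurable κ := hκ.mono h𝒢 le_rfl
  refine ae_eq_condExp_of_forall_setIntegral_eq h𝒢 (integrable_coe_comp_of_le hL hf hc)
    (fun _ _ _ ↦ (integrable_toReal_lintegral_law hκm hf hc).integrableOn) (fun A hA _ ↦ ?_)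
    ((Measure.measurable_lintegral hf.coe_nnreal_ennreal).comp
      hκ).ennreal_toReal.stronglyMeasurable.aestronglyMeasurable
  exact (setIntegral_toReal_law_eq_iff hL hκm hf hc).2 (h A hA _ hf.coe_nnreal_ennreal)

lemma isConditionalLaw_of_forall_bcf [TopologicalSpace E] [HasOuterApproxClosed E] [BorelSpace E]
    (h𝒢 : 𝒢 ≤ m) (hL : Measurable L) (hκ : Measurable κ)
    (h : ∀ g : BoundedContinuousFunction E ℝ≥0,
      (fun ω ↦ (∫⁻ x, g x ∂(κ ω)).toReal) =ᵐ[P] P[fun ω ↦ (g (L ω) : ℝ) | 𝒢]) :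
    IsConditionalLaw P L 𝒢 κ := by
  intro A hA f hf
  refine setLIntegral_of_forall_bcf hL hκ (fun g ↦ ?_) hf
  have hgm : Measurable g := g.continuous.measurable
  have hc := BoundedContinuousFunction.NNReal.upper_bound g
  refine (setIntegral_toReal_law_eq_iff hL hκ hgm hc).1 ?_
  rw [setIntegral_congr_ae (h𝒢 _ hA) ((h g).mono fun ω hω _ ↦ hω),
    setIntegral_condExp h𝒢 (integrable_coe_comp_of_le hL hgm hc) hA]

lemma IsConditionalLaw.condProb (h𝒢 : 𝒢 ≤ m) (hL : Measurable L) (hκ : Measurable[𝒢] κ)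
    (h : IsConditionalLaw P L 𝒢 κ) {B : Set E} (hB : MeasurableSet B) :
    (fun ω ↦ (κ ω).real B) =ᵐ[P] P⟦L ⁻¹' B | 𝒢⟧ := by
  have hind := h.condExp h𝒢 hL hκ (f := B.indicator 1) (measurable_one.indicator hB) (c := 1)
    fun x ↦ by by_cases hx : x ∈ B <;> simp [hx]
  have hcomp : (fun ω ↦ ((B.indicator 1 (L ω) : ℝ≥0) : ℝ)) = (L ⁻¹' B).indicator fun _ ↦ 1 := by
    ext ω
    by_cases hx : L ω ∈ B <;> simp [hx]
  have hlaw : ∀ ω, ∫⁻ x, ((B.indicator 1 x : ℝ≥0) : ℝ≥0∞) ∂(κ ω) = κ ω B := fun ω ↦ by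
    rw [← lintegral_indicator_one hB]
    congr with x
    by_cases hx : x ∈ B <;> simp [hx]
  simpa only [hcomp, hlaw, Measure.real] using hind

lemma IsConditionalLaw.integral_mul (h𝒢 : 𝒢 ≤ m) (hL : Measurable L) (hκ : Measurable[𝒢] κ)
    (h : IsConditionalLaw P L 𝒢 κ) {B : Set E} (hB : MeasurableSet B) {X : Ω → ℝ}
    (hX : AEStronglyMeasurable[𝒢] X P) (hXi : Integrable X P) :
    ∫ ω, X ω * (L ⁻¹' B).indicator 1 ω ∂P = ∫ ω, X ω * (κ ω).real B ∂P := by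
  have hi : Integrable ((L ⁻¹' B).indicator fun _ ↦ (1 : ℝ)) P :=
    (integrable_const (1 : ℝ)).indicator (hL hB)
  have hXI : Integrable (X * (L ⁻¹' B).indicator fun _ ↦ (1 : ℝ)) P := by
    convert! hXi.indicator (hL hB) using 1
    ext ω
    by_cases hx : L ω ∈ B <;> simp [hx]
  calc ∫ ω, X ω * (L ⁻¹' B).indicator 1 ω ∂P
      = ∫ ω, P[X * (L ⁻¹' B).indicator fun _ ↦ (1 : ℝ) | 𝒢] ω ∂P := (integral_condExp h𝒢).symm
    _ = ∫ ω, X ω * (κ ω).real B ∂P := by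
      refine integral_congr_ae ?_
      filter_upwards [h.condProb h𝒢 hL hκ hB,
        condExp_bilin_of_aestronglyMeasurable_left (.mul ℝ ℝ) hX hXI hi] with ω hω hpull
      exact hpull.trans (by simp [← hω])

end ConditionalLaw

/-! ### Regular conditional laws with càdlàg paths -/

section CadlagLaw

/-- A regular conditional law all of whose paths are càdlàg. -/
structure IsCadlagLaw (𝓕 : Filtration (Time T) m) (P : Measure Ω) (L : Ω → ℝ)
    (Q : Time T → Ω → ProbabilityMeasure ℝ) : Prop where
  measurable : ∀ t, Measurable[𝓕 t] fun ω ↦ (Q t ω : Measure ℝ)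
  law : ∀ t, IsConditionalLaw P L (𝓕 t) fun ω ↦ (Q t ω : Measure ℝ)
  cadlag : ∀ ω, IsCadlag fun t ↦ Q t ω

instance (Q : Time T → Ω → ProbabilityMeasure ℝ) (t : Time T) (ω : Ω) :
    IsProbabilityMeasure (leftLaw Q t ω) := by
  unfold leftLaw
  infer_instance

variable {𝓕 : Filtration (Time T) m} {P : Measure Ω} {L : Ω → ℝ}
  {Q : Time T → Ω → ProbabilityMeasure ℝ}

lemma IsRegularConditionalLaw.exists_isCadlagLaw [IsFiniteMeasure P] (h𝓕 : UsualConditions 𝓕 P)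
    (hL : Measurable L) (hQ : IsRegularConditionalLaw 𝓕 P L Q) :
    ∃ Q', IsCadlagLaw 𝓕 P L Q' ∧ ∀ᵐ ω ∂P, ∀ t, Q t ω = Q' t ω := by
  classical
  let Q' : Time T → Ω → ProbabilityMeasure ℝ := fun t ω ↦
    if IsCadlag fun t ↦ Q t ω then Q t ω else ⟨Measure.dirac 0, inferInstance⟩
  have hQQ : ∀ᵐ ω ∂P, ∀ t, Q t ω = Q' t ω := by
    filter_upwards [hQ.cadlag] with ω hω t
    simp [Q', hω]
  have hm : ∀ t, Measurable[𝓕 t] fun ω ↦ (Q' t ω : Measure ℝ) := fun t ↦ by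
    refine h𝓕.measurable_congr (f := fun ω ↦ (Q t ω : Measure ℝ)) ?_ ?_
    · exact Measure.measurable_of_measurable_coe _ fun B hB ↦ hQ.measurable t B hB
    · filter_upwards [hQQ] with ω hω
      rw [hω t]
  refine ⟨Q', ⟨hm, fun t ↦ ?_, fun ω ↦ ?_⟩, hQQ⟩
  · refine isConditionalLaw_of_condProb (𝓕.le t) hL ((hm t).mono (𝓕.le t) le_rfl) fun B hB ↦ ?_
    refine EventuallyEq.trans ?_ (hQ.condProb t B hB)
    filter_upwards [hQQ] with ω hω
    rw [hω t]
  · by_cases hω : IsCadlag fun t ↦ Q t ω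
    · simp [Q', hω]
    · simp only [Q', hω]
      exact fun t ↦ ⟨continuousWithinAt_const, _, tendsto_const_nhds⟩

lemma leftLaw_bot (ω : Ω) : leftLaw Q ⊥ ω = Q ⊥ ω := by
  rw [leftLaw, leftLim_eq_of_isBot isBot_bot]

lemma IsCadlagLaw.tendsto_lintegral_leftLaw (hQ : IsCadlagLaw 𝓕 P L Q) {t : Time T} (ht : ⊥ < t)
    (ω : Ω) (g : BoundedContinuousFunction ℝ ℝ≥0) :
    Tendsto (fun s ↦ ∫⁻ x, g x ∂(Q s ω : Measure ℝ)) (𝓝[<] t)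
      (𝓝 (∫⁻ x, g x ∂(leftLaw Q t ω))) := by
  have : (𝓝[<] t).NeBot := neBot_of_le (tendsto_gridBelow ht)
  exact ProbabilityMeasure.tendsto_iff_forall_lintegral_tendsto.1
    (tendsto_leftLim_of_tendsto (hQ.cadlag ω t).2) g

lemma IsCadlagLaw.measurable_leftLaw (hQ : IsCadlagLaw 𝓕 P L Q) :
    Measurable[𝓕.predictable] fun p : Time T × Ω ↦ leftLaw Q p.1 p.2 := by
  refine @measurable_of_lintegral_bcf _ _ 𝓕.predictable _ _ _ _ _ _ fun g ↦ ?_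
  refine measurable_predictable_leftLimit (X := fun t ω ↦ ∫⁻ x, g x ∂(Q t ω : Measure ℝ))
    (Y := fun t ω ↦ ∫⁻ x, g x ∂(leftLaw Q t ω)) (fun t ↦ ?_) (fun ω ↦ ?_) fun ω t ht ↦ ?_
  · exact (Measure.measurable_lintegral g.continuous.measurable.coe_nnreal_ennreal).comp
      (hQ.measurable t)
  · simp only [leftLaw_bot]
  · exact hQ.tendsto_lintegral_leftLaw ht ω g

lemma IsCadlagLaw.rightContinuous_lintegral (hQ : IsCadlagLaw 𝓕 P L Q)
    (g : BoundedContinuousFunction ℝ ℝ≥0) (ω : Ω) :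
    RightContinuous fun t ↦ (∫⁻ x, g x ∂(Q t ω : Measure ℝ)).toReal := fun t ↦
  (ENNReal.tendsto_toReal (lintegral_law_le (κ := fun ω ↦ (Q t ω : Measure ℝ))
    (BoundedContinuousFunction.NNReal.upper_bound g) ω |>.trans_lt ENNReal.coe_lt_top).ne).comp
    (ProbabilityMeasure.tendsto_iff_forall_lintegral_tendsto.1 (hQ.cadlag ω t).1 g)

lemma IsCadlagLaw.measurable_sampled (hQ : IsCadlagLaw 𝓕 P L Q) {r : Ω → Time T}
    (hr : IsStoppingTime 𝓕 fun ω ↦ (r ω : WithTop (Time T))) :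
    Measurable[hr.measurableSpace] fun ω ↦ (Q (r ω) ω : Measure ℝ) := by
  refine @measurable_of_lintegral_bcf _ _ hr.measurableSpace _ _ _ _ _ _ fun g ↦ ?_
  have hX : StronglyAdapted 𝓕 fun t ω ↦ (∫⁻ x, g x ∂(Q t ω : Measure ℝ)).toReal := fun t ↦
    Measurable.stronglyMeasurable (((Measure.measurable_lintegral
      g.continuous.measurable.coe_nnreal_ennreal).comp (hQ.measurable t)).ennreal_toReal)
  have hsampled := measurable_stoppedValue (isStronglyProgressive_of_rightContinuous hX
    (hQ.rightContinuous_lintegral g)) hr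
  convert! hsampled.ennreal_ofReal using 2 with ω
  change _ = ENNReal.ofReal (∫⁻ x, g x ∂(Q (r ω) ω : Measure ℝ)).toReal
  rw [ENNReal.ofReal_toReal]
  exact (lintegral_law_le (κ := fun ω ↦ (Q (r ω) ω : Measure ℝ))
    (BoundedContinuousFunction.NNReal.upper_bound g) ω |>.trans_lt ENNReal.coe_lt_top).ne

variable [IsFiniteMeasure P]

lemma IsCadlagLaw.martingale_lintegral (h𝓕 : UsualConditions 𝓕 P) (hL : Measurable L)
    (hQ : IsCadlagLaw 𝓕 P L Q) {f : ℝ → ℝ≥0} (hf : Measurable f) {c : ℝ≥0} (hc : ∀ x, f x ≤ c) :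
    Martingale (fun t ω ↦ (∫⁻ x, f x ∂(Q t ω : Measure ℝ)).toReal) 𝓕 P :=
  h𝓕.martingale_congr (martingale_condExp (fun ω ↦ (f (L ω) : ℝ)) 𝓕 P) fun t ↦
    ((hQ.law t).condExp (𝓕.le t) hL (hQ.measurable t) hf hc).symm

lemma IsCadlagLaw.isConditionalLaw_sampled (h𝓕 : UsualConditions 𝓕 P) (hL : Measurable L)
    (hQ : IsCadlagLaw 𝓕 P L Q) {r : Ω → Time T}
    (hr : IsStoppingTime 𝓕 fun ω ↦ (r ω : WithTop (Time T))) :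
    IsConditionalLaw P L hr.measurableSpace fun ω ↦ (Q (r ω) ω : Measure ℝ) := by
  refine isConditionalLaw_of_forall_bcf hr.measurableSpace_le hL
    ((hQ.measurable_sampled hr).mono hr.measurableSpace_le le_rfl) fun g ↦ ?_
  have hgm : Measurable g := g.continuous.measurable
  have hc := BoundedContinuousFunction.NNReal.upper_bound g
  refine (martingale_sampled_ae_eq_condExp h𝓕 (hQ.martingale_lintegral h𝓕 hL hgm hc)
    (ae_of_all _ (hQ.rightContinuous_lintegral g)) hr (t := ⊤) fun ω ↦ le_top).trans ?_
  refine (condExp_congr_ae ((hQ.law ⊤).condExp (𝓕.le ⊤) hL (hQ.measurable ⊤) hgm hc)).trans ?_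
  exact condExp_condExp_of_le (hr.measurableSpace_le_of_le_const
    fun ω ↦ WithTop.coe_le_coe.2 le_top) (𝓕.le ⊤)

end CadlagLaw

/-! ### Left limits of the conditional laws at predictable times -/

section PredictableTime

section

variable {ι : Type*}

/-- The value at the random time `d` of the process `u`, and `0` where `d = ⊤`. -/
def valueAt (u : ι → Ω → ℝ≥0∞) (d : Ω → WithTop ι) (ω : Ω) : ℝ≥0∞ :=
  (d ω).recTopCoe 0 fun f ↦ u f ω

variable {u v : ι → Ω → ℝ≥0∞} {d : Ω → WithTop ι} {ω : Ω}

lemma valueAt_of_eq_top (h : d ω = ⊤) : valueAt u d ω = 0 := by simp [valueAt, h]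

lemma valueAt_of_eq_coe {f : ι} (h : d ω = f) : valueAt u d ω = u f ω := by simp [valueAt, h]

lemma valueAt_le {c : ℝ≥0∞} (hu : ∀ f ω, u f ω ≤ c) (ω : Ω) : valueAt u d ω ≤ c := by
  induction h : d ω using WithTop.recTopCoe with
  | top => simp [valueAt_of_eq_top h]
  | coe f => rw [valueAt_of_eq_coe h]; exact hu f ω

lemma exists_finset_forall_eq_coe (hd : (range d).Finite) :
    ∃ S : Finset ι, ∀ ω (f : ι), d ω = f → f ∈ S := by
  have hfin : ((↑) ⁻¹' range d : Set ι).Finite := hd.preimage WithTop.coe_injective.injOn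
  exact ⟨hfin.toFinset, fun ω f h ↦ by simpa using ⟨ω, h⟩⟩

lemma valueAt_eq_sum {S : Finset ι} (hS : ∀ ω (f : ι), d ω = f → f ∈ S) :
    valueAt u d = fun ω ↦ ∑ f ∈ S, {ω | d ω = f}.indicator (u f) ω := by
  ext ω
  induction h : d ω using WithTop.recTopCoe with
  | top => simp [valueAt_of_eq_top h, h]
  | coe e =>
    rw [valueAt_of_eq_coe h, Finset.sum_eq_single_of_mem e (hS ω e h) fun f _ hf ↦ ?_]
    · exact (indicator_of_mem (s := {ω | d ω = e}) h _).symm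
    · exact indicator_of_notMem (by simpa [h] using hf.symm) _

lemma measurable_valueAt (hd : (range d).Finite) (hdm : ∀ f : ι, MeasurableSet {ω | d ω = f})
    (hu : ∀ f, Measurable (u f)) : Measurable (valueAt u d) := by
  obtain ⟨S, hS⟩ := exists_finset_forall_eq_coe hd
  rw [valueAt_eq_sum hS]
  exact Finset.measurable_fun_sum _ fun f _ ↦ (hu f).indicator (hdm f)

lemma lintegral_valueAt_congr {P : Measure Ω} (hd : (range d).Finite)
    (hdm : ∀ f : ι, MeasurableSet {ω | d ω = f}) (hu : ∀ f, Measurable (u f))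
    (hv : ∀ f, Measurable (v f))
    (h : ∀ f : ι, ∫⁻ ω in {ω | d ω = f}, u f ω ∂P = ∫⁻ ω in {ω | d ω = f}, v f ω ∂P) :
    ∫⁻ ω, valueAt u d ω ∂P = ∫⁻ ω, valueAt v d ω ∂P := by
  obtain ⟨S, hS⟩ := exists_finset_forall_eq_coe hd
  simp only [valueAt_eq_sum hS]
  rw [lintegral_finsetSum _ fun f _ ↦ (hu f).indicator (hdm f),
    lintegral_finsetSum _ fun f _ ↦ (hv f).indicator (hdm f)]
  simp only [lintegral_indicator (hdm _), h]

lemma measurableSet_ne_top (hd : (range d).Finite)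
    (hdm : ∀ f : ι, MeasurableSet {ω | d ω = f}) : MeasurableSet {ω | d ω ≠ ⊤} := by
  obtain ⟨S, hS⟩ := exists_finset_forall_eq_coe hd
  have : {ω | d ω ≠ ⊤} = ⋃ f ∈ S, {ω | d ω = f} := by
    ext ω
    simp only [mem_ofPred_eq, mem_iUnion, exists_prop, WithTop.ne_top_iff_exists]
    exact ⟨fun ⟨f, hf⟩ ↦ ⟨f, hS ω f hf.symm, hf.symm⟩, fun ⟨f, _, hf⟩ ↦ ⟨f, hf.symm⟩⟩
  rw [this]
  exact Finset.measurableSet_biUnion _ fun f _ ↦ hdm f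

end

lemma setLIntegral_le_of_forall_inner {P : Measure Ω} {Ω₀ : Set Ω} {F G : Ω → ℝ≥0∞} {c : ℝ≥0}
    (hF : ∀ ω, F ω ≤ c)
    (h : ∀ ε : ℝ≥0∞, ε ≠ 0 → ∃ K ⊆ Ω₀, P (Ω₀ \ K) ≤ ε ∧
      ∫⁻ ω in K, F ω ∂P ≤ ∫⁻ ω in K, G ω ∂P) :
    ∫⁻ ω in Ω₀, F ω ∂P ≤ ∫⁻ ω in Ω₀, G ω ∂P := by
  refine ENNReal.le_of_forall_pos_le_add fun ε hε _ ↦ ?_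
  obtain ⟨K, hKΩ, hP, hFG⟩ := h (ε / (c + 1)) (by simp [hε.ne'])
  calc ∫⁻ ω in Ω₀, F ω ∂P = ∫⁻ ω in K ∪ Ω₀ \ K, F ω ∂P := by rw [union_sdiff_cancel hKΩ]
    _ ≤ ∫⁻ ω in K, F ω ∂P + ∫⁻ ω in Ω₀ \ K, F ω ∂P := lintegral_union_le _ _ _
    _ ≤ ∫⁻ ω in Ω₀, G ω ∂P + ∫⁻ _ in Ω₀ \ K, c ∂P :=
      add_le_add (hFG.trans (lintegral_mono_set hKΩ)) (lintegral_mono hF)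
    _ ≤ ∫⁻ ω in Ω₀, G ω ∂P + (c + 1) * (ε / (c + 1)) := by
      rw [setLIntegral_const]
      gcongr
      exact le_self_add
    _ = ∫⁻ ω in Ω₀, G ω ∂P + ε := by rw [ENNReal.mul_div_cancel (by simp) (by simp)]

variable {𝓕 : Filtration (Time T) m} {δ : ℕ → ℝ≥0} {d : ℕ → Ω → WithTop (Time T)}

lemma IsAnnouncing.measurableSet_eq (hd : IsAnnouncing 𝓕 δ d) (n : ℕ) (f : Time T) :
    MeasurableSet {ω | d n ω = f} :=
  𝓕.le _ _ ((hd.knownAhead n).measurableSet_eq f)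

lemma IsAnnouncing.measurableSet_forall_ne_top (hd : IsAnnouncing 𝓕 δ d) :
    MeasurableSet {ω | ∀ n, d n ω ≠ ⊤} := by
  rw [ofPred_forall]
  exact .iInter fun n ↦ measurableSet_ne_top (hd.knownAhead n).finite_range (hd.measurableSet_eq n)

lemma IsAnnouncing.tendsto_lintegral_valueAt {P : Measure Ω} [IsFiniteMeasure P]
    (hd : IsAnnouncing 𝓕 δ d) {w : ℕ → Time T → Ω → ℝ≥0∞} {W : Ω → ℝ≥0∞} {c : ℝ≥0}
    (hw : ∀ n f, Measurable (w n f)) (hwc : ∀ n f ω, w n f ω ≤ c)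
    (hW : ∀ ω, (∀ n, d n ω ≠ ⊤) → Tendsto (fun n ↦ valueAt (w n) (d n) ω) atTop (𝓝 (W ω))) :
    Tendsto (fun n ↦ ∫⁻ ω, valueAt (w n) (d n) ω ∂P) atTop
      (𝓝 (∫⁻ ω in {ω | ∀ n, d n ω ≠ ⊤}, W ω ∂P)) := by
  rw [← lintegral_indicator hd.measurableSet_forall_ne_top]
  refine tendsto_lintegral_of_dominated_convergence (fun _ ↦ (c : ℝ≥0∞))
    (fun n ↦ measurable_valueAt (hd.knownAhead n).finite_range (hd.measurableSet_eq n) (hw n))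
    (fun n ↦ ae_of_all _ (valueAt_le (hwc n))) ?_ (ae_of_all _ fun ω ↦ ?_)
  · simpa using ENNReal.mul_ne_top ENNReal.coe_ne_top (measure_ne_top P _)
  · by_cases hω : ∀ n, d n ω ≠ ⊤
    · simpa [hω] using hW ω hω
    · obtain ⟨n, hn⟩ : ∃ n, d n ω = ⊤ := by simpa using hω
      refine tendsto_const_nhds.congr' ?_
      filter_upwards [eventually_ge_atTop n] with k hk
      rw [valueAt_of_eq_top (top_le_iff.1 (hn ▸ hd.monotone hk ω)),
        indicator_of_notMem (s := {ω | ∀ n, d n ω ≠ ⊤}) hω]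

lemma tendsto_shiftBack_nhdsLT {δ : ℕ → ℝ≥0} {e : ℕ → Time T} {t : Time T} (ht : ⊥ < t)
    (hδ : ∀ n, 0 < δ n) (hδ0 : Tendsto δ atTop (𝓝 0)) (he : ∀ n, e n ≤ t)
    (het : Tendsto e atTop (𝓝 t)) : Tendsto (fun n ↦ shiftBack (e n) (δ n)) atTop (𝓝[<] t) := by
  refine tendsto_nhdsWithin_iff.2 ⟨?_, .of_forall fun n ↦ ?_⟩
  · rw [tendsto_subtype_rng]
    simpa [coe_shiftBack] using (tendsto_subtype_rng.1 het).sub hδ0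
  · rcases (he n).eq_or_lt with h | h
    · exact h.symm ▸ shiftBack_lt ht (hδ n)
    · exact (shiftBack_le _ _).trans_lt h

variable {P : Measure Ω} [IsFiniteMeasure P] {L : Ω → ℝ} {Q : Time T → Ω → ProbabilityMeasure ℝ}

-- On `{d n = f}`, an event known at time `f - δ n`, the law `Q (f - δ n)` averages to that of `L`;
-- these laws converge to the left limit at the announced time.
lemma IsCadlagLaw.setLIntegral_leftLaw_of_isAnnouncing (hL : Measurable L)
    (hQ : IsCadlagLaw 𝓕 P L Q) (hd : IsAnnouncing 𝓕 δ d) {r : Ω → Time T}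
    (hr : ∀ ω, (∀ n, d n ω ≠ ⊤) → ⊥ < r ω ∧ ∃ e : ℕ → Time T,
      (∀ n, d n ω = e n) ∧ Tendsto e atTop (𝓝 (r ω)))
    (g : BoundedContinuousFunction ℝ ℝ≥0) :
    ∫⁻ ω in {ω | ∀ n, d n ω ≠ ⊤}, ∫⁻ x, g x ∂(leftLaw Q (r ω) ω) ∂P =
      ∫⁻ ω in {ω | ∀ n, d n ω ≠ ⊤}, g (L ω) ∂P := by
  have hc := BoundedContinuousFunction.NNReal.upper_bound g
  have hgm : Measurable fun x ↦ (g x : ℝ≥0∞) := g.continuous.measurable.coe_nnreal_ennreal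
  let u : ℕ → Time T → Ω → ℝ≥0∞ := fun n f ω ↦ ∫⁻ x, g x ∂(Q (shiftBack f (δ n)) ω : Measure ℝ)
  let v : Time T → Ω → ℝ≥0∞ := fun _ ω ↦ g (L ω)
  have hum : ∀ n f, Measurable (u n f) := fun n f ↦ (Measure.measurable_lintegral hgm).comp
    ((hQ.measurable _).mono (𝓕.le _) le_rfl)
  have hvm : ∀ f, Measurable (v f) := fun _ ↦ hgm.comp hL
  have huv : ∀ n, ∫⁻ ω, valueAt (u n) (d n) ω ∂P = ∫⁻ ω, valueAt v (d n) ω ∂P := fun n ↦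
    lintegral_valueAt_congr (hd.knownAhead n).finite_range (hd.measurableSet_eq n) (hum n) hvm
      fun f ↦ hQ.law _ _ ((hd.knownAhead n).measurableSet_eq f) _ hgm
  refine tendsto_nhds_unique (hd.tendsto_lintegral_valueAt hum
    (fun n f ↦ lintegral_law_le (κ := fun ω ↦ (Q (shiftBack f (δ n)) ω : Measure ℝ)) hc)
    fun ω hω ↦ ?_) ((hd.tendsto_lintegral_valueAt (fun _ ↦ hvm)
      (fun _ _ ω ↦ ENNReal.coe_le_coe.2 (hc (L ω))) fun ω hω ↦ ?_).congr fun n ↦ (huv n).symm)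
  · obtain ⟨hpos, e, he, her⟩ := hr ω hω
    have hemono : Monotone e := fun i j hij ↦ by
      simpa only [he, WithTop.coe_le_coe] using hd.monotone hij ω
    refine ((hQ.tendsto_lintegral_leftLaw hpos ω g).comp (tendsto_shiftBack_nhdsLT hpos hd.pos
      hd.tendsto_zero (hemono.ge_of_tendsto her) her)).congr fun n ↦ ?_
    exact (valueAt_of_eq_coe (u := u n) (he n)).symm
  · obtain ⟨-, e, he, -⟩ := hr ω hω
    exact tendsto_const_nhds.congr fun n ↦ (valueAt_of_eq_coe (u := v) (he n)).symm

theorem IsCadlagLaw.setLIntegral_leftLaw (hL : Measurable L) (hQ : IsCadlagLaw 𝓕 P L Q)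
    {Ω₀ : Set Ω} {r : Ω → Time T} (hr : Measurable r)
    (hgr : MeasurableSet[𝓕.predictable] {p : Time T × Ω | p.2 ∈ Ω₀ ∧ p.1 = r p.2})
    (hpos : ∀ ω ∈ Ω₀, ⊥ < r ω) {f : ℝ → ℝ≥0∞} (hf : Measurable f) :
    ∫⁻ ω in Ω₀, ∫⁻ x, f x ∂(leftLaw Q (r ω) ω) ∂P = ∫⁻ ω in Ω₀, f (L ω) ∂P := by
  have hκ : Measurable fun ω ↦ leftLaw Q (r ω) ω :=
    (hQ.measurable_leftLaw.mono (predictable_le 𝓕) le_rfl).comp (hr.prodMk measurable_id)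
  refine setLIntegral_of_forall_bcf hL hκ (fun g ↦ ?_) hf
  have hc := BoundedContinuousFunction.NNReal.upper_bound g
  have hinner : ∀ ε : ℝ≥0∞, ε ≠ 0 → ∃ K ⊆ Ω₀, P (Ω₀ \ K) ≤ ε ∧
      ∫⁻ ω in K, ∫⁻ x, g x ∂(leftLaw Q (r ω) ω) ∂P = ∫⁻ ω in K, g (L ω) ∂P := fun ε hε ↦ by
    obtain ⟨δ, d, hd, hPε, hlim⟩ := exists_isAnnouncing_of_measurableSet_graph (P := P) hr hgr hε
    exact ⟨_, fun ω hω ↦ (hlim ω hω).1, hPε,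
      hQ.setLIntegral_leftLaw_of_isAnnouncing hL hd
        (fun ω hω ↦ ⟨hpos ω (hlim ω hω).1, (hlim ω hω).2⟩) g⟩
  refine le_antisymm
    (setLIntegral_le_of_forall_inner (lintegral_law_le (κ := fun ω ↦ leftLaw Q (r ω) ω) hc)
      fun ε hε ↦ ?_)
    (setLIntegral_le_of_forall_inner (fun ω ↦ ENNReal.coe_le_coe.2 (hc (L ω))) fun ε hε ↦ ?_)
  all_goals obtain ⟨K, hK, hPK, heq⟩ := hinner ε hε
  · exact ⟨K, hK, hPK, heq.le⟩
  · exact ⟨K, hK, hPK, heq.ge⟩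

end PredictableTime

/-! ### Increasing predictable processes and time changes -/

section Stieltjes

variable {f : Time T → ℝ}

/-- The first time at which `f` reaches the level `c`, or the final time if there is none. -/
def debut (f : Time T → ℝ) (c : ℝ) : Time T := sInf (insert ⊤ {t | c ≤ f t})

lemma debut_le_iff (hf : RightContinuous f) (hm : Monotone f) {c : ℝ} {t : Time T} :
    debut f c ≤ t ↔ c ≤ f t ∨ t = ⊤ := by
  have hglb : IsGLB (insert ⊤ {t | c ≤ f t}) (debut f c) :=
    isGLB_csInf (insert_nonempty _ _) (OrderBot.bddBelow _)
  refine ⟨fun ht ↦ ?_, fun ht ↦ hglb.1 (ht.symm.imp_right id)⟩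
  by_contra! hlt
  have hlt' : f (debut f c) < c := (hm ht).trans_lt hlt.1
  obtain ⟨s, hs, hsc, hsT⟩ := ((hglb.frequently_mem (insert_nonempty _ _)).and_eventually
    (((hf _).eventually_lt_const hlt').and
      (nhdsWithin_le_nhds (Iio_mem_nhds (ht.trans_lt hlt.2.lt_top))))).exists
  exact hs.elim (fun h ↦ lt_irrefl (⊤ : Time T) (h ▸ hsT)) hsc.not_ge

lemma le_apply_debut (hf : RightContinuous f) (hm : Monotone f) {c : ℝ} (hc : c ≤ f ⊤) :
    c ≤ f (debut f c) :=
  ((debut_le_iff hf hm).1 le_rfl).elim id fun h ↦ h ▸ hc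

lemma bot_lt_debut (hf : RightContinuous f) (hm : Monotone f) {c : ℝ} (h0 : f ⊥ < c)
    (hc : c ≤ f ⊤) : ⊥ < debut f c := by
  rw [bot_lt_iff_ne_bot]
  intro h
  exact h0.not_ge (h ▸ le_apply_debut hf hm hc)

lemma eq_debut_iff (hf : RightContinuous f) (hm : Monotone f) {D : Set (Time T)} (hD : Dense D)
    {c : ℝ} {t : Time T} :
    c ≤ f ⊤ ∧ t = debut f c ↔ c ≤ f t ∧ ∀ q ∈ D, t ≤ q ∨ f q < c := by
  constructor
  · rintro ⟨hc, rfl⟩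
    refine ⟨le_apply_debut hf hm hc, fun q _ ↦ ?_⟩
    rw [debut_le_iff hf hm]
    exact (le_or_gt c (f q)).imp_left Or.inl
  · rintro ⟨ht, hq⟩
    have hc : c ≤ f ⊤ := ht.trans (hm le_top)
    refine ⟨hc, le_antisymm ?_ ((debut_le_iff hf hm).2 (Or.inl ht))⟩
    by_contra! hlt
    obtain ⟨q, hqD, hq₁, hq₂⟩ := hD.exists_between hlt
    exact (hq q hqD).elim hq₂.not_ge
      ((le_apply_debut hf hm hc).trans (hm hq₁.le)).not_gt

lemma stieltjes_Ioc (hf : RightContinuous f) (hm : Monotone f) (s t : Time T) :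
    stieltjes f (Ioc s t) = ENNReal.ofReal (f t - f s) := by
  rw [stieltjes, dif_pos ⟨hm, hf⟩, StieltjesFunction.measure_Ioc]

lemma stieltjes_Iic (hf : RightContinuous f) (hm : Monotone f) (t : Time T) :
    stieltjes f (Iic t) = ENNReal.ofReal (f t - f ⊥) := by
  rw [stieltjes, dif_pos ⟨hm, hf⟩, ← Icc_bot (a := t), StieltjesFunction.measure_Icc,
    leftLim_eq_of_isBot isBot_bot]

lemma stieltjes_bot (f : Time T → ℝ) : stieltjes f {⊥} = 0 := by
  by_cases h : Monotone f ∧ RightContinuous f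
  · rw [← Iic_bot, stieltjes_Iic h.2 h.1, sub_self, ENNReal.ofReal_zero]
  · rw [stieltjes, dif_neg h, Measure.coe_zero, Pi.zero_apply]

instance (f : Time T → ℝ) : IsFiniteMeasure (stieltjes f) := by
  by_cases h : Monotone f ∧ RightContinuous f
  · refine ⟨?_⟩
    rw [← Iic_top, stieltjes_Iic h.2 h.1]
    exact ENNReal.ofReal_lt_top
  · rw [stieltjes, dif_neg h]
    infer_instance

lemma restrict_stieltjes_Ioc_bot_top (f : Time T → ℝ) :
    (stieltjes f).restrict (Ioc ⊥ ⊤) = stieltjes f := by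
  rw [Measure.restrict_eq_self_of_ae_mem]
  filter_upwards [measure_eq_zero_iff_ae_notMem.1 (stieltjes_bot f)] with t ht
  exact ⟨bot_lt_iff_ne_bot.2 ht, le_top⟩

lemma measurable_debut (hf : RightContinuous f) (hm : Monotone f) : Measurable (debut f) := by
  refine Monotone.measurable fun c c' hcc ↦ (debut_le_iff hf hm).2 ?_
  exact ((debut_le_iff hf hm).1 le_rfl).imp_left hcc.trans

lemma map_debut (hf : RightContinuous f) (hm : Monotone f) :
    (volume.restrict (Ioc (f ⊥) (f ⊤))).map (debut f) = stieltjes f := by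
  refine Measure.ext_of_Iic _ _ fun t ↦ ?_
  have hpre : debut f ⁻¹' Iic t ∩ Ioc (f ⊥) (f ⊤) = Ioc (f ⊥) (f t) := by
    ext c
    simp only [mem_inter_iff, mem_preimage, mem_Iic, debut_le_iff hf hm, mem_Ioc]
    constructor
    · rintro ⟨h | rfl, h₁, h₂⟩
      · exact ⟨h₁, h⟩
      · exact ⟨h₁, h₂⟩
    · rintro ⟨h₁, h₂⟩
      exact ⟨Or.inl h₂, h₁, h₂.trans (hm le_top)⟩
  rw [Measure.map_apply (measurable_debut hf hm) measurableSet_Iic, stieltjes_Iic hf hm,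
    Measure.restrict_apply (measurable_debut hf hm measurableSet_Iic), hpre, Real.volume_Ioc]

lemma lintegral_stieltjes (hf : RightContinuous f) (hm : Monotone f) {G : Time T → ℝ≥0∞}
    (hG : Measurable G) :
    ∫⁻ s, G s ∂(stieltjes f) = ∫⁻ c in Ioc (f ⊥) (f ⊤), G (debut f c) := by
  rw [← map_debut hf hm, lintegral_map hG (measurable_debut hf hm)]

end Stieltjes

/-- Increasing right-continuous predictable processes null at `0`: the integrators of the drift. -/
structure IsIncreasing (𝓕 : Filtration (Time T) m) (C : Time T → Ω → ℝ) : Prop where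
  predictable : Measurable[𝓕.predictable] fun p : Time T × Ω ↦ C p.1 p.2
  zero : ∀ ω, C ⊥ ω = 0
  mono : ∀ ω, Monotone fun t ↦ C t ω
  rightCont : ∀ ω, RightContinuous fun t ↦ C t ω

namespace IsIncreasing

variable {𝓕 : Filtration (Time T) m} {C : Time T → Ω → ℝ}

lemma adapted (hC : IsIncreasing 𝓕 C) : StronglyAdapted 𝓕 C :=
  IsStronglyPredictable.stronglyAdapted (E := ℝ)
    (show StronglyMeasurable[𝓕.predictable] (Function.uncurry C) from
      hC.predictable.stronglyMeasurable)

lemma measurable (hC : IsIncreasing 𝓕 C) (t : Time T) : Measurable (C t) :=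
  (hC.adapted t).measurable.mono (𝓕.le t) le_rfl

lemma measurable_debut (hC : IsIncreasing 𝓕 C) :
    Measurable fun p : ℝ × Ω ↦ debut (fun t ↦ C t p.2) p.1 := by
  refine measurable_of_Iic fun t ↦ ?_
  have hpre : (fun p : ℝ × Ω ↦ debut (fun t ↦ C t p.2) p.1) ⁻¹' Iic t
      = {p | p.1 ≤ C t p.2} ∪ {_p | t = ⊤} := by
    ext p
    exact debut_le_iff (hC.rightCont p.2) (hC.mono p.2)
  rw [hpre]
  exact (measurableSet_le measurable_fst ((hC.measurable t).comp measurable_snd)).union (.const _)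

lemma measurableSet_graph_debut (hC : IsIncreasing 𝓕 C) (c : ℝ) :
    MeasurableSet[𝓕.predictable]
      {p : Time T × Ω | p.2 ∈ {ω | c ≤ C ⊤ ω} ∧ p.1 = debut (fun t ↦ C t p.2) c} := by
  obtain ⟨D, hDc, hD⟩ := TopologicalSpace.exists_countable_dense (Time T)
  have hgraph : {p : Time T × Ω | p.2 ∈ {ω | c ≤ C ⊤ ω} ∧ p.1 = debut (fun t ↦ C t p.2) c}
      = {p | c ≤ C p.1 p.2} ∩ ⋂ q ∈ D, (Prod.fst ⁻¹' Iic q ∪ Ioi q ×ˢ {ω | C q ω < c}) := by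
    ext ⟨t, ω⟩
    simp only [mem_ofPred_eq, eq_debut_iff (hC.rightCont ω) (hC.mono ω) hD, mem_inter_iff,
      mem_iInter, mem_union, mem_preimage, mem_Iic, mem_prod, mem_Ioi]
    refine and_congr_right fun _ ↦ forall₂_congr fun q _ ↦ ?_
    rw [or_and_left, and_iff_right (le_or_gt t q)]
  rw [hgraph]
  refine MeasurableSet.inter (hC.predictable measurableSet_Ici) (.biInter hDc fun q _ ↦ ?_)
  exact (measurable_fst_predictable 𝓕 measurableSet_Iic).union
    (measurableSet_predictable_Ioi_prod ((hC.adapted q).measurable measurableSet_Iio))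

lemma lintegral_eq_indicator (hC : IsIncreasing 𝓕 C) (ω : Ω) {G : Time T → ℝ≥0∞}
    (hG : Measurable G) :
    ∫⁻ s, G s ∂(stieltjes fun t ↦ C t ω)
      = ∫⁻ c in Ioi (0 : ℝ), {c | c ≤ C ⊤ ω}.indicator (fun c ↦ G (debut (fun t ↦ C t ω) c)) c := by
  have hs : MeasurableSet {c | c ≤ C ⊤ ω} := measurableSet_Iic
  rw [lintegral_stieltjes (hC.rightCont ω) (hC.mono ω) hG, hC.zero, lintegral_indicator hs,
    Measure.restrict_restrict hs, ← Ioi_inter_Iic, inter_comm]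
  rfl

lemma measurable_indicator_debut (hC : IsIncreasing 𝓕 C) {G : Time T × Ω → ℝ≥0∞}
    (hG : Measurable G) : Measurable fun p : ℝ × Ω ↦
      {c | c ≤ C ⊤ p.2}.indicator (fun c ↦ G (debut (fun t ↦ C t p.2) c, p.2)) p.1 := by
  have h : Measurable fun p : ℝ × Ω ↦ G (debut (fun t ↦ C t p.2) p.1, p.2) :=
    hG.comp (hC.measurable_debut.prodMk measurable_snd)
  exact h.indicator (measurableSet_le measurable_fst ((hC.measurable ⊤).comp measurable_snd))

lemma measurable_lintegral (hC : IsIncreasing 𝓕 C) {G : Time T × Ω → ℝ≥0∞} (hG : Measurable G) :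
    Measurable fun ω ↦ ∫⁻ s, G (s, ω) ∂(stieltjes fun t ↦ C t ω) := by
  rw [funext fun ω ↦ hC.lintegral_eq_indicator ω (G := fun s ↦ G (s, ω))
    (hG.comp measurable_prodMk_right)]
  exact (hC.measurable_indicator_debut hG).lintegral_prod_left'

lemma lintegral_lintegral (hC : IsIncreasing 𝓕 C) {P : Measure Ω} [SFinite P]
    {G : Time T × Ω → ℝ≥0∞} (hG : Measurable G) :
    ∫⁻ ω, ∫⁻ s, G (s, ω) ∂(stieltjes fun t ↦ C t ω) ∂P
      = ∫⁻ c in Ioi (0 : ℝ), ∫⁻ ω in {ω | c ≤ C ⊤ ω}, G (debut (fun t ↦ C t ω) c, ω) ∂P := by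
  rw [lintegral_congr fun ω ↦ hC.lintegral_eq_indicator ω (G := fun s ↦ G (s, ω))
      (hG.comp measurable_prodMk_right),
    lintegral_lintegral_swap
      (f := fun ω c ↦ {c | c ≤ C ⊤ ω}.indicator (fun c ↦ G (debut (fun t ↦ C t ω) c, ω)) c)
      ((hC.measurable_indicator_debut hG).comp measurable_swap).aemeasurable]
  refine lintegral_congr fun c ↦ ?_
  rw [← lintegral_indicator (measurableSet_le measurable_const (hC.measurable ⊤))]
  rfl

end IsIncreasing

/-! ### Disintegration of `L` along the predictable σ-algebra -/

lemma setLIntegral_kernel_of_forall_prod {A E : Type*} [MeasurableSpace A] [MeasurableSpace E]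
    {P : Measure Ω} [IsFiniteMeasure P] {φ : Ω → A} (hφ : Measurable φ) {K : Kernel A E}
    [IsMarkovKernel K] {Y : Ω → E} (hY : Measurable Y) {S : Set Ω}
    (h : ∀ D, MeasurableSet D → ∀ B, MeasurableSet B →
      ∫⁻ ω in φ ⁻¹' D ∩ S, K (φ ω) B ∂P = P (Y ⁻¹' B ∩ (φ ⁻¹' D ∩ S)))
    {H : A × E → ℝ≥0∞} (hH : Measurable H) :
    ∫⁻ ω in S, ∫⁻ x, H (φ ω, x) ∂(K (φ ω)) ∂P = ∫⁻ ω in S, H (φ ω, Y ω) ∂P := by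
  have hjoint : ((P.restrict S).map φ) ⊗ₘ K = (P.restrict S).map fun ω ↦ (φ ω, Y ω) := by
    refine Measure.ext_prod fun {D B} hD hB ↦ ?_
    rw [Measure.compProd_apply_prod hD hB, setLIntegral_map hD (K.measurable_coe hB) hφ,
      Measure.restrict_restrict (hφ hD), Measure.map_apply (hφ.prodMk hY) (hD.prod hB),
      Measure.restrict_apply ((hφ.prodMk hY) (hD.prod hB)), h D hD B hB, mk_preimage_prod,
      inter_comm (φ ⁻¹' D) (Y ⁻¹' B), inter_assoc]
  rw [← lintegral_map hH (hφ.prodMk hY), ← hjoint, Measure.lintegral_compProd hH,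
    lintegral_map (hH.lintegral_kernel_prod_right' (κ := K)) hφ]

/-- `[0, T] × Ω` with the predictable σ-algebra, as a type of its own so that predictable
transition kernels are kernels on it. -/
def PredictableSpace (_ : Filtration (Time T) m) : Type _ := Time T × Ω

instance (𝓕 : Filtration (Time T) m) : MeasurableSpace (PredictableSpace 𝓕) := 𝓕.predictable

section Disintegration

variable {𝓕 : Filtration (Time T) m} {P : Measure Ω} {L : Ω → ℝ}
  {Q : Time T → Ω → ProbabilityMeasure ℝ} {C : Time T → Ω → ℝ}

/-- The left limits of the conditional laws, as a kernel from the predictable σ-algebra. -/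
def IsCadlagLaw.leftKernel (hQ : IsCadlagLaw 𝓕 P L Q) : Kernel (PredictableSpace 𝓕) ℝ where
  toFun p := leftLaw Q p.1 p.2
  measurable' := hQ.measurable_leftLaw

instance (hQ : IsCadlagLaw 𝓕 P L Q) : IsMarkovKernel hQ.leftKernel :=
  ⟨fun p ↦ inferInstanceAs (IsProbabilityMeasure (leftLaw Q p.1 p.2))⟩

lemma IsCadlagLaw.measurable_lintegral_leftLaw (hQ : IsCadlagLaw 𝓕 P L Q)
    {H : (Time T × Ω) × ℝ → ℝ≥0∞} (hH : Measurable[𝓕.predictable.prod (borel ℝ)] H) :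
    Measurable[𝓕.predictable] fun p : Time T × Ω ↦ ∫⁻ x, H (p, x) ∂(leftLaw Q p.1 p.2) :=
  Measurable.lintegral_kernel_prod_right' (κ := hQ.leftKernel) hH

lemma measurable_prod_of_predictable {B : Type*} [MeasurableSpace B] {H : (Time T × Ω) × ℝ → B}
    (hH : Measurable[𝓕.predictable.prod (borel ℝ)] H) : Measurable H := by
  refine hH.mono ?_ le_rfl
  rw [← BorelSpace.measurable_eq (α := ℝ)]
  exact sup_le_sup (MeasurableSpace.comap_mono (predictable_le 𝓕)) le_rfl

lemma measurable_comp_of_predictable {B : Type*} [MeasurableSpace B]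
    {H : (Time T × Ω) × ℝ → B} (hH : Measurable[𝓕.predictable.prod (borel ℝ)] H) {L : Ω → ℝ}
    (hL : Measurable L) : Measurable fun p : Time T × Ω ↦ H (p, L p.2) :=
  (measurable_prod_of_predictable hH).comp (measurable_id.prodMk (hL.comp measurable_snd))

variable [IsFiniteMeasure P]

lemma IsCadlagLaw.setLIntegral_leftLaw_prod (hL : Measurable L) (hQ : IsCadlagLaw 𝓕 P L Q)
    {S : Set Ω} {r : Ω → Time T} (hr : Measurable r)
    (hgr : MeasurableSet[𝓕.predictable] {p : Time T × Ω | p.2 ∈ S ∧ p.1 = r p.2})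
    (hpos : ∀ ω ∈ S, ⊥ < r ω) {H : (Time T × Ω) × ℝ → ℝ≥0∞}
    (hH : Measurable[𝓕.predictable.prod (borel ℝ)] H) :
    ∫⁻ ω in S, ∫⁻ x, H ((r ω, ω), x) ∂(leftLaw Q (r ω) ω) ∂P =
      ∫⁻ ω in S, H ((r ω, ω), L ω) ∂P := by
  let φ : Ω → PredictableSpace 𝓕 := fun ω ↦ (r ω, ω)
  have hφ : Measurable φ := (hr.prodMk measurable_id).mono le_rfl (predictable_le 𝓕)
  refine setLIntegral_kernel_of_forall_prod hφ (K := hQ.leftKernel) hL (fun D hD B hB ↦ ?_) hH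
  have hgrD : MeasurableSet[𝓕.predictable]
      {p : Time T × Ω | p.2 ∈ φ ⁻¹' D ∩ S ∧ p.1 = r p.2} := by
    convert! hD.inter hgr using 1
    ext ⟨t, ω⟩
    constructor
    · rintro ⟨⟨hωD, hω⟩, ht : t = r ω⟩
      exact ⟨ht ▸ hωD, hω, ht⟩
    · rintro ⟨hωD, hω, ht : t = r ω⟩
      exact ⟨⟨ht ▸ hωD, hω⟩, ht⟩
  calc ∫⁻ ω in φ ⁻¹' D ∩ S, leftLaw Q (r ω) ω B ∂P
      = ∫⁻ ω in φ ⁻¹' D ∩ S, ∫⁻ x, B.indicator 1 x ∂(leftLaw Q (r ω) ω) ∂P := by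
        simp_rw [lintegral_indicator_one hB]
    _ = ∫⁻ ω in φ ⁻¹' D ∩ S, (L ⁻¹' B).indicator 1 ω ∂P :=
        hQ.setLIntegral_leftLaw hL hr hgrD (fun ω hω ↦ hpos ω hω.2) (measurable_one.indicator hB)
    _ = P (L ⁻¹' B ∩ (φ ⁻¹' D ∩ S)) := by
        rw [lintegral_indicator_one (hL hB), Measure.restrict_apply (hL hB)]

theorem IsCadlagLaw.lintegral_lintegral_leftLaw (hL : Measurable L) (hQ : IsCadlagLaw 𝓕 P L Q)
    (hC : IsIncreasing 𝓕 C) {H : (Time T × Ω) × ℝ → ℝ≥0∞}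
    (hH : Measurable[𝓕.predictable.prod (borel ℝ)] H) :
    ∫⁻ ω, ∫⁻ s, ∫⁻ x, H ((s, ω), x) ∂(leftLaw Q s ω) ∂(stieltjes fun t ↦ C t ω) ∂P
      = ∫⁻ ω, ∫⁻ s, H ((s, ω), L ω) ∂(stieltjes fun t ↦ C t ω) ∂P := by
  rw [hC.lintegral_lintegral (G := fun p ↦ ∫⁻ x, H (p, x) ∂(leftLaw Q p.1 p.2))
      ((hQ.measurable_lintegral_leftLaw hH).mono (predictable_le 𝓕) le_rfl),
    hC.lintegral_lintegral (measurable_comp_of_predictable hH hL)]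
  refine setLIntegral_congr_fun measurableSet_Ioi fun c hc ↦ ?_
  exact hQ.setLIntegral_leftLaw_prod hL (hC.measurable_debut.comp measurable_prodMk_left)
    (hC.measurableSet_graph_debut c)
    (fun ω hω ↦ bot_lt_debut (hC.rightCont ω) (hC.mono ω) ((hC.zero ω).trans_lt hc) hω) hH

end Disintegration

/-! ### Integrals with respect to increasing predictable processes -/

lemma tendsto_setIntegral_of_eventually_mem_iff {A β : Type*} [MeasurableSpace A] {μ : Measure A}
    {f : A → ℝ} (hf : Integrable f μ) {l : Filter β} [l.IsCountablyGenerated] {S : β → Set A}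
    {S' : Set A} (hS : ∀ b, MeasurableSet (S b)) (hS' : MeasurableSet S')
    (h : ∀ a, ∀ᶠ b in l, a ∈ S b ↔ a ∈ S') :
    Tendsto (fun b ↦ ∫ a in S b, f a ∂μ) l (𝓝 (∫ a in S', f a ∂μ)) := by
  simp only [← integral_indicator (hS _), ← integral_indicator hS']
  refine tendsto_integral_filter_of_dominated_convergence (fun a ↦ ‖f a‖)
    (.of_forall fun b ↦ hf.1.indicator (hS b))
    (.of_forall fun b ↦ ae_of_all _ fun a ↦ norm_indicator_le_norm_self f a) hf.norm
    (ae_of_all _ fun a ↦ tendsto_const_nhds.congr' ?_)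
  filter_upwards [h a] with b hb
  classical simp only [indicator_apply, hb]

lemma isCadlag_setIntegral {μ : Measure (Time T)} {f : Time T → ℝ} (hf : Integrable f μ) :
    IsCadlag fun t ↦ ∫ s in Ioc ⊥ t, f s ∂μ := by
  refine fun t ↦ ⟨?_, ∫ s in Ioo ⊥ t, f s ∂μ, ?_⟩
  · refine tendsto_setIntegral_of_eventually_mem_iff hf (fun _ ↦ measurableSet_Ioc)
      measurableSet_Ioc fun s ↦ ?_
    rcases le_or_gt s t with h | h
    · filter_upwards [self_mem_nhdsWithin] with u hu
      simp only [mem_Ioc, h, h.trans hu]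
    · filter_upwards [nhdsWithin_le_nhds (Iio_mem_nhds h)] with u hu
      simp only [mem_Ioc, h.not_ge, (mem_Iio.1 hu).not_ge]
  · refine tendsto_setIntegral_of_eventually_mem_iff hf (fun _ ↦ measurableSet_Ioc)
      measurableSet_Ioo fun s ↦ ?_
    rcases lt_or_ge s t with h | h
    · filter_upwards [nhdsWithin_le_nhds (Ioi_mem_nhds h)] with u hu
      simp only [mem_Ioc, mem_Ioo, h, (mem_Ioi.1 hu).le]
    · filter_upwards [self_mem_nhdsWithin] with u hu
      simp only [mem_Ioc, mem_Ioo, h.not_gt, ((mem_Iio.1 hu).trans_le h).not_ge]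

lemma isPiSystem_predictable (𝓕 : Filtration (Time T) m) :
    IsPiSystem ({s | ∃ A, MeasurableSet[𝓕 ⊥] A ∧ s = {(⊥ : Time T)} ×ˢ A} ∪
      {s | ∃ i A, MeasurableSet[𝓕 i] A ∧ s = Ioi i ×ˢ A}) := by
  rintro _ (⟨A, hA, rfl⟩ | ⟨i, A, hA, rfl⟩) _ (⟨B, hB, rfl⟩ | ⟨j, B, hB, rfl⟩) hne
  · exact Or.inl ⟨A ∩ B, hA.inter hB, by rw [prod_inter_prod, inter_self]⟩
  · obtain ⟨⟨t, ω⟩, ⟨rfl, -⟩, ht, -⟩ := hne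
    exact absurd (mem_Ioi.1 ht) not_lt_bot
  · obtain ⟨⟨t, ω⟩, ⟨ht, -⟩, rfl, -⟩ := hne
    exact absurd (mem_Ioi.1 ht) not_lt_bot
  · refine Or.inr ⟨max i j, A ∩ B, ?_, by rw [prod_inter_prod, Ioi_inter_Ioi]⟩
    exact (𝓕.mono (le_max_left i j) _ hA).inter (𝓕.mono (le_max_right i j) _ hB)

lemma measurable_indicator_Ioi {𝓕 : Filtration (Time T) m} {B : Type*} [MeasurableSpace B] [Zero B]
    {i : Time T} {f : Ω → B} (hf : Measurable[𝓕 i] f) :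
    Measurable[𝓕.predictable] ((Prod.fst ⁻¹' Ioi i).indicator fun p : Time T × Ω ↦ f p.2) := by
  intro s hs
  have hpre : (Prod.fst ⁻¹' Ioi i).indicator (fun p : Time T × Ω ↦ f p.2) ⁻¹' s
      = Ioi i ×ˢ (f ⁻¹' s) ∪ (Prod.fst ⁻¹' Ioi i)ᶜ ∩ {_p | (0 : B) ∈ s} := by
    ext ⟨t, ω⟩
    by_cases h : i < t <;> simp [indicator, h]
  rw [hpre]
  exact (measurableSet_predictable_Ioi_prod (hf hs)).union
    ((measurable_fst_predictable 𝓕 measurableSet_Ioi).compl.inter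
      (@MeasurableSet.const _ 𝓕.predictable _))

/-- The section of `[0, T] × Ω` at `ω`. -/
def predictableSection (𝓕 : Filtration (Time T) m) (ω : Ω) (s : Time T) : PredictableSpace 𝓕 :=
  (s, ω)

lemma measurable_predictableSection (𝓕 : Filtration (Time T) m) (ω : Ω) :
    Measurable (predictableSection 𝓕 ω) := fun E hE ↦
  measurable_prodMk_right (y := ω) (predictable_le 𝓕 E hE)

/-- The measure `1_{(0, t]}(s) dC_s(ω)`, on the section of `[0, T] × Ω` at `ω`. -/
def sectionMeasure (𝓕 : Filtration (Time T) m) (C : Time T → Ω → ℝ) (p : PredictableSpace 𝓕) :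
    Measure (PredictableSpace 𝓕) :=
  ((stieltjes fun t ↦ C t p.2).restrict (Ioc ⊥ p.1)).map (predictableSection 𝓕 p.2)

instance (𝓕 : Filtration (Time T) m) (C : Time T → Ω → ℝ) (p : PredictableSpace 𝓕) :
    IsFiniteMeasure (sectionMeasure 𝓕 C p) := by
  unfold sectionMeasure
  infer_instance

lemma sectionMeasure_apply {𝓕 : Filtration (Time T) m} (C : Time T → Ω → ℝ)
    (p : PredictableSpace 𝓕) {E : Set (PredictableSpace 𝓕)} (hE : MeasurableSet E) :
    sectionMeasure 𝓕 C p E =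
      stieltjes (fun t ↦ C t p.2) (predictableSection 𝓕 p.2 ⁻¹' E ∩ Ioc ⊥ p.1) := by
  rw [sectionMeasure, Measure.map_apply (measurable_predictableSection 𝓕 p.2) hE,
    Measure.restrict_apply (measurable_predictableSection 𝓕 p.2 hE)]

namespace IsIncreasing

variable {𝓕 : Filtration (Time T) m} {C : Time T → Ω → ℝ}

lemma sectionMeasure_Ioi_prod (hC : IsIncreasing 𝓕 C) {i : Time T} {A : Set Ω}
    (hA : MeasurableSet[𝓕 i] A) (p : PredictableSpace 𝓕) :
    sectionMeasure 𝓕 C p (Ioi i ×ˢ A) =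
      (Ioi i ×ˢ A).indicator (fun p ↦ ENNReal.ofReal (C p.1 p.2 - C i p.2)) p := by
  obtain ⟨t, ω⟩ := p
  rw [sectionMeasure_apply C (t, ω) (measurableSet_predictable_Ioi_prod hA)]
  by_cases hω : ω ∈ A
  · have hsec : predictableSection 𝓕 ω ⁻¹' (Ioi i ×ˢ A) ∩ Ioc ⊥ t = Ioc i t := by
      ext s
      exact ⟨fun h ↦ ⟨h.1.1, h.2.2⟩, fun h ↦ ⟨⟨h.1, hω⟩, bot_le.trans_lt h.1, h.2⟩⟩
    rw [hsec, stieltjes_Ioc (hC.rightCont ω) (hC.mono ω)]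
    by_cases hit : i < t
    · simp [indicator, hit, hω]
    · simpa [indicator, hit, hω] using hC.mono ω (not_lt.1 hit)
  · have hsec : predictableSection 𝓕 ω ⁻¹' (Ioi i ×ˢ A) ∩ Ioc ⊥ t = ∅ :=
      eq_empty_of_forall_notMem fun s hs ↦ hω hs.1.2
    rw [hsec, measure_empty, indicator_of_notMem fun h ↦ hω h.2]

lemma measurable_sectionMeasure (hC : IsIncreasing 𝓕 C) : Measurable (sectionMeasure 𝓕 C) := by
  refine Measurable.measure_of_isPiSystem (S := _) rfl (isPiSystem_predictable 𝓕) ?_ ?_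
  · rintro _ (⟨A, hA, rfl⟩ | ⟨i, A, hA, rfl⟩)
    · have hzero : ∀ p, sectionMeasure 𝓕 C p ({⊥} ×ˢ A) = 0 := fun p ↦ by
        rw [sectionMeasure_apply C p (measurableSet_predictable_singleton_bot_prod hA)]
        exact measure_mono_null (fun s hs ↦ hs.1.1) (stieltjes_bot _)
      simp only [hzero, measurable_const]
    · have hval : ∀ p, sectionMeasure 𝓕 C p (Ioi i ×ˢ A) = (Ioi i ×ˢ A).indicator (fun p ↦
          ENNReal.ofReal (C p.1 p.2 - (Prod.fst ⁻¹' Ioi i).indicator (fun p ↦ C i p.2) p)) p :=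
        fun p ↦ by
          refine (hC.sectionMeasure_Ioi_prod hA p).trans
            (congrFun (indicator_congr fun q hq ↦ ?_) p)
          rw [indicator_of_mem (s := Prod.fst ⁻¹' Ioi i) hq.1]
      simp only [hval]
      exact ((hC.predictable.sub
        (measurable_indicator_Ioi (hC.adapted i).measurable)).ennreal_ofReal).indicator
        (measurableSet_predictable_Ioi_prod hA)
  · have hval : ∀ p, sectionMeasure 𝓕 C p univ = ENNReal.ofReal (C p.1 p.2) := fun p ↦ by
      rw [sectionMeasure_apply C p .univ, preimage_univ, univ_inter,
        stieltjes_Ioc (hC.rightCont _) (hC.mono _), hC.zero, sub_zero]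
    simp only [hval]
    exact hC.predictable.ennreal_ofReal

lemma measurable_setIntegral (hC : IsIncreasing 𝓕 C) {G : Time T × Ω → ℝ}
    (hG : Measurable[𝓕.predictable] G) :
    Measurable[𝓕.predictable] fun p : Time T × Ω ↦
      ∫ s in Ioc ⊥ p.1, G (s, p.2) ∂(stieltjes fun t ↦ C t p.2) := by
  let K : Kernel (PredictableSpace 𝓕) (PredictableSpace 𝓕) :=
    ⟨sectionMeasure 𝓕 C, hC.measurable_sectionMeasure⟩
  let G' : PredictableSpace 𝓕 → ℝ := G
  have hG' : Measurable G' := hG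
  have hval : ∀ p : PredictableSpace 𝓕, ∫ q, G' q ∂(K p) =
      ∫ s in Ioc ⊥ p.1, G (s, p.2) ∂(stieltjes fun t ↦ C t p.2) := fun p ↦
    integral_map (measurable_predictableSection 𝓕 p.2).aemeasurable
      hG'.stronglyMeasurable.aestronglyMeasurable
  have hK : Measurable fun p ↦ ∫ q, G' q ∂(K p) :=
    (StronglyMeasurable.integral_kernel hG'.stronglyMeasurable).measurable
  exact (funext hval) ▸ hK

lemma exists_isIncreasing_setLIntegral {P : Measure Ω} (h𝓕 : UsualConditions 𝓕 P)
    (hC : IsIncreasing 𝓕 C) {φ : Time T × Ω → ℝ≥0∞} (hφ : Measurable[𝓕.predictable] φ)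
    (hfin : ∀ᵐ ω ∂P, ∫⁻ s, φ (s, ω) ∂(stieltjes fun t ↦ C t ω) < ∞) :
    ∃ Γ, IsIncreasing 𝓕 Γ ∧ ∀ᵐ ω ∂P, ∀ t,
      ENNReal.ofReal (Γ t ω) = ∫⁻ s in Ioc ⊥ t, φ (s, ω) ∂(stieltjes fun t ↦ C t ω) := by
  let N : Set Ω := {ω | ∫⁻ s, φ (s, ω) ∂(stieltjes fun t ↦ C t ω) < ∞}
  have hN : MeasurableSet[𝓕 ⊥] N := .of_compl (h𝓕.null Nᶜ (ae_iff.1 hfin))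
  have hφm : ∀ ω, Measurable fun s ↦ φ (s, ω) := fun ω ↦
    (hφ.mono (predictable_le 𝓕) le_rfl).comp measurable_prodMk_right
  have hint : ∀ ω ∈ N, Integrable (fun s ↦ (φ (s, ω)).toReal) (stieltjes fun t ↦ C t ω) :=
    fun ω hω ↦ integrable_toReal_of_lintegral_ne_top (hφm ω).aemeasurable (ne_of_lt hω)
  let Γ : Time T → Ω → ℝ := fun t ↦
    N.indicator fun ω ↦ ∫ s in Ioc ⊥ t, (φ (s, ω)).toReal ∂(stieltjes fun t ↦ C t ω)
  have hΓ : ∀ ω ∈ N, ∀ t, Γ t ω = ∫ s in Ioc ⊥ t, (φ (s, ω)).toReal ∂(stieltjes fun t ↦ C t ω) :=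
    fun ω hω t ↦ indicator_of_mem hω _
  have hΓ0 : ∀ ω ∉ N, ∀ t, Γ t ω = 0 := fun ω hω t ↦ indicator_of_notMem hω _
  refine ⟨Γ, ⟨?_, fun ω ↦ ?_, fun ω ↦ ?_, fun ω ↦ ?_⟩, ?_⟩
  · exact (hC.measurable_setIntegral hφ.ennreal_toReal).indicator (measurableSet_snd_predictable hN)
  · by_cases hω : ω ∈ N
    · rw [hΓ ω hω, Ioc_self, setIntegral_empty]
    · exact hΓ0 ω hω _
  · by_cases hω : ω ∈ N
    · simp only [hΓ ω hω]
      exact fun s t hst ↦ setIntegral_mono_set (hint ω hω).integrableOn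
        (ae_of_all _ fun _ ↦ ENNReal.toReal_nonneg) (Ioc_subset_Ioc_right hst).eventuallyLE
    · simp only [hΓ0 ω hω, monotone_const]
  · by_cases hω : ω ∈ N
    · simp only [hΓ ω hω]
      exact (isCadlag_setIntegral (hint ω hω)).rightContinuous
    · simp only [hΓ0 ω hω]
      exact fun t ↦ continuousWithinAt_const
  · filter_upwards [hfin] with ω hω t
    rw [hΓ ω hω, ofReal_integral_eq_lintegral_ofReal (hint ω hω).integrableOn
      (ae_of_all _ fun _ ↦ ENNReal.toReal_nonneg)]
    refine lintegral_congr_ae (ae_restrict_of_ae ?_)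
    filter_upwards [ae_lt_top (hφm ω) hω.ne] with s hs using ENNReal.ofReal_toReal hs.ne

end IsIncreasing

/-! ### Local boundedness of increasing predictable processes -/

section

variable {𝓕 : Filtration (Time T) m}

lemma iInf_lt_iff_exists_lt {S : ℕ → Ω → WithTop (Time T)} {ω : Ω} {a : WithTop (Time T)} :
    ⨅ n, S n ω < a ↔ ∃ n, S n ω < a :=
  ciInf_lt_iff (OrderBot.bddBelow _)

lemma lt_top_iff_le_coe_top {a : WithTop (Time T)} : a < ⊤ ↔ a ≤ (⊤ : Time T) := by
  cases a <;> simp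

lemma isStoppingTime_iInf (h𝓕 : 𝓕.IsRightContinuous) {S : ℕ → Ω → WithTop (Time T)}
    (hS : ∀ n, IsStoppingTime 𝓕 (S n)) : IsStoppingTime 𝓕 fun ω ↦ ⨅ n, S n ω := by
  have hlt : ∀ t : Time T, MeasurableSet[𝓕 t] {ω | ⨅ n, S n ω < t} := fun t ↦ by
    simp only [iInf_lt_iff_exists_lt, ofPred_exists]
    exact .iUnion fun n ↦ (hS n).measurableSet_lt t
  refine isStoppingTime_of_measurableSet_lt_of_isRightContinuous' hlt fun t ht ↦ ?_
  have htop : t = ⊤ := by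
    by_contra h
    exact (nhdsGT_neBot_of_exists_gt ⟨⊤, lt_top_iff_ne_top.2 h⟩).ne ht
  subst htop
  have heq : {ω | ⨅ n, S n ω = (⊤ : Time T)} =
      (⋃ n, {ω | S n ω ≤ (⊤ : Time T)}) \ {ω | ⨅ n, S n ω < (⊤ : Time T)} := by
    ext ω
    simp only [mem_ofPred_eq, Set.mem_sdiff, mem_iUnion, ← lt_top_iff_le_coe_top,
      ← iInf_lt_iff_exists_lt]
    rw [lt_top_iff_le_coe_top, not_lt, le_antisymm_iff]
  rw [heq]
  exact (MeasurableSet.iUnion fun n ↦ hS n ⊤).diff (hlt ⊤)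

lemma IsKnownAhead.isStoppingTime_map_shiftBack {δ : ℝ≥0} {d : Ω → WithTop (Time T)}
    (hd : IsKnownAhead 𝓕 δ d) : IsStoppingTime 𝓕 fun ω ↦ (d ω).map (shiftBack · δ) := by
  intro t
  obtain ⟨S, hS⟩ := exists_finset_forall_eq_coe hd.finite_range
  have heq : {ω | (d ω).map (shiftBack · δ) ≤ t} =
      ⋃ f ∈ S.filter (shiftBack · δ ≤ t), {ω | d ω = f} := by
    ext ω
    simp only [mem_ofPred_eq, mem_iUnion, Finset.mem_filter, exists_prop]
    cases h : d ω with
    | top => simp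
    | coe e => simpa [WithTop.coe_le_coe] using fun _ ↦ hS ω e h
  rw [heq]
  refine Finset.measurableSet_biUnion _ fun f hf ↦ ?_
  exact 𝓕.mono (Finset.mem_filter.1 hf).2 _ (hd.measurableSet_eq f)

lemma IsAnnouncing.exists_measure_ne_top_diff_le {δ : ℕ → ℝ≥0} {d : ℕ → Ω → WithTop (Time T)}
    (hd : IsAnnouncing 𝓕 δ d) (P : Measure Ω) [IsFiniteMeasure P] {ε : ℝ≥0∞} (hε : ε ≠ 0) :
    ∃ n, P ({ω | d n ω ≠ ⊤} \ {ω | ∀ n, d n ω ≠ ⊤}) ≤ ε := by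
  have hm : ∀ n, MeasurableSet {ω | d n ω ≠ ⊤} := fun n ↦
    measurableSet_ne_top (hd.knownAhead n).finite_range (hd.measurableSet_eq n)
  have hanti : Antitone fun n ↦ {ω | d n ω ≠ ⊤} \ {ω | ∀ n, d n ω ≠ ⊤} := fun i j hij ↦
    sdiff_subset_sdiff_left fun ω hω ↦ ne_top_of_le_ne_top hω (hd.monotone hij ω)
  have hempty : ⋂ n, {ω | d n ω ≠ ⊤} \ {ω | ∀ n, d n ω ≠ ⊤} = ∅ :=
    eq_empty_of_forall_notMem fun ω hω ↦
      (mem_iInter.1 hω 0).2 fun n ↦ (mem_iInter.1 hω n).1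
  have hlim := tendsto_measure_iInter_atTop (μ := P)
    (fun n ↦ ((hm n).diff hd.measurableSet_forall_ne_top).nullMeasurableSet) hanti
    ⟨0, measure_ne_top _ _⟩
  rw [hempty, measure_empty] at hlim
  exact ((hlim.eventually_lt_const (pos_iff_ne_zero.2 hε)).exists).imp fun n hn ↦ hn.le

variable {P : Measure Ω} [IsFiniteMeasure P]

lemma exists_isStoppingTime_lt_of_measurableSet_graph {Ω₀ : Set Ω} {r : Ω → Time T}
    (hr : Measurable r)
    (hG : MeasurableSet[𝓕.predictable] {p : Time T × Ω | p.2 ∈ Ω₀ ∧ p.1 = r p.2})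
    (hpos : ∀ ω ∈ Ω₀, ⊥ < r ω) {ε : ℝ≥0∞} (hε : ε ≠ 0) :
    ∃ S, IsStoppingTime 𝓕 S ∧ P (Ω₀ \ {ω | S ω < r ω}) ≤ ε ∧ P ({ω | S ω < ⊤} \ Ω₀) ≤ ε := by
  obtain ⟨δ, d, hd, hle, hlim⟩ := exists_isAnnouncing_of_measurableSet_graph (P := P) hr hG hε
  obtain ⟨n, hn⟩ := hd.exists_measure_ne_top_diff_le P hε
  refine ⟨_, (hd.knownAhead n).isStoppingTime_map_shiftBack,
    (measure_mono (sdiff_subset_sdiff_right fun ω hω ↦ ?_)).trans hle,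
    (measure_mono ?_).trans hn⟩
  · obtain ⟨hω₀, e, he, het⟩ := hlim ω hω
    have hemono : Monotone e := fun i j hij ↦ by
      simpa only [he, WithTop.coe_le_coe] using hd.monotone hij ω
    have hlt : shiftBack (e n) (δ n) < r ω := by
      rcases (hemono.ge_of_tendsto het n).eq_or_lt with h | h
      · exact h.symm ▸ shiftBack_lt (hpos ω hω₀) (hd.pos n)
      · exact (shiftBack_le _ _).trans_lt h
    simpa [he] using hlt
  · rintro ω ⟨hfin, hω₀⟩
    refine ⟨fun h ↦ ?_, fun h ↦ hω₀ (hlim ω h).1⟩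
    simp [h] at hfin

lemma exists_measure_le_apply_le {f : Ω → ℝ} (hf : Measurable f) {ε : ℝ≥0∞} (hε : ε ≠ 0) :
    ∃ c : ℝ, 0 < c ∧ P {ω | c ≤ f ω} ≤ ε := by
  have hanti : Antitone fun n : ℕ ↦ {ω | (n : ℝ) + 1 ≤ f ω} := fun i j hij ω hω ↦ by
    have hij' : (i : ℝ) ≤ j := Nat.cast_le.2 hij
    exact (add_le_add_left hij' 1).trans hω
  have hempty : ⋂ n : ℕ, {ω | (n : ℝ) + 1 ≤ f ω} = ∅ := eq_empty_of_forall_notMem fun ω hω ↦ by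
    obtain ⟨n, hn⟩ := exists_nat_gt (f ω)
    exact ((lt_add_one (n : ℝ)).trans_le (mem_iInter.1 hω n)).not_gt hn
  have hlim := tendsto_measure_iInter_atTop (μ := P)
    (fun n ↦ (measurableSet_le measurable_const hf).nullMeasurableSet) hanti
    ⟨0, measure_ne_top _ _⟩
  rw [hempty, measure_empty] at hlim
  obtain ⟨n, hn⟩ := (hlim.eventually_lt_const (pos_iff_ne_zero.2 hε)).exists
  exact ⟨n + 1, by positivity, hn.le⟩

lemma exists_isStoppingTime_ae_lt_of_measurableSet_graph (h𝓕 : 𝓕.IsRightContinuous) {Ω₀ : Set Ω}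
    {r : Ω → Time T} (hr : Measurable r)
    (hG : MeasurableSet[𝓕.predictable] {p : Time T × Ω | p.2 ∈ Ω₀ ∧ p.1 = r p.2})
    (hpos : ∀ ω ∈ Ω₀, ⊥ < r ω) {ε : ℝ≥0∞} (hε : ε ≠ 0) :
    ∃ σ, IsStoppingTime 𝓕 σ ∧ (∀ᵐ ω ∂P, ω ∈ Ω₀ → σ ω < r ω) ∧ P ({ω | σ ω < ⊤} \ Ω₀) ≤ ε := by
  obtain ⟨ε', hε', hsum⟩ := ENNReal.exists_pos_sum_of_countable' hε ℕ
  choose S hS hSlt hStop using fun n ↦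
    exists_isStoppingTime_lt_of_measurableSet_graph (P := P) hr hG hpos (hε' n).ne'
  have hε0 : Tendsto ε' atTop (𝓝 0) :=
    ENNReal.tendsto_atTop_zero_of_tsum_ne_top (hsum.trans_le le_top).ne
  refine ⟨fun ω ↦ ⨅ n, S n ω, isStoppingTime_iInf h𝓕 hS, ?_, ?_⟩
  · have hnull : P (Ω₀ \ {ω | ⨅ n, S n ω < r ω}) = 0 :=
      le_antisymm (ge_of_tendsto' hε0 fun n ↦ (measure_mono (sdiff_subset_sdiff_right
        fun ω hω ↦ iInf_lt_iff_exists_lt.2 ⟨n, hω⟩)).trans (hSlt n)) zero_le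
    filter_upwards [measure_eq_zero_iff_ae_notMem.1 hnull] with ω hω h
    exact not_not.1 fun h' ↦ hω ⟨h, h'⟩
  · calc P ({ω | ⨅ n, S n ω < ⊤} \ Ω₀)
        = P (⋃ n, {ω | S n ω < ⊤} \ Ω₀) := by
          simp only [iInf_lt_iff_exists_lt, ofPred_exists, iUnion_sdiff]
      _ ≤ ∑' n, P ({ω | S n ω < ⊤} \ Ω₀) := measure_iUnion_le _
      _ ≤ ∑' n, ε' n := ENNReal.tsum_le_tsum hStop
      _ ≤ ε := hsum.le

theorem IsIncreasing.exists_bounded (h𝓕 : 𝓕.IsRightContinuous) {Γ : Time T → Ω → ℝ}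
    (hΓ : IsIncreasing 𝓕 Γ) {ε : ℝ≥0∞} (hε : ε ≠ 0) :
    ∃ S, IsStoppingTime 𝓕 S ∧ P {ω | S ω < ⊤} ≤ ε ∧
      ∃ k : ℝ, ∀ᵐ ω ∂P, ∀ t, Γ (stopAt S t ω) ω ≤ k := by
  have hε2 : ε / 2 ≠ 0 := (ENNReal.half_pos hε).ne'
  obtain ⟨c, hc, hΓc⟩ := exists_measure_le_apply_le (P := P) (hΓ.measurable ⊤) hε2
  -- Stop strictly before `Γ` reaches the level `c`, so that its jump there is not seen.
  obtain ⟨σ, hσ, hσlt, hσtop⟩ := exists_isStoppingTime_ae_lt_of_measurableSet_graph (P := P) h𝓕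
    (hΓ.measurable_debut.comp measurable_prodMk_left) (hΓ.measurableSet_graph_debut c)
    (fun ω hω ↦ bot_lt_debut (hΓ.rightCont ω) (hΓ.mono ω) ((hΓ.zero ω).trans_lt hc) hω) hε2
  refine ⟨σ, hσ, ?_, c, ?_⟩
  · calc P {ω | σ ω < ⊤}
        ≤ P ({ω | c ≤ Γ ⊤ ω} ∪ {ω | σ ω < ⊤} \ {ω | c ≤ Γ ⊤ ω}) :=
          measure_mono (subset_union_right.trans_eq union_sdiff_self.symm)
      _ ≤ ε / 2 + ε / 2 := (measure_union_le _ _).trans (add_le_add hΓc hσtop)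
      _ = ε := ENNReal.add_halves ε
  · filter_upwards [hσlt] with ω hω t
    by_cases h : c ≤ Γ ⊤ ω
    · have hlt : stopAt σ t ω < debut (fun t ↦ Γ t ω) c :=
        WithTop.coe_lt_coe.1 ((coe_stopAt_le σ t ω).trans_lt (hω h))
      by_contra! hgt
      exact hlt.not_ge ((debut_le_iff (hΓ.rightCont ω) (hΓ.mono ω)).2 (.inl hgt.le))
    · exact (hΓ.mono ω le_top).trans (not_le.1 h).le

end

/-! ### Integrability of the drift -/

section

variable {𝓕 : Filtration (Time T) m} {τ : Ω → WithTop (Time T)}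

lemma measurableSet_predictable_le (hτ : IsStoppingTime 𝓕 τ) :
    MeasurableSet[𝓕.predictable] {p : Time T × Ω | p.1 ≤ τ p.2} := by
  obtain ⟨D, hDc, hD⟩ := TopologicalSpace.exists_countable_dense (Time T)
  have heq : {p : Time T × Ω | p.1 ≤ τ p.2} = (⋃ q ∈ D, Ioi q ×ˢ {ω | τ ω ≤ q})ᶜ := by
    ext ⟨t, ω⟩
    simp only [mem_ofPred_eq, mem_compl_iff, mem_iUnion, mem_prod, mem_Ioi, exists_prop, not_exists,
      not_and, not_le]
    refine ⟨fun h q _ hq ↦ (WithTop.coe_lt_coe.2 hq).trans_le h, fun h ↦ ?_⟩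
    by_contra! hlt
    obtain ⟨u, hu⟩ := WithTop.ne_top_iff_exists.1 hlt.ne_top
    rw [← hu, WithTop.coe_lt_coe] at hlt
    obtain ⟨q, hqD, huq, hqt⟩ := hD.exists_between hlt
    exact (h q hqD hqt).not_ge (hu ▸ WithTop.coe_le_coe.2 huq.le)
  rw [heq]
  exact (MeasurableSet.biUnion hDc fun q _ ↦ measurableSet_predictable_Ioi_prod (hτ q)).compl

lemma le_stopAt_iff {u t : Time T} {ω : Ω} : u ≤ stopAt τ t ω ↔ u ≤ t ∧ u ≤ τ ω := by
  rw [← WithTop.coe_le_coe, coe_stopAt, le_min_iff, WithTop.coe_le_coe]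

lemma measurable_stopAt (hτ : IsStoppingTime 𝓕 τ) (t : Time T) : Measurable (stopAt τ t) :=
  (measurable_of_isStoppingTime_of_le (isStoppingTime_stopAt hτ t) fun ω ↦ stopAt_le τ t ω).mono
    (𝓕.le t) le_rfl

end

namespace IsIncreasing

variable {𝓕 : Filtration (Time T) m} {C : Time T → Ω → ℝ} {r r' : Ω → Time T}

lemma measurable_setLIntegral_Ioc (hC : IsIncreasing 𝓕 C) {G : Time T × Ω → ℝ≥0∞}
    (hG : Measurable G) (hr : Measurable r) (hr' : Measurable r') :
    Measurable fun ω ↦ ∫⁻ u in Ioc (r ω) (r' ω), G (u, ω) ∂(stieltjes fun t ↦ C t ω) := by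
  simp only [← lintegral_indicator measurableSet_Ioc]
  exact hC.measurable_lintegral (hG.indicator
    ((measurableSet_lt (hr.comp measurable_snd) measurable_fst).inter
      (measurableSet_le measurable_fst (hr'.comp measurable_snd))))

lemma stronglyMeasurable_integral (hC : IsIncreasing 𝓕 C) {G : Time T × Ω → ℝ}
    (hG : Measurable G) :
    StronglyMeasurable fun ω ↦ ∫ s, G (s, ω) ∂(stieltjes fun t ↦ C t ω) := by
  have hjoint : Measurable fun p : Ω × ℝ ↦ (Ioc 0 (C ⊤ p.1)).indicator
      (fun c ↦ G (debut (fun t ↦ C t p.1) c, p.1)) p.2 := by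
    have h : Measurable fun p : Ω × ℝ ↦ G (debut (fun t ↦ C t p.1) p.2, p.1) :=
      hG.comp ((hC.measurable_debut.comp measurable_swap).prodMk measurable_fst)
    exact h.indicator ((measurableSet_lt measurable_const measurable_snd).inter
      (measurableSet_le measurable_snd ((hC.measurable ⊤).comp measurable_fst)))
  convert hjoint.stronglyMeasurable.integral_prod_right' (ν := volume) using 1
  ext ω
  have hm : Measurable (debut fun t ↦ C t ω) := hC.measurable_debut.comp measurable_prodMk_right
  have hG' : Measurable fun s ↦ G (s, ω) := hG.comp measurable_prodMk_right
  change _ = ∫ c, (Ioc 0 (C ⊤ ω)).indicator (fun c ↦ G (debut (fun t ↦ C t ω) c, ω)) c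
  rw [integral_indicator measurableSet_Ioc, ← hC.zero ω,
    ← integral_map (f := fun s ↦ G (s, ω)) hm.aemeasurable hG'.aestronglyMeasurable,
    map_debut (hC.rightCont ω) (hC.mono ω)]

lemma stronglyMeasurable_setIntegral_Ioc (hC : IsIncreasing 𝓕 C) {G : Time T × Ω → ℝ}
    (hG : Measurable G) (hr : Measurable r) (hr' : Measurable r') :
    StronglyMeasurable fun ω ↦
      ∫ u in Ioc (r ω) (r' ω), G (u, ω) ∂(stieltjes fun t ↦ C t ω) := by
  simp only [← integral_indicator measurableSet_Ioc]
  exact hC.stronglyMeasurable_integral (hG.indicator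
    ((measurableSet_lt (hr.comp measurable_snd) measurable_fst).inter
      (measurableSet_le measurable_fst (hr'.comp measurable_snd))))

end IsIncreasing

section ToReal

variable {P : Measure Ω}

lemma integral_eq_toReal_sub_toReal {U V : Ω → ℝ≥0∞} (hU : Measurable U) (hV : Measurable V)
    (hUfin : ∫⁻ ω, U ω ∂P ≠ ∞) (hVfin : ∫⁻ ω, V ω ∂P ≠ ∞) {g : Ω → ℝ}
    (hg : ∀ᵐ ω ∂P, g ω = (U ω).toReal - (V ω).toReal) :
    ∫ ω, g ω ∂P = (∫⁻ ω, U ω ∂P).toReal - (∫⁻ ω, V ω ∂P).toReal := by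
  rw [integral_congr_ae hg, integral_sub
      (integrable_toReal_of_lintegral_ne_top hU.aemeasurable hUfin)
      (integrable_toReal_of_lintegral_ne_top hV.aemeasurable hVfin),
    integral_toReal hU.aemeasurable (ae_lt_top hU hUfin),
    integral_toReal hV.aemeasurable (ae_lt_top hV hVfin)]

lemma integral_integral_eq_toReal_sub {A : Type*} [MeasurableSpace A] {μ : Ω → Measure A}
    {f : Ω → A → ℝ} (hf : ∀ ω, Measurable (f ω))
    (hμ : ∀ g : ℝ → ℝ≥0∞, Measurable g → Measurable fun ω ↦ ∫⁻ a, g (f ω a) ∂(μ ω))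
    (hfin : ∫⁻ ω, ∫⁻ a, ‖f ω a‖ₑ ∂(μ ω) ∂P ≠ ∞) :
    ∫ ω, ∫ a, f ω a ∂(μ ω) ∂P = (∫⁻ ω, ∫⁻ a, ENNReal.ofReal (f ω a) ∂(μ ω) ∂P).toReal
      - (∫⁻ ω, ∫⁻ a, ENNReal.ofReal (-f ω a) ∂(μ ω) ∂P).toReal := by
  refine integral_eq_toReal_sub_toReal (hμ _ ENNReal.measurable_ofReal)
    (hμ _ measurable_neg.ennreal_ofReal) ?_ ?_ ?_
  · exact ne_top_of_le_ne_top hfin (lintegral_mono fun ω ↦ lintegral_mono fun a ↦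
      Real.ofReal_le_enorm _)
  · exact ne_top_of_le_ne_top hfin (lintegral_mono fun ω ↦ lintegral_mono fun a ↦
      (Real.ofReal_le_enorm _).trans_eq (enorm_neg _))
  · filter_upwards [ae_lt_top (hμ _ measurable_enorm) hfin] with ω hω
    exact integral_eq_lintegral_pos_part_sub_lintegral_neg_part
      ⟨(hf ω).aestronglyMeasurable, hω⟩

end ToReal

section Indicator

variable {A B : Type*}

lemma indicator_prod_apply {M : Type*} [Zero M] (s : Set A) (t : Set B) (f : A × B → M) (a : A)
    (b : B) : (s ×ˢ t).indicator f (a, b)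
      = s.indicator (fun a ↦ t.indicator (fun b ↦ f (a, b)) b) a := by
  by_cases ha : a ∈ s <;> by_cases hb : b ∈ t <;> simp [ha, hb]

variable [MeasurableSpace A] [MeasurableSpace B]

lemma lintegral_lintegral_indicator_prod (μ : Measure A) (κ : A → Measure B) {s : Set A}
    (hs : MeasurableSet s) {t : Set B} (ht : MeasurableSet t) (f : A × B → ℝ≥0∞) :
    ∫⁻ a, ∫⁻ b, (s ×ˢ t).indicator f (a, b) ∂(κ a) ∂μ
      = ∫⁻ a in s, ∫⁻ b in t, f (a, b) ∂(κ a) ∂μ := by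
  rw [← lintegral_indicator hs]
  refine lintegral_congr fun a ↦ ?_
  by_cases ha : a ∈ s
  · simp only [indicator_prod_apply, indicator_of_mem ha, lintegral_indicator ht]
  · simp [ha]

lemma integral_integral_indicator_prod (μ : Measure A) (κ : A → Measure B) {s : Set A}
    (hs : MeasurableSet s) {t : Set B} (ht : MeasurableSet t) (f : A × B → ℝ) :
    ∫ a, ∫ b, (s ×ˢ t).indicator f (a, b) ∂(κ a) ∂μ
      = ∫ a in s, ∫ b in t, f (a, b) ∂(κ a) ∂μ := by
  rw [← integral_indicator hs]
  refine integral_congr_ae (ae_of_all _ fun a ↦ ?_)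
  by_cases ha : a ∈ s
  · simp only [indicator_prod_apply, indicator_of_mem ha, integral_indicator ht]
  · simp [ha]

lemma lintegral_lintegral_indicator_comp {P : Measure Ω} (μ : Ω → Measure A) {E : Set (A × Ω)}
    (hE : MeasurableSet E) {L : Ω → B} (hL : Measurable L) {t : Set B} (ht : MeasurableSet t)
    (f : (A × Ω) × B → ℝ≥0∞) :
    ∫⁻ ω, ∫⁻ a, (E ×ˢ t).indicator f ((a, ω), L ω) ∂(μ ω) ∂P
      = ∫⁻ ω in L ⁻¹' t, ∫⁻ a in (·, ω) ⁻¹' E, f ((a, ω), L ω) ∂(μ ω) ∂P := by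
  rw [← lintegral_indicator (hL ht)]
  refine lintegral_congr fun ω ↦ ?_
  by_cases hω : L ω ∈ t
  · simp only [indicator_of_mem (mem_preimage.2 hω),
      ← lintegral_indicator (measurable_prodMk_right hE)]
    refine lintegral_congr fun a ↦ ?_
    by_cases ha : (a, ω) ∈ E <;> simp [ha, hω]
  · simp [hω]

lemma integral_integral_indicator_comp {P : Measure Ω} (μ : Ω → Measure A) {E : Set (A × Ω)}
    (hE : MeasurableSet E) {L : Ω → B} (hL : Measurable L) {t : Set B} (ht : MeasurableSet t)
    (f : (A × Ω) × B → ℝ) :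
    ∫ ω, ∫ a, (E ×ˢ t).indicator f ((a, ω), L ω) ∂(μ ω) ∂P
      = ∫ ω in L ⁻¹' t, ∫ a in (·, ω) ⁻¹' E, f ((a, ω), L ω) ∂(μ ω) ∂P := by
  rw [← integral_indicator (hL ht)]
  refine integral_congr_ae (ae_of_all _ fun ω ↦ ?_)
  by_cases hω : L ω ∈ t
  · simp only [indicator_of_mem (mem_preimage.2 hω),
      ← integral_indicator (measurable_prodMk_right hE)]
    refine integral_congr_ae (ae_of_all _ fun a ↦ ?_)
    by_cases ha : (a, ω) ∈ E <;> simp [ha, hω]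
  · simp [hω]

end Indicator

lemma measurableSet_prod_borel {𝓕 : Filtration (Time T) m} {E : Set (Time T × Ω)}
    (hE : MeasurableSet[𝓕.predictable] E) {B : Set ℝ} (hB : MeasurableSet B) :
    MeasurableSet[𝓕.predictable.prod (borel ℝ)] (E ×ˢ B) :=
  @MeasurableSet.prod _ _ 𝓕.predictable (borel ℝ) _ _ hE
    (BorelSpace.measurable_eq (α := ℝ) ▸ hB)

namespace IsCadlagLaw

variable {𝓕 : Filtration (Time T) m} {P : Measure Ω} {L : Ω → ℝ}
  {Q : Time T → Ω → ProbabilityMeasure ℝ} {C : Time T → Ω → ℝ}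

lemma measurable_setLIntegral_leftLaw (hQ : IsCadlagLaw 𝓕 P L Q) {H : (Time T × Ω) × ℝ → ℝ≥0∞}
    (hH : Measurable[𝓕.predictable.prod (borel ℝ)] H) {B : Set ℝ} (hB : MeasurableSet B) :
    Measurable[𝓕.predictable] fun p : Time T × Ω ↦ ∫⁻ x in B, H (p, x) ∂(leftLaw Q p.1 p.2) :=
  Measurable.lintegral_kernel_prod_right' (κ := hQ.leftKernel.restrict hB) hH

variable [IsFiniteMeasure P]

lemma setLIntegral_setLIntegral_leftLaw (hL : Measurable L) (hQ : IsCadlagLaw 𝓕 P L Q)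
    (hC : IsIncreasing 𝓕 C) {H : (Time T × Ω) × ℝ → ℝ≥0∞}
    (hH : Measurable[𝓕.predictable.prod (borel ℝ)] H) {E : Set (Time T × Ω)}
    (hE : MeasurableSet[𝓕.predictable] E) {B : Set ℝ} (hB : MeasurableSet B) :
    ∫⁻ ω, ∫⁻ s in (·, ω) ⁻¹' E, ∫⁻ x in B, H ((s, ω), x) ∂(leftLaw Q s ω)
        ∂(stieltjes fun t ↦ C t ω) ∂P
      = ∫⁻ ω in L ⁻¹' B, ∫⁻ s in (·, ω) ⁻¹' E, H ((s, ω), L ω)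
        ∂(stieltjes fun t ↦ C t ω) ∂P := by
  have hE' := predictable_le 𝓕 _ hE
  rw [← lintegral_lintegral_indicator_comp _ hE' hL hB,
    ← hQ.lintegral_lintegral_leftLaw hL hC (hH.indicator (measurableSet_prod_borel hE hB))]
  exact lintegral_congr fun ω ↦ (lintegral_lintegral_indicator_prod _ _
    (measurable_prodMk_right hE') hB fun q ↦ H ((q.1, ω), q.2)).symm

theorem integral_integral_leftLaw (hL : Measurable L) (hQ : IsCadlagLaw 𝓕 P L Q)
    (hC : IsIncreasing 𝓕 C) {h : (Time T × Ω) × ℝ → ℝ}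
    (hh : Measurable[𝓕.predictable.prod (borel ℝ)] h)
    (hfin : ∫⁻ ω, ∫⁻ s, ‖h ((s, ω), L ω)‖ₑ ∂(stieltjes fun t ↦ C t ω) ∂P ≠ ∞) :
    ∫ ω, ∫ s, ∫ x, h ((s, ω), x) ∂(leftLaw Q s ω) ∂(stieltjes fun t ↦ C t ω) ∂P
      = ∫ ω, ∫ s, h ((s, ω), L ω) ∂(stieltjes fun t ↦ C t ω) ∂P := by
  have hh' := measurable_prod_of_predictable hh
  have hinner : ∀ g : ℝ → ℝ≥0∞, Measurable g →
      Measurable fun p : Time T × Ω ↦ ∫⁻ x, g (h (p, x)) ∂(leftLaw Q p.1 p.2) := fun g hg ↦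
    (hQ.measurable_lintegral_leftLaw (hg.comp hh)).mono (predictable_le 𝓕) le_rfl
  have hbound : ∀ g : ℝ → ℝ≥0∞, Measurable g → (∀ y, g y ≤ ‖y‖ₑ) →
      ∫⁻ ω, ∫⁻ s, ∫⁻ x, g (h ((s, ω), x)) ∂(leftLaw Q s ω) ∂(stieltjes fun t ↦ C t ω) ∂P ≠ ∞ :=
    fun g hg hle ↦ ((hQ.lintegral_lintegral_leftLaw hL hC (hg.comp hh)).trans_le
      (lintegral_mono fun ω ↦ lintegral_mono fun s ↦ hle _)).trans_lt hfin.lt_top |>.ne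
  have hneg : ∀ y : ℝ, ENNReal.ofReal (-y) ≤ ‖y‖ₑ := fun y ↦
    (Real.ofReal_le_enorm _).trans_eq (enorm_neg _)
  have hL_eq := integral_integral_eq_toReal_sub (P := P)
    (μ := fun ω ↦ stieltjes fun t ↦ C t ω) (f := fun ω s ↦ h ((s, ω), L ω))
    (fun ω ↦ hh'.comp ((measurable_id.prodMk measurable_const).prodMk measurable_const))
    (fun g hg ↦ hC.measurable_lintegral (G := fun p ↦ g (h (p, L p.2)))
      (hg.comp (hh'.comp (measurable_id.prodMk (hL.comp measurable_snd))))) hfin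
  have hQ_eq := integral_eq_toReal_sub_toReal (P := P)
    (g := fun ω ↦ ∫ s, ∫ x, h ((s, ω), x) ∂(leftLaw Q s ω) ∂(stieltjes fun t ↦ C t ω))
    (hC.measurable_lintegral (hinner _ ENNReal.measurable_ofReal))
    (hC.measurable_lintegral (hinner _ measurable_neg.ennreal_ofReal))
    (hbound _ ENNReal.measurable_ofReal Real.ofReal_le_enorm)
    (hbound _ measurable_neg.ennreal_ofReal hneg) <| by
      filter_upwards [ae_lt_top (hC.measurable_lintegral (hinner _ measurable_enorm))
        (hbound _ measurable_enorm fun _ ↦ le_rfl)] with ω hω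
      exact (integral_integral_eq_toReal_sub (μ := fun s ↦ leftLaw Q s ω)
        (f := fun s x ↦ h ((s, ω), x)) (fun s ↦ hh'.comp measurable_prodMk_left)
        (fun g hg ↦ (hinner g hg).comp measurable_prodMk_right) hω.ne)
  rw [hQ_eq, hL_eq]
  exact congrArg₂ (fun x y ↦ x.toReal - y.toReal)
    (hQ.lintegral_lintegral_leftLaw hL hC hh.ennreal_ofReal)
    (hQ.lintegral_lintegral_leftLaw hL hC (measurable_neg.ennreal_ofReal.comp hh))

theorem setIntegral_setIntegral_leftLaw (hL : Measurable L) (hQ : IsCadlagLaw 𝓕 P L Q)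
    (hC : IsIncreasing 𝓕 C) {h : (Time T × Ω) × ℝ → ℝ}
    (hh : Measurable[𝓕.predictable.prod (borel ℝ)] h) {E : Set (Time T × Ω)}
    (hE : MeasurableSet[𝓕.predictable] E) {B : Set ℝ} (hB : MeasurableSet B)
    (hfin : ∫⁻ ω in L ⁻¹' B, ∫⁻ s in (·, ω) ⁻¹' E, ‖h ((s, ω), L ω)‖ₑ
      ∂(stieltjes fun t ↦ C t ω) ∂P ≠ ∞) :
    ∫ ω, ∫ s in (·, ω) ⁻¹' E, ∫ x in B, h ((s, ω), x) ∂(leftLaw Q s ω)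
        ∂(stieltjes fun t ↦ C t ω) ∂P
      = ∫ ω in L ⁻¹' B, ∫ s in (·, ω) ⁻¹' E, h ((s, ω), L ω)
        ∂(stieltjes fun t ↦ C t ω) ∂P := by
  have hE' := predictable_le 𝓕 _ hE
  rw [← integral_integral_indicator_comp _ hE' hL hB,
    ← hQ.integral_integral_leftLaw hL hC (hh.indicator (measurableSet_prod_borel hE hB))]
  · exact integral_congr_ae (ae_of_all _ fun ω ↦ (integral_integral_indicator_prod _ _
      (measurable_prodMk_right hE') hB fun q ↦ h ((q.1, ω), q.2)).symm)
  · simp only [enorm_indicator_eq_indicator_enorm]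
    rwa [lintegral_lintegral_indicator_comp _ hE' hL hB fun q ↦ ‖h q‖ₑ]

end IsCadlagLaw

section

variable {𝓕 : Filtration (Time T) m} {τ : Ω → WithTop (Time T)} {s t : Time T} {B : Set Ω}

lemma measurableSet_predictable_Ioc_stopAt (hτ : IsStoppingTime 𝓕 τ) (t : Time T)
    (hB : MeasurableSet[𝓕 s] B) : MeasurableSet[𝓕.predictable]
      {p : Time T × Ω | p.2 ∈ B ∧ p.1 ∈ Ioc (stopAt τ s p.2) (stopAt τ t p.2)} := by
  convert! (measurableSet_predictable_prod (t := s) (measurableSet_Ioc (b := t))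
    Ioc_subset_Ioi_self hB).inter (measurableSet_predictable_le hτ) using 1
  ext ⟨u, ω⟩
  have hu : u ≤ τ ω → (stopAt τ s ω < u ↔ s < u) := fun h ↦ by
    simp only [← not_le, le_stopAt_iff, h, and_true]
  simp only [mem_ofPred_eq, mem_inter_iff, mem_prod, mem_Ioc, le_stopAt_iff]
  tauto

end

section

variable {𝓕 : Filtration (Time T) m} {P : Measure Ω} [IsFiniteMeasure P] {L : Ω → ℝ}
  {Q : Time T → Ω → ProbabilityMeasure ℝ} {C : Time T → Ω → ℝ} {α : Time T → ℝ → Ω → ℝ} {a : ℝ}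

lemma exists_isStoppingTime_setLIntegral_lt_top (h𝓕 : UsualConditions 𝓕 P) (hL : Measurable L)
    (hQ : IsCadlagLaw 𝓕 P L Q) (hC : IsIncreasing 𝓕 C)
    (hα : Measurable[𝓕.predictable.prod (borel ℝ)] fun p : (Time T × Ω) × ℝ ↦ α p.1.1 p.2 p.1.2)
    (hint : ∀ᵐ ω ∂P, ∫⁻ s, ∫⁻ x in Ioi a, ‖α s x ω‖ₑ ∂(leftLaw Q s ω)
      ∂(stieltjes fun u ↦ C u ω) < ∞) {ε : ℝ≥0∞} (hε : ε ≠ 0) :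
    ∃ S, IsStoppingTime 𝓕 S ∧ P {ω | S ω < ⊤} ≤ ε ∧
      ∫⁻ ω in {ω | a < L ω}, ∫⁻ s in Ioc ⊥ (stopAt S ⊤ ω), ‖α s (L ω) ω‖ₑ
        ∂(stieltjes fun u ↦ C u ω) ∂P < ∞ := by
  obtain ⟨Γ, hΓ, hΓint⟩ := hC.exists_isIncreasing_setLIntegral h𝓕
    (hQ.measurable_setLIntegral_leftLaw (measurable_enorm.comp hα) measurableSet_Ioi) hint
  obtain ⟨S, hS, hSP, k, hk⟩ := hΓ.exists_bounded (P := P) h𝓕.rightCont hε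
  refine ⟨S, hS, hSP, ?_⟩
  have hbot : ∀ ω, stopAt S ⊥ ω = ⊥ := fun ω ↦ le_bot_iff.1 (stopAt_le S ⊥ ω)
  have hswap := hQ.setLIntegral_setLIntegral_leftLaw hL hC (measurable_enorm.comp hα)
    (measurableSet_predictable_Ioc_stopAt hS ⊤ (@MeasurableSet.univ _ (𝓕 ⊥)))
    (measurableSet_Ioi (a := a))
  simp only [preimage_ofPred_eq, mem_univ, true_and, hbot, ofPred_mem_eq] at hswap
  calc _ = ∫⁻ ω, ∫⁻ s in Ioc ⊥ (stopAt S ⊤ ω), ∫⁻ x in Ioi a, ‖α s x ω‖ₑ ∂(leftLaw Q s ω)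
          ∂(stieltjes fun u ↦ C u ω) ∂P := hswap.symm
    _ ≤ ∫⁻ _, ENNReal.ofReal k ∂P := by
        refine lintegral_mono_ae ?_
        filter_upwards [hk, hΓint] with ω hbound hω
        exact (hω _).symm.trans_le (ENNReal.ofReal_le_ofReal (hbound ⊤))
    _ < ∞ := by
        rw [lintegral_const]
        exact ENNReal.mul_lt_top ENNReal.ofReal_lt_top (measure_lt_top P _)

lemma ae_lintegral_lt_top_of_lt (h𝓕 : UsualConditions 𝓕 P) (hL : Measurable L)
    (hQ : IsCadlagLaw 𝓕 P L Q) (hC : IsIncreasing 𝓕 C)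
    (hα : Measurable[𝓕.predictable.prod (borel ℝ)] fun p : (Time T × Ω) × ℝ ↦ α p.1.1 p.2 p.1.2)
    (hint : ∀ᵐ ω ∂P, ∫⁻ s, ∫⁻ x in Ioi a, ‖α s x ω‖ₑ ∂(leftLaw Q s ω)
      ∂(stieltjes fun u ↦ C u ω) < ∞) :
    ∀ᵐ ω ∂P, a < L ω → ∫⁻ s, ‖α s (L ω) ω‖ₑ ∂(stieltjes fun u ↦ C u ω) < ∞ := by
  rw [ae_iff]
  refine le_antisymm (le_of_forall_pos_le_add fun ε hε ↦ ?_) zero_le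
  obtain ⟨S, hS, hSP, hfin⟩ :=
    exists_isStoppingTime_setLIntegral_lt_top h𝓕 hL hQ hC hα hint hε.ne'
  have hαL : Measurable fun p : Time T × Ω ↦ ‖α p.1 (L p.2) p.2‖ₑ :=
    (measurable_comp_of_predictable hα hL).enorm
  have hlt := ae_lt_top
    (hC.measurable_setLIntegral_Ioc hαL measurable_const (measurable_stopAt hS ⊤)) hfin.ne
  rw [ae_restrict_iff' (measurableSet_lt measurable_const hL)] at hlt
  rw [zero_add]
  refine (measure_mono_ae ?_).trans hSP
  filter_upwards [hlt] with ω hω hbad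
  by_contra hS_top
  refine hbad fun hLa ↦ ?_
  have hfinω := hω hLa
  rwa [stopAt_of_le ((not_lt_top_iff.1 hS_top).symm ▸ le_top), restrict_stieltjes_Ioc_bot_top]
    at hfinω

theorem ae_integrable_drift (h𝓕 : UsualConditions 𝓕 P) (hL : Measurable L)
    (hQ : IsCadlagLaw 𝓕 P L Q) (hC : IsIncreasing 𝓕 C)
    (hα : Measurable[𝓕.predictable.prod (borel ℝ)] fun p : (Time T × Ω) × ℝ ↦ α p.1.1 p.2 p.1.2)
    (hint : ∀ a : ℝ, ∀ᵐ ω ∂P, ∫⁻ s, ∫⁻ x in Ioi a, ‖α s x ω‖ₑ ∂(leftLaw Q s ω)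
      ∂(stieltjes fun u ↦ C u ω) < ∞) :
    ∀ᵐ ω ∂P, Integrable (fun s ↦ α s (L ω) ω) (stieltjes fun u ↦ C u ω) := by
  filter_upwards [ae_all_iff.2 fun n : ℕ ↦ ae_lintegral_lt_top_of_lt h𝓕 hL hQ hC hα (hint (-n))]
    with ω hω
  obtain ⟨n, hn⟩ := exists_nat_gt (-L ω)
  exact ⟨((measurable_prod_of_predictable hα).comp
    (measurable_prodMk_right.prodMk measurable_const)).aestronglyMeasurable, hω n (by linarith)⟩

end

/-! ### Increments of the martingale part on `{L > a}` -/

section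

variable {τ τ' : Ω → WithTop (Time T)} {ω : Ω}

lemma stopAt_congr (h : τ ω = τ' ω) (t : Time T) : stopAt τ t ω = stopAt τ' t ω := by
  simp [stopAt, h]

lemma stopAt_mono_left (h : τ ω ≤ τ' ω) (t : Time T) : stopAt τ t ω ≤ stopAt τ' t ω := by
  rw [← WithTop.coe_le_coe, coe_stopAt, coe_stopAt]
  exact min_le_min le_rfl h

lemma stopped_stopAt (τ : Ω → WithTop (Time T)) (X : Time T → Ω → ℝ) (t : Time T) (ω : Ω) :
    stopped τ X (stopAt τ t ω) ω = stopped τ X t ω := by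
  simp only [stopped, indicator, stopAt_of_le (coe_stopAt_le τ t ω)]

end

lemma IsIncreasing.exists_integrableOn_bound {𝓕 : Filtration (Time T) m} {P : Measure Ω}
    {C : Time T → Ω → ℝ} (hC : IsIncreasing 𝓕 C) {G : Time T × Ω → ℝ} (hG : Measurable G)
    {r : Ω → Time T} (hr : Measurable r) {R : Set Ω}
    (hfin : ∫⁻ ω in R, ∫⁻ s in Ioc ⊥ (r ω), ‖G (s, ω)‖ₑ ∂(stieltjes fun u ↦ C u ω) ∂P < ∞) :
    ∃ F : Ω → ℝ, IntegrableOn F R P ∧ ∀ᵐ ω ∂(P.restrict R),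
      IntegrableOn (fun u ↦ G (u, ω)) (Ioc ⊥ (r ω)) (stieltjes fun t ↦ C t ω) ∧
      ∀ u v, v ≤ r ω → ‖∫ u in Ioc u v, G (u, ω) ∂(stieltjes fun t ↦ C t ω)‖ ≤ F ω := by
  have hm := hC.measurable_setLIntegral_Ioc hG.enorm measurable_const hr (r := fun _ ↦ ⊥)
  refine ⟨_, integrable_toReal_of_lintegral_ne_top hm.aemeasurable hfin.ne, ?_⟩
  filter_upwards [ae_lt_top hm hfin.ne] with ω hω
  refine ⟨⟨(hG.comp measurable_prodMk_right).aestronglyMeasurable, hω⟩, fun u v hv ↦ ?_⟩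
  have h : ‖∫ u in Ioc u v, G (u, ω) ∂(stieltjes fun t ↦ C t ω)‖ₑ
      ≤ ∫⁻ u in Ioc ⊥ (r ω), ‖G (u, ω)‖ₑ ∂(stieltjes fun t ↦ C t ω) :=
    (enorm_integral_le_lintegral_enorm _).trans (lintegral_mono_set (Ioc_subset_Ioc bot_le hv))
  simpa only [toReal_enorm] using ENNReal.toReal_mono hω.ne h

section

variable {𝓕 : Filtration (Time T) m} {P : Measure Ω} {L : Ω → ℝ}
  {Q : Time T → Ω → ProbabilityMeasure ℝ} {C : Time T → Ω → ℝ} {α : Time T → ℝ → Ω → ℝ}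

lemma IsCadlagLaw.integrable_tail_mul {X : Ω → ℝ} (hX : Integrable X P)
    (hQ : IsCadlagLaw 𝓕 P L Q) {r : Ω → Time T}
    (hr : IsStoppingTime 𝓕 fun ω ↦ (r ω : WithTop (Time T))) (a : ℝ) :
    Integrable (fun ω ↦ tail Q a (r ω) ω * X ω) P := by
  have htail : Measurable fun ω ↦ tail Q a (r ω) ω :=
    ((Measure.measurable_coe measurableSet_Ioi).comp
      ((hQ.measurable_sampled hr).mono hr.measurableSpace_le le_rfl)).ennreal_toReal
  refine hX.bdd_mul (c := 1) htail.aestronglyMeasurable (ae_of_all _ fun ω ↦ ?_)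
  rw [tail, Real.norm_of_nonneg measureReal_nonneg]
  exact measureReal_le_one

lemma setIntegral_inter_stopAt_sub (X : Time T → Ω → ℝ) {τ : Ω → WithTop (Time T)} {s t : Time T}
    (hst : s ≤ t) {B : Set Ω} (hB : MeasurableSet B) :
    ∫ ω in B ∩ {ω | s < τ ω}, (X (stopAt τ t ω) ω - X (stopAt τ s ω) ω) ∂P
      = ∫ ω in B, (X (stopAt τ t ω) ω - X (stopAt τ s ω) ω) ∂P := by
  refine (setIntegral_eq_of_subset_of_forall_sdiff_eq_zero hB inter_subset_left fun ω hω ↦ ?_).symm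
  rw [stopAt_eq_of_le hst (not_lt.1 fun h ↦ hω.2 ⟨hω.1, h⟩), sub_self]

lemma IsCadlagLaw.integrable_integral_leftLaw (hQ : IsCadlagLaw 𝓕 P L Q)
    (hα : Measurable[𝓕.predictable.prod (borel ℝ)] fun p : (Time T × Ω) × ℝ ↦ α p.1.1 p.2 p.1.2)
    {B : Set ℝ} (hB : MeasurableSet B) {μ : Measure (Time T)} {ω : Ω}
    (hfin : ∫⁻ s, ∫⁻ x in B, ‖α s x ω‖ₑ ∂(leftLaw Q s ω) ∂μ < ∞) :
    Integrable (fun s ↦ ∫ x in B, α s x ω ∂(leftLaw Q s ω)) μ := by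
  have hm := StronglyMeasurable.integral_kernel_prod_right' (κ := hQ.leftKernel.restrict hB)
    (Measurable.stronglyMeasurable hα)
  exact ⟨((hm.measurable.mono (predictable_le 𝓕) le_rfl).comp
    measurable_prodMk_right).aestronglyMeasurable,
    (lintegral_mono fun s ↦ enorm_integral_le_lintegral_enorm _).trans_lt hfin⟩

variable [IsFiniteMeasure P]

lemma IsCadlagLaw.setIntegral_tail_mul (h𝓕 : UsualConditions 𝓕 P) (hL : Measurable L)
    (hQ : IsCadlagLaw 𝓕 P L Q) {N : Time T → Ω → ℝ} (hN : StronglyAdapted 𝓕 N)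
    (hNc : ∀ᵐ ω ∂P, RightContinuous fun t ↦ N t ω) {r : Ω → Time T}
    (hr : IsStoppingTime 𝓕 fun ω ↦ (r ω : WithTop (Time T)))
    (hNr : Integrable (fun ω ↦ N (r ω) ω) P) {S : Set Ω}
    (hS : MeasurableSet[hr.measurableSpace] S) (a : ℝ) :
    ∫ ω in S ∩ {ω | a < L ω}, N (r ω) ω ∂P = ∫ ω in S, tail Q a (r ω) ω * N (r ω) ω ∂P := by
  have hS' := hr.measurableSpace_le _ hS
  obtain ⟨Y, hY, hNY⟩ := exists_measurable_ae_eq_sampled h𝓕 hN hNc hr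
  have h := (hQ.isConditionalLaw_sampled h𝓕 hL hr).integral_mul hr.measurableSpace_le hL
    (hQ.measurable_sampled hr) (measurableSet_Ioi (a := a)) (X := S.indicator fun ω ↦ N (r ω) ω)
    ⟨S.indicator Y, (hY.indicator hS).stronglyMeasurable, hNY.mono fun ω hω ↦ by
      simp only [indicator, hω]⟩ (hNr.indicator hS')
  rw [← integral_indicator hS',
    ← integral_indicator (hS'.inter (measurableSet_lt measurable_const hL))]
  convert! h using 3 with ω ω
  · by_cases hωS : ω ∈ S <;> by_cases hωL : a < L ω <;> simp [indicator, hωS, hωL]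
  · by_cases hωS : ω ∈ S <;> simp [tail, hωS, mul_comm]

lemma setIntegral_stopAt_sub_eq (h𝓕 : UsualConditions 𝓕 P) (hL : Measurable L)
    (hQ : IsCadlagLaw 𝓕 P L Q) {a : ℝ} {N W A : Time T → Ω → ℝ} (hN : Martingale N 𝓕 P)
    (hNc : ∀ᵐ ω ∂P, RightContinuous fun t ↦ N t ω) (hW : Martingale W 𝓕 P)
    (hWc : ∀ᵐ ω ∂P, RightContinuous fun t ↦ W t ω) {ρ : Ω → WithTop (Time T)}
    (hρ : IsStoppingTime 𝓕 ρ) (hWN : ∀ᵐ ω ∂P, ∀ u : Time T, ⊥ < ρ ω → u ≤ ρ ω →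
      W u ω = tail Q a u ω * N u ω - A u ω)
    {s t : Time T} (hst : s ≤ t) {B : Set Ω} (hB : MeasurableSet[𝓕 s] B) :
    ∫ ω in B ∩ {ω | a < L ω}, (N (stopAt ρ t ω) ω - N (stopAt ρ s ω) ω) ∂P
      = ∫ ω in B, (A (stopAt ρ t ω) ω - A (stopAt ρ s ω) ω) ∂P := by
  -- `B ∩ {s < ρ}` is seen at both times `s ∧ ρ` and `t ∧ ρ`, unlike `B`.
  set S : Set Ω := B ∩ {ω | s < ρ ω} with hSdef
  have hBm : MeasurableSet B := 𝓕.le s B hB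
  have hLa : MeasurableSet {ω | a < L ω} := measurableSet_lt measurable_const hL
  have hW_int := integrable_stopAt h𝓕 hW hWc hρ
  have hW_zero : ∫ ω in S, (W (stopAt ρ t ω) ω - W (stopAt ρ s ω) ω) ∂P = 0 := by
    rw [integral_sub (hW_int t).integrableOn (hW_int s).integrableOn,
      setIntegral_stopAt h𝓕 hW hWc hρ hst hB, setIntegral_stopAt h𝓕 hW hWc hρ le_rfl hB, sub_self]
  have hN_int := integrable_stopAt h𝓕 hN hNc hρ
  have hτ := isStoppingTime_stopAt hρ
  have hV_int := fun u ↦ hQ.integrable_tail_mul (hN_int u) (hτ u) a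
  have hV : ∀ u, s ≤ u → ∫ ω in S ∩ {ω | a < L ω}, N (stopAt ρ u ω) ω ∂P
      = ∫ ω in S, tail Q a (stopAt ρ u ω) ω * N (stopAt ρ u ω) ω ∂P := fun u hu ↦
    hQ.setIntegral_tail_mul h𝓕 hL hN.1 hNc (hτ u) (hN_int u)
      (measurableSet_inter_lt_stopAt hρ hu hB) a
  rw [← setIntegral_inter_stopAt_sub N hst (hBm.inter hLa), inter_right_comm, ← hSdef,
    ← setIntegral_inter_stopAt_sub A hst hBm,
    integral_sub (hN_int t).integrableOn (hN_int s).integrableOn, hV t hst, hV s le_rfl,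
    ← integral_sub (hV_int t).integrableOn (hV_int s).integrableOn, ← sub_zero (∫ ω in S, _ ∂P),
    ← hW_zero, ← integral_sub (f := fun ω ↦ tail Q a (stopAt ρ t ω) ω * N (stopAt ρ t ω) ω
        - tail Q a (stopAt ρ s ω) ω * N (stopAt ρ s ω) ω)
      (g := fun ω ↦ W (stopAt ρ t ω) ω - W (stopAt ρ s ω) ω)
      ((hV_int t).sub (hV_int s)).integrableOn ((hW_int t).sub (hW_int s)).integrableOn]
  refine setIntegral_congr_ae (𝓕.le s _ (hB.inter (hρ.measurableSet_gt s))) ?_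
  filter_upwards [hWN] with ω hω hωS
  have hpos : ⊥ < ρ ω := bot_le.trans_lt hωS.2
  rw [hω _ hpos (coe_stopAt_le ρ t ω), hω _ hpos (coe_stopAt_le ρ s ω)]
  ring

lemma setIntegral_tailIntegral_sub (hL : Measurable L)
    (hQ : IsCadlagLaw 𝓕 P L Q) (hC : IsIncreasing 𝓕 C)
    (hα : Measurable[𝓕.predictable.prod (borel ℝ)] fun p : (Time T × Ω) × ℝ ↦ α p.1.1 p.2 p.1.2)
    {a : ℝ} (hint : ∀ᵐ ω ∂P, ∫⁻ s, ∫⁻ x in Ioi a, ‖α s x ω‖ₑ ∂(leftLaw Q s ω)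
      ∂(stieltjes fun u ↦ C u ω) < ∞) {ρ : Ω → WithTop (Time T)} (hρ : IsStoppingTime 𝓕 ρ)
    (hfin : ∫⁻ ω in {ω | a < L ω}, ∫⁻ u in Ioc ⊥ (stopAt ρ ⊤ ω), ‖α u (L ω) ω‖ₑ
      ∂(stieltjes fun t ↦ C t ω) ∂P < ∞) {s t : Time T} (hst : s ≤ t) {B : Set Ω}
    (hB : MeasurableSet[𝓕 s] B) :
    ∫ ω in B, (tailIntegral Q C α a (stopAt ρ t ω) ω - tailIntegral Q C α a (stopAt ρ s ω) ω) ∂P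
      = ∫ ω in B ∩ {ω | a < L ω}, ∫ u in Ioc (stopAt ρ s ω) (stopAt ρ t ω), α u (L ω) ω
        ∂(stieltjes fun t ↦ C t ω) ∂P := by
  have hBm : MeasurableSet B := 𝓕.le s B hB
  have hLa : MeasurableSet {ω | a < L ω} := measurableSet_lt measurable_const hL
  let E : Set (Time T × Ω) := {p | p.2 ∈ B ∧ p.1 ∈ Ioc (stopAt ρ s p.2) (stopAt ρ t p.2)}
  have hE_eq : ∀ ω ∈ B, (·, ω) ⁻¹' E = Ioc (stopAt ρ s ω) (stopAt ρ t ω) := fun ω hω ↦ by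
    ext u
    simp [E, hω]
  have hE_empty : ∀ ω ∉ B, (·, ω) ⁻¹' E = ∅ := fun ω hω ↦ by
    ext u
    simp [E, hω]
  have hE_sub : ∀ ω, (·, ω) ⁻¹' E ⊆ Ioc ⊥ (stopAt ρ ⊤ ω) := fun ω u hu ↦
    ⟨bot_le.trans_lt hu.2.1, hu.2.2.trans (monotone_stopAt ρ ω le_top)⟩
  have hswap := hQ.setIntegral_setIntegral_leftLaw hL hC hα
    (measurableSet_predictable_Ioc_stopAt hρ t hB) (measurableSet_Ioi (a := a))
    ((lintegral_mono fun ω ↦ lintegral_mono_set (hE_sub ω)).trans_lt hfin).ne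
  calc ∫ ω in B, (tailIntegral Q C α a (stopAt ρ t ω) ω
          - tailIntegral Q C α a (stopAt ρ s ω) ω) ∂P
      = ∫ ω in B, ∫ u in Ioc (stopAt ρ s ω) (stopAt ρ t ω), ∫ x in Ioi a, α u x ω ∂(leftLaw Q u ω)
          ∂(stieltjes fun t ↦ C t ω) ∂P := by
        refine setIntegral_congr_ae hBm (hint.mono fun ω hω _ ↦ ?_)
        have hi := hQ.integrable_integral_leftLaw hα measurableSet_Ioi hω
        rw [tailIntegral, tailIntegral, ← Ioc_union_Ioc_eq_Ioc bot_le (monotone_stopAt ρ ω hst),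
          setIntegral_union (Ioc_disjoint_Ioc_of_le le_rfl) measurableSet_Ioc hi.integrableOn
            hi.integrableOn, add_sub_cancel_left]
    _ = ∫ ω, ∫ u in (·, ω) ⁻¹' E, ∫ x in Ioi a, α u x ω ∂(leftLaw Q u ω)
          ∂(stieltjes fun t ↦ C t ω) ∂P := by
        refine Eq.trans (setIntegral_congr_fun hBm fun ω hω ↦ ?_)
          (setIntegral_eq_integral_of_forall_compl_eq_zero fun ω hω ↦ ?_)
        · simp only [hE_eq ω hω]
        · rw [hE_empty ω hω, setIntegral_empty]
    _ = ∫ ω in {ω | a < L ω}, ∫ u in (·, ω) ⁻¹' E, α u (L ω) ω ∂(stieltjes fun t ↦ C t ω) ∂P :=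
        hswap
    _ = ∫ ω in B ∩ {ω | a < L ω}, ∫ u in Ioc (stopAt ρ s ω) (stopAt ρ t ω), α u (L ω) ω
          ∂(stieltjes fun t ↦ C t ω) ∂P := by
        rw [setIntegral_eq_of_subset_of_forall_sdiff_eq_zero hLa inter_subset_right
          fun ω hω ↦ by rw [hE_empty ω fun h ↦ hω.2 ⟨h, hω.1⟩, setIntegral_empty]]
        exact setIntegral_congr_fun (hBm.inter hLa) fun ω hω ↦ by simp only [hE_eq ω hω.1]

end

section

variable {𝓕 : Filtration (Time T) m} {P : Measure Ω}

lemma eventually_eq_top {τ : ℕ → WithTop (Time T)} (h : Tendsto τ atTop (𝓝 ⊤)) :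
    ∀ᶠ n in atTop, τ n = ⊤ := by
  filter_upwards [h.eventually_const_lt (WithTop.coe_lt_top (⊤ : Time T))] with n hn
  by_contra hne
  obtain ⟨u, hu⟩ := WithTop.ne_top_iff_exists.1 hne
  exact not_top_lt (WithTop.coe_lt_coe.1 (hu ▸ hn))

lemma tendsto_setIntegral_stopAt [IsFiniteMeasure P] (h𝓕 : UsualConditions 𝓕 P)
    {N : Time T → Ω → ℝ} (hN : Martingale N 𝓕 P)
    (hNc : ∀ᵐ ω ∂P, RightContinuous fun t ↦ N t ω) {ρ : ℕ → Ω → WithTop (Time T)}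
    (hρ : ∀ n, IsStoppingTime 𝓕 (ρ n)) {t : Time T}
    (h : ∀ᵐ ω ∂P, ∀ᶠ n in atTop, N (stopAt (ρ n) t ω) ω = N t ω) (R : Set Ω) :
    Tendsto (fun n ↦ ∫ ω in R, N (stopAt (ρ n) t ω) ω ∂P) atTop (𝓝 (∫ ω in R, N t ω ∂P)) :=
  (tendsto_setIntegral_of_ae_eq_condExp (hN.integrable t)
    (fun n ↦ (isStoppingTime_stopAt (hρ n) t).measurableSpace_le)
    (fun n ↦ martingale_sampled_ae_eq_condExp h𝓕 hN hNc (isStoppingTime_stopAt (hρ n) t)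
      fun ω ↦ stopAt_le _ t ω)
    (h.mono fun _ hω ↦ tendsto_const_nhds.congr' (hω.mono fun _ hn ↦ hn.symm))).2 R

lemma IsIncreasing.tendsto_setIntegral_setIntegral_Ioc_stopAt {C : Time T → Ω → ℝ}
    (hC : IsIncreasing 𝓕 C) {G : Time T × Ω → ℝ} (hG : Measurable G) {R : Set Ω}
    {σ : Ω → WithTop (Time T)} (hσ : IsStoppingTime 𝓕 σ)
    (hfin : ∫⁻ ω in R, ∫⁻ u in Ioc ⊥ (stopAt σ ⊤ ω), ‖G (u, ω)‖ₑ
      ∂(stieltjes fun t ↦ C t ω) ∂P < ∞) {ρ : ℕ → Ω → WithTop (Time T)}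
    (hρ : ∀ n, IsStoppingTime 𝓕 (ρ n)) (hle : ∀ n ω, ρ n ω ≤ σ ω)
    (h : ∀ᵐ ω ∂P, ∀ᶠ n in atTop, ρ n ω = σ ω) (s t : Time T) :
    Tendsto (fun n ↦ ∫ ω in R, ∫ u in Ioc (stopAt (ρ n) s ω) (stopAt (ρ n) t ω), G (u, ω)
        ∂(stieltjes fun t ↦ C t ω) ∂P) atTop
      (𝓝 (∫ ω in R, ∫ u in Ioc (stopAt σ s ω) (stopAt σ t ω), G (u, ω)
        ∂(stieltjes fun t ↦ C t ω) ∂P)) := by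
  obtain ⟨F, hF, hFb⟩ := hC.exists_integrableOn_bound hG (measurable_stopAt hσ ⊤) hfin
  refine tendsto_integral_of_dominated_convergence F (fun n ↦ ?_) hF (fun n ↦ ?_)
    (ae_restrict_of_ae ?_)
  · exact (hC.stronglyMeasurable_setIntegral_Ioc hG (measurable_stopAt (hρ n) s)
      (measurable_stopAt (hρ n) t)).aestronglyMeasurable
  · filter_upwards [hFb] with ω hω
    exact hω.2 _ _ ((stopAt_mono_left (hle n ω) t).trans (monotone_stopAt σ ω le_top))
  · filter_upwards [h] with ω hω
    refine tendsto_const_nhds.congr' (hω.mono fun n hn ↦ ?_)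
    simp only [stopAt_congr hn]

variable [IsFiniteMeasure P] {L : Ω → ℝ} {Q : Time T → Ω → ProbabilityMeasure ℝ}
  {C : Time T → Ω → ℝ} {α : Time T → ℝ → Ω → ℝ}

lemma setIntegral_stopped_stopAt_sub (h𝓕 : UsualConditions 𝓕 P) (hL : Measurable L)
    (hQ : IsCadlagLaw 𝓕 P L Q) (hC : IsIncreasing 𝓕 C)
    (hα : Measurable[𝓕.predictable.prod (borel ℝ)] fun p : (Time T × Ω) × ℝ ↦ α p.1.1 p.2 p.1.2)
    {a : ℝ} (hint : ∀ᵐ ω ∂P, ∫⁻ s, ∫⁻ x in Ioi a, ‖α s x ω‖ₑ ∂(leftLaw Q s ω)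
      ∂(stieltjes fun u ↦ C u ω) < ∞) {M W : Time T → Ω → ℝ}
    (hMc : ∀ᵐ ω ∂P, RightContinuous fun t ↦ M t ω)
    (hWc : ∀ᵐ ω ∂P, RightContinuous fun t ↦ W t ω)
    (hWM : ∀ t ω, W t ω = tail Q a t ω * M t ω - tailIntegral Q C α a t ω)
    {σ τ ρ : Ω → WithTop (Time T)} (hM : Martingale (stopped σ M) 𝓕 P)
    (hW : Martingale (stopped τ W) 𝓕 P) (hρ : IsStoppingTime 𝓕 ρ) (hρσ : ∀ ω, ρ ω ≤ σ ω)
    (hρτ : ∀ ω, ρ ω ≤ τ ω)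
    (hfin : ∫⁻ ω in {ω | a < L ω}, ∫⁻ u in Ioc ⊥ (stopAt σ ⊤ ω), ‖α u (L ω) ω‖ₑ
      ∂(stieltjes fun t ↦ C t ω) ∂P < ∞) {s t : Time T} (hst : s ≤ t) {B : Set Ω}
    (hB : MeasurableSet[𝓕 s] B) :
    ∫ ω in B ∩ {ω | a < L ω}, (stopped σ M (stopAt ρ t ω) ω - stopped σ M (stopAt ρ s ω) ω) ∂P
      = ∫ ω in B ∩ {ω | a < L ω}, ∫ u in Ioc (stopAt ρ s ω) (stopAt ρ t ω), α u (L ω) ω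
        ∂(stieltjes fun t ↦ C t ω) ∂P := by
  have hfin_ρ := (lintegral_mono (μ := P.restrict {ω | a < L ω}) fun ω ↦ lintegral_mono_set
    (Ioc_subset_Ioc_right (stopAt_mono_left (hρσ ω) ⊤))).trans_lt hfin
  refine (setIntegral_stopAt_sub_eq h𝓕 hL hQ hM
    (hMc.mono fun ω hω ↦ rightContinuous_stopped hω) hW
    (hWc.mono fun ω hω ↦ rightContinuous_stopped hω) hρ
    (ae_of_all P fun ω u hu hule ↦ ?_) hst hB).trans
    (setIntegral_tailIntegral_sub hL hQ hC hα hint hρ hfin_ρ hst hB)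
  rw [stopped_of_lt (hu.trans_le (hρτ ω)), stopped_of_lt (hu.trans_le (hρσ ω)),
    stopAt_of_le (hule.trans (hρτ ω)), stopAt_of_le (hule.trans (hρσ ω)), hWM]

theorem setIntegral_stopped_sub (h𝓕 : UsualConditions 𝓕 P) (hL : Measurable L)
    (hQ : IsCadlagLaw 𝓕 P L Q) (hC : IsIncreasing 𝓕 C)
    (hα : Measurable[𝓕.predictable.prod (borel ℝ)] fun p : (Time T × Ω) × ℝ ↦ α p.1.1 p.2 p.1.2)
    {a : ℝ} (hint : ∀ᵐ ω ∂P, ∫⁻ s, ∫⁻ x in Ioi a, ‖α s x ω‖ₑ ∂(leftLaw Q s ω)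
      ∂(stieltjes fun u ↦ C u ω) < ∞) {M : Time T → Ω → ℝ}
    (hMc : ∀ᵐ ω ∂P, RightContinuous fun t ↦ M t ω)
    (htail : IsLocalMartingale 𝓕 P fun t ω ↦ tail Q a t ω * M t ω - tailIntegral Q C α a t ω)
    {σ : Ω → WithTop (Time T)} (hσ : IsStoppingTime 𝓕 σ) (hM : Martingale (stopped σ M) 𝓕 P)
    (hfin : ∫⁻ ω in {ω | a < L ω}, ∫⁻ u in Ioc ⊥ (stopAt σ ⊤ ω), ‖α u (L ω) ω‖ₑ
      ∂(stieltjes fun t ↦ C t ω) ∂P < ∞) {s t : Time T} (hst : s ≤ t) {B : Set Ω}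
    (hB : MeasurableSet[𝓕 s] B) :
    ∫ ω in B ∩ {ω | a < L ω}, (stopped σ M t ω - stopped σ M s ω) ∂P
      = ∫ ω in B ∩ {ω | a < L ω}, ∫ u in Ioc (stopAt σ s ω) (stopAt σ t ω), α u (L ω) ω
        ∂(stieltjes fun t ↦ C t ω) ∂P := by
  obtain ⟨hWc, τ, hτ, hW⟩ := htail
  have hNc := hMc.mono fun ω hω ↦ rightContinuous_stopped (τ := σ) hω
  let ρ : ℕ → Ω → WithTop (Time T) := fun n ω ↦ min (σ ω) (τ n ω)
  have hρ : ∀ n, IsStoppingTime 𝓕 (ρ n) := fun n ↦ hσ.min (hτ.isStoppingTime n)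
  have hρσ : ∀ n ω, ρ n ω ≤ σ ω := fun n ω ↦ min_le_left _ _
  have hρ_eq : ∀ᵐ ω ∂P, ∀ᶠ n in atTop, ρ n ω = σ ω := hτ.tendsto_top.mono fun ω hω ↦
    (eventually_eq_top hω).mono fun n hn ↦ by simp only [ρ, hn, min_top_right]
  have hlim := fun r ↦ tendsto_setIntegral_stopAt h𝓕 hM hNc hρ (t := r)
    (hρ_eq.mono fun ω hω ↦ hω.mono fun n hn ↦ by rw [stopAt_congr hn, stopped_stopAt])
    (B ∩ {ω | a < L ω})
  have hint_stop := fun n r ↦ (integrable_stopAt h𝓕 hM hNc (hρ n) r).integrableOn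
    (s := B ∩ {ω | a < L ω})
  rw [integral_sub (hM.integrable t).integrableOn (hM.integrable s).integrableOn]
  refine tendsto_nhds_unique (((hlim t).sub (hlim s)).congr fun n ↦ ?_)
    (hC.tendsto_setIntegral_setIntegral_Ioc_stopAt
      (measurable_comp_of_predictable hα hL) hσ
      ((lintegral_mono_set inter_subset_right).trans_lt hfin) hρ hρσ hρ_eq s t)
  rw [← integral_sub (hint_stop n t) (hint_stop n s)]
  exact setIntegral_stopped_stopAt_sub h𝓕 hL hQ hC hα hint hMc
    (hWc.mono fun ω hω ↦ hω.rightContinuous) (fun _ _ ↦ rfl) hM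
    (by rw [← stoppedProcess_indicator]; exact hW n) (hρ n) (hρσ n)
    (fun ω ↦ min_le_right _ _) hfin hst hB

end

/-! ### The enlarged filtration -/

lemma isStoppingTime_mono_filtration {ι : Type*} [Preorder ι] {𝓕 𝓖 : Filtration ι m} (h : 𝓕 ≤ 𝓖)
    {τ : Ω → WithTop ι} (hτ : IsStoppingTime 𝓕 τ) : IsStoppingTime 𝓖 τ :=
  fun i ↦ h i _ (hτ i)

lemma IsIncreasing.mono_filtration {𝓕 𝓖 : Filtration (Time T) m} (h : 𝓕 ≤ 𝓖)
    {C : Time T → Ω → ℝ} (hC : IsIncreasing 𝓕 C) : IsIncreasing 𝓖 C :=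
  ⟨hC.predictable.mono (predictable_mono h) le_rfl, hC.zero, hC.mono, hC.rightCont⟩

section

variable {𝓕 : Filtration (Time T) m} {P : Measure Ω} {L : Ω → ℝ}

lemma le_enlarge (hL : Measurable L) : 𝓕 ≤ enlarge 𝓕 L hL :=
  le_sup_left.trans (Filtration.le_rightCont _)

lemma measurable_enlarge (hL : Measurable L) (t : Time T) : Measurable[enlarge 𝓕 L hL t] L := by
  have h : MeasurableSpace.comap L inferInstance ≤ enlarge 𝓕 L hL t :=
    (le_sup_right (a := 𝓕 t)).trans (Filtration.le_rightCont
      (𝓕 ⊔ Filtration.const (Time T) (MeasurableSpace.comap L inferInstance) hL.comap_le) t)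
  exact fun s hs ↦ h _ ⟨s, hs, rfl⟩

lemma UsualConditions.enlarge (h𝓕 : UsualConditions 𝓕 P) (hL : Measurable L) :
    UsualConditions (enlarge 𝓕 L hL) P where
  rightCont := by
    unfold Enlargement.enlarge
    infer_instance
  null s hs := le_enlarge hL ⊥ s (h𝓕.null s hs)

lemma measurableSet_of_enlarge (hL : Measurable L) {s t : Time T} (hst : s < t) {A : Set Ω}
    (hA : MeasurableSet[enlarge 𝓕 L hL s] A) :
    MeasurableSet[𝓕 t ⊔ MeasurableSpace.comap L inferInstance] A := by
  rw [enlarge, Filtration.rightCont_eq_of_not_isMax _ (not_isMax_of_lt hst)] at hA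
  exact (iInf₂_le (f := fun j (_ : j > s) ↦
    (𝓕 ⊔ Filtration.const (Time T) (MeasurableSpace.comap L inferInstance) hL.comap_le) j) t hst)
    A hA

lemma martingale_enlarge_of_setIntegral_sub [IsFiniteMeasure P] (hL : Measurable L)
    {X : Time T → Ω → ℝ} (hX : StronglyAdapted (enlarge 𝓕 L hL) X)
    (hi : ∀ t, Integrable (X t) P)
    (hsub : ∀ s t, s < t → ∀ A, MeasurableSet[𝓕 s ⊔ MeasurableSpace.comap L inferInstance] A →
      ∫ ω in A, (X t ω - X s ω) ∂P = 0)
    (hlim : ∀ s A, MeasurableSet A →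
      Tendsto (fun u ↦ ∫ ω in A, X u ω ∂P) (𝓝[≥] s) (𝓝 (∫ ω in A, X s ω ∂P))) :
    Martingale X (enlarge 𝓕 L hL) P := by
  refine martingale_of_setIntegral_sub hX hi fun s t hst A hA ↦ ?_
  have hlim_gt := (hlim s A ((enlarge 𝓕 L hL).le s _ hA)).mono_left
    (nhdsWithin_mono s Ioi_subset_Ici_self)
  have hconst : ∀ᶠ u in 𝓝[>] s, ∫ ω in A, X t ω ∂P = ∫ ω in A, X u ω ∂P := by
    filter_upwards [Ioo_mem_nhdsGT hst] with u hu
    rw [← sub_eq_zero, ← integral_sub (hi t).integrableOn (hi u).integrableOn]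
    exact hsub u t hu.2 A (measurableSet_of_enlarge hL hu.1 hA)
  have : (𝓝[>] s).NeBot := nhdsGT_neBot_of_exists_gt ⟨t, hst⟩
  rw [integral_sub (hi t).integrableOn (hi s).integrableOn, sub_eq_zero]
  exact tendsto_nhds_unique (tendsto_const_nhds.congr' hconst) hlim_gt

end

lemma inter_lt_eq_max_lt (L : Ω → ℝ) (a b : ℝ) :
    {ω | a < L ω} ∩ {ω | b < L ω} = {ω | max a b < L ω} := by
  ext ω
  simp only [mem_inter_iff, mem_ofPred_eq, max_lt_iff]

lemma isPiSystem_inter_lt (𝓐 : MeasurableSpace Ω) (L : Ω → ℝ) :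
    IsPiSystem {A | ∃ B a, MeasurableSet[𝓐] B ∧ A = B ∩ {ω | a < L ω}} := by
  rintro _ ⟨B, a, hB, rfl⟩ _ ⟨B', a', hB', rfl⟩ -
  refine ⟨B ∩ B', max a a', hB.inter hB', ?_⟩
  rw [inter_inter_inter_comm, inter_lt_eq_max_lt]

lemma monotone_neg_nat_lt (L : Ω → ℝ) : Monotone fun n : ℕ ↦ {ω | -(n : ℝ) < L ω} :=
  fun _ _ hnk ω (hω : _ < L ω) ↦
    show _ < L ω from (neg_le_neg (Nat.cast_le (α := ℝ).2 hnk)).trans_lt hω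

lemma iUnion_neg_nat_lt (L : Ω → ℝ) : ⋃ n : ℕ, {ω | -(n : ℝ) < L ω} = univ := by
  refine eq_univ_of_forall fun ω ↦ ?_
  obtain ⟨n, hn⟩ := exists_nat_gt (-L ω)
  exact mem_iUnion.2 ⟨n, neg_lt.1 hn⟩

lemma sup_comap_eq_generateFrom (𝓐 : MeasurableSpace Ω) (L : Ω → ℝ) :
    𝓐 ⊔ MeasurableSpace.comap L inferInstance
      = .generateFrom {A | ∃ B a, MeasurableSet[𝓐] B ∧ A = B ∩ {ω | a < L ω}} := by
  refine le_antisymm (sup_le (fun B hB ↦ ?_) ?_) (MeasurableSpace.generateFrom_le ?_)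
  · have : B = ⋃ n : ℕ, B ∩ {ω | -(n : ℝ) < L ω} := by
      rw [← inter_iUnion, iUnion_neg_nat_lt, inter_univ]
    rw [this]
    exact MeasurableSet.iUnion fun n ↦ MeasurableSpace.measurableSet_generateFrom ⟨B, _, hB, rfl⟩
  · refine Measurable.comap_le (measurable_of_Ioi fun a ↦ ?_)
    exact MeasurableSpace.measurableSet_generateFrom
      ⟨univ, a, MeasurableSet.univ, (univ_inter _).symm⟩
  · rintro _ ⟨B, a, hB, rfl⟩
    exact (le_sup_left (a := 𝓐) _ hB).inter
      (le_sup_right (a := 𝓐) _ ⟨Ioi a, measurableSet_Ioi, rfl⟩)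

lemma setIntegral_eq_zero_of_inter_lt {Ω : Type*} {𝓐 m : MeasurableSpace Ω} {P : Measure Ω}
    {L : Ω → ℝ} (h𝓐 : 𝓐 ≤ m) (hL : Measurable L) {f : Ω → ℝ} (hf : Integrable f P)
    (h : ∀ B, MeasurableSet[𝓐] B → ∀ a : ℝ, ∫ ω in B ∩ {ω | a < L ω}, f ω ∂P = 0) {A : Set Ω}
    (hA : MeasurableSet[𝓐 ⊔ MeasurableSpace.comap L inferInstance] A) : ∫ ω in A, f ω ∂P = 0 := by
  have hle : 𝓐 ⊔ MeasurableSpace.comap L inferInstance ≤ m := sup_le h𝓐 hL.comap_le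
  have huniv : ∫ ω, f ω ∂P = 0 := by
    have hlim := tendsto_setIntegral_of_monotone (μ := P) (f := f)
      (fun n : ℕ ↦ measurableSet_lt measurable_const hL) (monotone_neg_nat_lt L) hf.integrableOn
    rw [iUnion_neg_nat_lt, setIntegral_univ] at hlim
    refine tendsto_nhds_unique hlim (tendsto_const_nhds.congr fun n ↦ ?_)
    simpa only [univ_inter] using (h univ MeasurableSet.univ (-(n : ℝ))).symm
  induction A, hA using MeasurableSpace.induction_on_inter (sup_comap_eq_generateFrom 𝓐 L)
    (isPiSystem_inter_lt 𝓐 L) with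
  | empty => exact setIntegral_empty
  | basic A hA =>
    obtain ⟨B, a, hB, rfl⟩ := hA
    exact h B hB a
  | compl A hA ih => rw [setIntegral_compl (hle _ hA) hf, ih, huniv, sub_zero]
  | iUnion A hd hA ih =>
    simp only [integral_iUnion (fun n ↦ hle _ (hA n)) hd hf.integrableOn, ih, tsum_zero]

/-! ### Martingales for the enlarged filtration -/

lemma tendsto_setIntegral_nhdsGE {𝓕 : Filtration (Time T) m} {P : Measure Ω} [IsFiniteMeasure P]
    {X : Time T → Ω → ℝ} (hX : Martingale X 𝓕 P) (hc : ∀ᵐ ω ∂P, RightContinuous fun t ↦ X t ω)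
    (s : Time T) (A : Set Ω) :
    Tendsto (fun u ↦ ∫ ω in A, X u ω ∂P) (𝓝[≥] s) (𝓝 (∫ ω in A, X s ω ∂P)) := by
  refine tendsto_of_seq_tendsto fun u hu ↦ ?_
  refine (tendsto_setIntegral_of_ae_eq_condExp (hX.integrable ⊤) (fun n ↦ 𝓕.le (u n))
    (fun n ↦ (hX.2 (u n) ⊤ le_top).symm) ?_).2 A
  filter_upwards [hc] with ω hω using (hω s).tendsto.comp hu

section

variable {𝓕 : Filtration (Time T) m} {P : Measure Ω} {C : Time T → Ω → ℝ}

namespace IsIncreasing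

variable {G : Time T × Ω → ℝ} {σ : Ω → WithTop (Time T)} {R : Set Ω}

lemma integrableOn_setIntegral_stopAt (hC : IsIncreasing 𝓕 C) (hG : Measurable G)
    (hσ : IsStoppingTime 𝓕 σ) (hfin : ∫⁻ ω in R, ∫⁻ u in Ioc ⊥ (stopAt σ ⊤ ω), ‖G (u, ω)‖ₑ
      ∂(stieltjes fun t ↦ C t ω) ∂P < ∞) (t : Time T) :
    IntegrableOn (fun ω ↦ ∫ u in Ioc ⊥ (stopAt σ t ω), G (u, ω)
      ∂(stieltjes fun t ↦ C t ω)) R P := by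
  obtain ⟨F, hF, hFb⟩ := hC.exists_integrableOn_bound hG (measurable_stopAt hσ ⊤) hfin
  refine Integrable.mono' hF (hC.stronglyMeasurable_setIntegral_Ioc hG measurable_const
    (measurable_stopAt hσ t)).aestronglyMeasurable ?_
  filter_upwards [hFb] with ω hω using hω.2 _ _ (monotone_stopAt σ ω le_top)

lemma setIntegral_setIntegral_Ioc_stopAt (hC : IsIncreasing 𝓕 C) (hG : Measurable G)
    (hσ : IsStoppingTime 𝓕 σ) (hfin : ∫⁻ ω in R, ∫⁻ u in Ioc ⊥ (stopAt σ ⊤ ω), ‖G (u, ω)‖ₑ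
      ∂(stieltjes fun t ↦ C t ω) ∂P < ∞) {s t : Time T} (hst : s ≤ t) :
    ∫ ω in R, ∫ u in Ioc (stopAt σ s ω) (stopAt σ t ω), G (u, ω) ∂(stieltjes fun t ↦ C t ω) ∂P
      = ∫ ω in R, (∫ u in Ioc ⊥ (stopAt σ t ω), G (u, ω) ∂(stieltjes fun t ↦ C t ω)
        - ∫ u in Ioc ⊥ (stopAt σ s ω), G (u, ω) ∂(stieltjes fun t ↦ C t ω)) ∂P := by
  obtain ⟨F, -, hFb⟩ := hC.exists_integrableOn_bound hG (measurable_stopAt hσ ⊤) hfin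
  refine integral_congr_ae ?_
  filter_upwards [hFb] with ω hω
  have hint : ∀ u v, IntegrableOn (fun u ↦ G (u, ω)) (Ioc u (stopAt σ v ω))
      (stieltjes fun t ↦ C t ω) := fun u v ↦
    hω.1.mono_set (Ioc_subset_Ioc bot_le (monotone_stopAt σ ω le_top))
  rw [← Ioc_union_Ioc_eq_Ioc bot_le (monotone_stopAt σ ω hst), setIntegral_union
    (Ioc_disjoint_Ioc_of_le le_rfl) measurableSet_Ioc (hint _ _) (hint _ _), add_sub_cancel_left]

lemma tendsto_setIntegral_setIntegral_stopAt (hC : IsIncreasing 𝓕 C) (hG : Measurable G)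
    (hσ : IsStoppingTime 𝓕 σ) (hfin : ∫⁻ ω in R, ∫⁻ u in Ioc ⊥ (stopAt σ ⊤ ω), ‖G (u, ω)‖ₑ
      ∂(stieltjes fun t ↦ C t ω) ∂P < ∞) (s : Time T) :
    Tendsto (fun v ↦ ∫ ω in R, ∫ u in Ioc ⊥ (stopAt σ v ω), G (u, ω)
        ∂(stieltjes fun t ↦ C t ω) ∂P) (𝓝[≥] s)
      (𝓝 (∫ ω in R, ∫ u in Ioc ⊥ (stopAt σ s ω), G (u, ω) ∂(stieltjes fun t ↦ C t ω) ∂P)) := by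
  obtain ⟨F, hF, hFb⟩ := hC.exists_integrableOn_bound hG (measurable_stopAt hσ ⊤) hfin
  refine tendsto_integral_filter_of_dominated_convergence F
    (Eventually.of_forall fun v ↦ (hC.stronglyMeasurable_setIntegral_Ioc hG measurable_const
      (measurable_stopAt hσ v)).aestronglyMeasurable) (Eventually.of_forall fun v ↦ ?_) hF ?_
  · filter_upwards [hFb] with ω hω using hω.2 _ _ (monotone_stopAt σ ω le_top)
  · filter_upwards [hFb] with ω hω
    have hrestrict : ∀ v, ∫ u in Ioc ⊥ (stopAt σ v ω), G (u, ω)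
        ∂((stieltjes fun t ↦ C t ω).restrict (Ioc ⊥ (stopAt σ ⊤ ω)))
        = ∫ u in Ioc ⊥ (stopAt σ v ω), G (u, ω) ∂(stieltjes fun t ↦ C t ω) := fun v ↦ by
      rw [Measure.restrict_restrict measurableSet_Ioc, inter_eq_left.2
        (Ioc_subset_Ioc_right (monotone_stopAt σ ω le_top))]
    simp_rw [← hrestrict]
    exact (rightContinuous_stopAt (isCadlag_setIntegral hω.1).rightContinuous σ ω s).tendsto

end IsIncreasing

variable {L : Ω → ℝ} {Q : Time T → Ω → ProbabilityMeasure ℝ} {α : Time T → ℝ → Ω → ℝ}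
  {M : Time T → Ω → ℝ} {σ : Ω → WithTop (Time T)} {b : ℝ}

lemma stopped_compensated (M C : Time T → Ω → ℝ) (α : Time T → ℝ → Ω → ℝ) (L : Ω → ℝ)
    (σ : Ω → WithTop (Time T)) (t : Time T) (ω : Ω) :
    stopped σ (compensated M C α L) t ω = stopped σ M t ω
      - ∫ u in Ioc ⊥ (stopAt σ t ω), α u (L ω) ω ∂(stieltjes fun t ↦ C t ω) := by
  by_cases h : ω ∈ {ω | ⊥ < σ ω}
  · simp only [stopped, indicator_of_mem h, compensated]
  · have hσ : σ ω = ⊥ := not_bot_lt_iff.1 h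
    simp only [stopped, indicator_of_notMem h]
    rw [stopAt_of_ge (s := ⊥) hσ bot_le, Ioc_self, setIntegral_empty, sub_zero]

lemma measurable_drift_enlarge (hL : Measurable L) (hC : IsIncreasing 𝓕 C)
    (hα : Measurable[𝓕.predictable.prod (borel ℝ)] fun p : (Time T × Ω) × ℝ ↦ α p.1.1 p.2 p.1.2)
    (hσ : IsStoppingTime 𝓕 σ) (t : Time T) :
    Measurable[enlarge 𝓕 L hL t] fun ω ↦ ∫ u in Ioc ⊥ (stopAt σ t ω), α u (L ω) ω
      ∂(stieltjes fun t ↦ C t ω) := by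
  have hL_predictable : Measurable[(enlarge 𝓕 L hL).predictable] fun p : Time T × Ω ↦ L p.2 :=
    fun B hB ↦ measurableSet_snd_predictable (measurable_enlarge hL ⊥ hB)
  have hG : Measurable[(enlarge 𝓕 L hL).predictable]
      fun p : Time T × Ω ↦ α p.1 (L p.2) p.2 := by
    refine hα.comp (g := fun p : (Time T × Ω) × ℝ ↦ α p.1.1 p.2 p.1.2) (f := fun p ↦ (p, L p.2)) ?_
    refine @Measurable.prodMk _ (enlarge 𝓕 L hL).predictable _ _ 𝓕.predictable (borel ℝ) _ _
      (measurable_id.mono (predictable_mono (le_enlarge hL)) le_rfl) ?_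
    rwa [← BorelSpace.measurable_eq (α := ℝ)]
  have hD : IsStronglyPredictable (enlarge 𝓕 L hL) fun t ω ↦
      ∫ u in Ioc ⊥ t, α u (L ω) ω ∂(stieltjes fun t ↦ C t ω) :=
    ((hC.mono_filtration (le_enlarge hL)).measurable_setIntegral hG).stronglyMeasurable
  have hr := isStoppingTime_stopAt (isStoppingTime_mono_filtration (le_enlarge hL) hσ) t
  exact (measurable_stoppedValue hD.isStronglyProgressive hr).mono
    (hr.measurableSpace_le_of_le_const fun ω ↦ WithTop.coe_le_coe.2 (stopAt_le σ t ω)) le_rfl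

lemma integrableOn_stopped_compensated (hL : Measurable L) (hC : IsIncreasing 𝓕 C)
    (hα : Measurable[𝓕.predictable.prod (borel ℝ)] fun p : (Time T × Ω) × ℝ ↦ α p.1.1 p.2 p.1.2)
    (hσ : IsStoppingTime 𝓕 σ) (hM : Martingale (stopped σ M) 𝓕 P) {R : Set Ω}
    (hfin : ∫⁻ ω in R, ∫⁻ u in Ioc ⊥ (stopAt σ ⊤ ω), ‖α u (L ω) ω‖ₑ
      ∂(stieltjes fun t ↦ C t ω) ∂P < ∞) (t : Time T) :
    IntegrableOn (stopped σ (compensated M C α L) t) R P := by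
  simp_rw [funext (stopped_compensated M C α L σ t)]
  exact (hM.integrable t).integrableOn.sub
    (hC.integrableOn_setIntegral_stopAt (measurable_comp_of_predictable hα hL) hσ hfin t)

variable [IsFiniteMeasure P]

lemma tendsto_setIntegral_stopped_compensated (hL : Measurable L) (hC : IsIncreasing 𝓕 C)
    (hα : Measurable[𝓕.predictable.prod (borel ℝ)] fun p : (Time T × Ω) × ℝ ↦ α p.1.1 p.2 p.1.2)
    (hMc : ∀ᵐ ω ∂P, RightContinuous fun t ↦ M t ω) (hσ : IsStoppingTime 𝓕 σ)
    (hM : Martingale (stopped σ M) 𝓕 P) {R : Set Ω}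
    (hfin : ∫⁻ ω in R, ∫⁻ u in Ioc ⊥ (stopAt σ ⊤ ω), ‖α u (L ω) ω‖ₑ
      ∂(stieltjes fun t ↦ C t ω) ∂P < ∞) (s : Time T) :
    Tendsto (fun u ↦ ∫ ω in R, stopped σ (compensated M C α L) u ω ∂P) (𝓝[≥] s)
      (𝓝 (∫ ω in R, stopped σ (compensated M C α L) s ω ∂P)) := by
  have hG := measurable_comp_of_predictable hα hL
  have hsub := fun t ↦ integral_sub (hM.integrable t).integrableOn
    (hC.integrableOn_setIntegral_stopAt hG hσ hfin t)
  simp_rw [stopped_compensated]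
  rw [hsub s]
  refine Tendsto.congr (fun t ↦ (hsub t).symm) ?_
  exact (tendsto_setIntegral_nhdsGE hM (hMc.mono fun ω hω ↦ rightContinuous_stopped hω) s R).sub
    (hC.tendsto_setIntegral_setIntegral_stopAt hG hσ hfin s)

lemma setIntegral_stopped_compensated_sub (h𝓕 : UsualConditions 𝓕 P) (hL : Measurable L)
    (hQ : IsCadlagLaw 𝓕 P L Q) (hC : IsIncreasing 𝓕 C)
    (hα : Measurable[𝓕.predictable.prod (borel ℝ)] fun p : (Time T × Ω) × ℝ ↦ α p.1.1 p.2 p.1.2)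
    (hint : ∀ᵐ ω ∂P, ∫⁻ s, ∫⁻ x in Ioi b, ‖α s x ω‖ₑ ∂(leftLaw Q s ω)
      ∂(stieltjes fun u ↦ C u ω) < ∞)
    (hMc : ∀ᵐ ω ∂P, RightContinuous fun t ↦ M t ω)
    (htail : IsLocalMartingale 𝓕 P fun t ω ↦ tail Q b t ω * M t ω - tailIntegral Q C α b t ω)
    (hσ : IsStoppingTime 𝓕 σ) (hM : Martingale (stopped σ M) 𝓕 P)
    (hfin : ∫⁻ ω in {ω | b < L ω}, ∫⁻ u in Ioc ⊥ (stopAt σ ⊤ ω), ‖α u (L ω) ω‖ₑ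
      ∂(stieltjes fun t ↦ C t ω) ∂P < ∞) {s t : Time T} (hst : s ≤ t) {B : Set Ω}
    (hB : MeasurableSet[𝓕 s] B) :
    ∫ ω in B ∩ {ω | b < L ω}, (stopped σ (compensated M C α L) t ω
      - stopped σ (compensated M C α L) s ω) ∂P = 0 := by
  have hG := measurable_comp_of_predictable hα hL
  have hfin_B := (lintegral_mono_set (inter_subset_right (s := B))).trans_lt hfin
  have hDi := hC.integrableOn_setIntegral_stopAt hG hσ hfin_B
  have hincr := setIntegral_stopped_sub h𝓕 hL hQ hC hα hint hMc htail hσ hM hfin hst hB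
  rw [hC.setIntegral_setIntegral_Ioc_stopAt hG hσ hfin_B hst, ← sub_eq_zero] at hincr
  simp only [stopped_compensated, sub_sub_sub_comm]
  exact (integral_sub ((hM.integrable t).sub (hM.integrable s)).integrableOn
    ((hDi t).sub (hDi s))).trans hincr

lemma setIntegral_indicator_stopped_compensated_sub (h𝓕 : UsualConditions 𝓕 P)
    (hL : Measurable L) (hQ : IsCadlagLaw 𝓕 P L Q) (hC : IsIncreasing 𝓕 C)
    (hα : Measurable[𝓕.predictable.prod (borel ℝ)] fun p : (Time T × Ω) × ℝ ↦ α p.1.1 p.2 p.1.2)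
    (hint : ∀ a : ℝ, ∀ᵐ ω ∂P, ∫⁻ s, ∫⁻ x in Ioi a, ‖α s x ω‖ₑ ∂(leftLaw Q s ω)
      ∂(stieltjes fun u ↦ C u ω) < ∞)
    (hMc : ∀ᵐ ω ∂P, RightContinuous fun t ↦ M t ω)
    (htail : ∀ a : ℝ, IsLocalMartingale 𝓕 P fun t ω ↦
      tail Q a t ω * M t ω - tailIntegral Q C α a t ω)
    (hσ : IsStoppingTime 𝓕 σ) (hM : Martingale (stopped σ M) 𝓕 P)
    (hfin : ∫⁻ ω in {ω | b < L ω}, ∫⁻ u in Ioc ⊥ (stopAt σ ⊤ ω), ‖α u (L ω) ω‖ₑ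
      ∂(stieltjes fun t ↦ C t ω) ∂P < ∞) {s t : Time T} (hst : s ≤ t) {A : Set Ω}
    (hA : MeasurableSet[𝓕 s ⊔ MeasurableSpace.comap L inferInstance] A) :
    ∫ ω in A, {ω | b < L ω}.indicator (fun ω ↦ stopped σ (compensated M C α L) t ω
      - stopped σ (compensated M C α L) s ω) ω ∂P = 0 := by
  have hb : MeasurableSet {ω | b < L ω} := measurableSet_lt measurable_const hL
  have hi := integrableOn_stopped_compensated hL hC hα hσ hM hfin
  refine setIntegral_eq_zero_of_inter_lt (𝓕.le s) hL (((hi t).sub (hi s)).integrable_indicator hb)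
    (fun B hB a ↦ ?_) hA
  rw [setIntegral_indicator hb, inter_assoc, inter_lt_eq_max_lt]
  refine setIntegral_stopped_compensated_sub h𝓕 hL hQ hC hα (hint _) hMc (htail _) hσ hM ?_ hst hB
  exact (lintegral_mono_set fun ω hω ↦ (le_max_right a b).trans_lt hω).trans_lt hfin

theorem martingale_indicator_stopped_compensated (h𝓕 : UsualConditions 𝓕 P) (hL : Measurable L)
    (hQ : IsCadlagLaw 𝓕 P L Q) (hC : IsIncreasing 𝓕 C)
    (hα : Measurable[𝓕.predictable.prod (borel ℝ)] fun p : (Time T × Ω) × ℝ ↦ α p.1.1 p.2 p.1.2)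
    (hint : ∀ a : ℝ, ∀ᵐ ω ∂P, ∫⁻ s, ∫⁻ x in Ioi a, ‖α s x ω‖ₑ ∂(leftLaw Q s ω)
      ∂(stieltjes fun u ↦ C u ω) < ∞)
    (hMc : ∀ᵐ ω ∂P, RightContinuous fun t ↦ M t ω)
    (htail : ∀ a : ℝ, IsLocalMartingale 𝓕 P fun t ω ↦
      tail Q a t ω * M t ω - tailIntegral Q C α a t ω)
    (hσ : IsStoppingTime 𝓕 σ) (hM : Martingale (stopped σ M) 𝓕 P)
    (hfin : ∫⁻ ω in {ω | b < L ω}, ∫⁻ u in Ioc ⊥ (stopAt σ ⊤ ω), ‖α u (L ω) ω‖ₑ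
      ∂(stieltjes fun t ↦ C t ω) ∂P < ∞) :
    Martingale (fun t ↦ {ω | b < L ω}.indicator (stopped σ (compensated M C α L) t))
      (enlarge 𝓕 L hL) P := by
  have hb : MeasurableSet {ω | b < L ω} := measurableSet_lt measurable_const hL
  refine martingale_enlarge_of_setIntegral_sub hL (fun t ↦ ?_) (fun t ↦
    (integrableOn_stopped_compensated hL hC hα hσ hM hfin t).integrable_indicator hb)
    (fun s t hst A hA ↦ ?_) fun s A _ ↦ ?_
  · refine StronglyMeasurable.indicator ?_ (measurable_enlarge hL t measurableSet_Ioi)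
    rw [funext (stopped_compensated M C α L σ t)]
    exact ((hM.1 t).mono (le_enlarge hL t)).sub
      (measurable_drift_enlarge hL hC hα hσ t).stronglyMeasurable
  · simpa only [indicator_sub] using setIntegral_indicator_stopped_compensated_sub h𝓕 hL hQ hC hα
      hint hMc htail hσ hM hfin hst.le hA
  · simp_rw [setIntegral_indicator hb]
    exact tendsto_setIntegral_stopped_compensated hL hC hα hMc hσ hM
      ((lintegral_mono_set inter_subset_right).trans_lt hfin) s

end

/-! ### Localization -/

lemma martingale_of_indicator {ι : Type*} [LinearOrder ι] {𝓖 : Filtration ι m} {P : Measure Ω}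
    [IsFiniteMeasure P] {X : ι → Ω → ℝ} {R : ℕ → Set Ω} (hRm : ∀ n, MeasurableSet (R n))
    (hR : Monotone R) (hR_univ : ⋃ n, R n = univ) (hi : ∀ t, Integrable (X t) P)
    (h : ∀ n, Martingale (fun t ↦ (R n).indicator (X t)) 𝓖 P) : Martingale X 𝓖 P := by
  refine martingale_of_setIntegral_sub (fun t ↦ ?_) hi fun s t hst B hB ↦ ?_
  · refine stronglyMeasurable_of_tendsto atTop (fun n ↦ (h n).1 t) (tendsto_pi_nhds.2 fun ω ↦ ?_)
    simpa only [hR_univ, indicator_univ] using (hR.tendsto_indicator R (X t) ω).mono_right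
      (pure_le_nhds _)
  · have hlim : ∀ u, Tendsto (fun n ↦ ∫ ω in B, (R n).indicator (X u) ω ∂P) atTop
        (𝓝 (∫ ω in B, X u ω ∂P)) := fun u ↦ by
      simp_rw [fun n ↦ setIntegral_indicator (μ := P) (s := B) (f := X u) (hRm n)]
      have hmono : Monotone fun n ↦ B ∩ R n := fun _ _ hnk ↦ inter_subset_inter_right B (hR hnk)
      simpa only [← inter_iUnion, hR_univ, inter_univ] using tendsto_setIntegral_of_monotone
        (fun n ↦ (𝓖.le s B hB).inter (hRm n)) hmono (hi u).integrableOn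
    rw [integral_sub (hi t).integrableOn (hi s).integrableOn, sub_eq_zero]
    exact tendsto_nhds_unique (hlim t)
      ((hlim s).congr fun n ↦ (h n).setIntegral_eq hst.le hB)

section

variable {ι : Type*} [LinearOrder ι] [OrderBot ι]

lemma stopped_stopped_of_le {σ τ : Ω → WithTop ι} (h : σ ≤ τ) (X : ι → Ω → ℝ) :
    stopped σ (stopped τ X) = stopped σ X := by
  ext t ω
  by_cases hσ : ω ∈ {ω | ⊥ < σ ω}
  · have hτ : ω ∈ {ω | ⊥ < τ ω} := lt_of_lt_of_le (show ⊥ < σ ω from hσ) (h ω)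
    simp only [stopped, indicator_of_mem hσ, indicator_of_mem hτ]
    rw [stopAt_of_le ((coe_stopAt_le σ t ω).trans (h ω))]
  · simp only [stopped, indicator_of_notMem hσ]

lemma stopped_top (X : ι → Ω → ℝ) : stopped (fun _ ↦ ⊤) X = X := by
  ext t ω
  rw [stopped_of_lt (τ := fun _ ↦ ⊤) (WithTop.coe_lt_top ⊥),
    stopAt_of_le (τ := fun _ ↦ ⊤) le_top]

lemma stopped_piecewise_bot (σ : Ω → WithTop ι) (R : Set Ω) [DecidablePred (· ∈ R)]
    (X : ι → Ω → ℝ) (t : ι) :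
    stopped (R.piecewise σ fun _ ↦ ⊥) X t = R.indicator (stopped σ X t) := by
  ext ω
  by_cases hω : ω ∈ R
  · simp only [stopped, stopAt, indicator, mem_ofPred_eq, piecewise_eq_of_mem R _ _ hω, if_pos hω]
    congr
  · simp only [stopped, indicator, mem_ofPred_eq, piecewise_eq_of_notMem R _ _ hω, lt_irrefl,
      if_false, if_neg hω]

lemma martingale_stopped_of_le {𝓕 : Filtration (Time T) m} {P : Measure Ω} [IsFiniteMeasure P]
    {X : Time T → Ω → ℝ} (h𝓕 : UsualConditions 𝓕 P)
    (hc : ∀ᵐ ω ∂P, RightContinuous fun t ↦ X t ω) {σ τ : Ω → WithTop (Time T)}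
    (hσ : IsStoppingTime 𝓕 σ) (hστ : σ ≤ τ) (hX : Martingale (stopped τ X) 𝓕 P) :
    Martingale (stopped σ X) 𝓕 P := by
  rw [← stopped_stopped_of_le hστ]
  exact martingale_stopped h𝓕 hX (hc.mono fun ω hω ↦ rightContinuous_stopped hω) hσ

end

section

variable {𝓕 : Filtration (Time T) m} {P : Measure Ω}

lemma exists_isLocalizingSequence_le (h𝓕 : 𝓕.IsRightContinuous)
    {S : ℕ → Ω → WithTop (Time T)} (hS : ∀ n, IsStoppingTime 𝓕 (S n))
    (htop : ∀ᵐ ω ∂P, ∀ᶠ n in atTop, S n ω = ⊤) :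
    ∃ I, IsLocalizingSequence 𝓕 I P ∧ ∀ n, I n ≤ S n := by
  have hle : ∀ n j ω, ⨅ i, S (n + i) ω ≤ S (n + j) ω := fun n j ω ↦
    ciInf_le (OrderBot.bddBelow _) j
  refine ⟨fun n ω ↦ ⨅ j, S (n + j) ω,
    ⟨⟨fun n ↦ isStoppingTime_iInf h𝓕 fun j ↦ hS (n + j), ?_⟩, ?_⟩, fun n ω ↦ hle n 0 ω⟩
  · filter_upwards [htop] with ω hω
    obtain ⟨N, hN⟩ := eventually_atTop.1 hω
    refine tendsto_const_nhds.congr' ((eventually_ge_atTop N).mono fun n hn ↦ ?_)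
    simp only [hN _ (le_add_right hn), ciInf_const]
  · refine ae_of_all _ fun ω n k hnk ↦ le_ciInf fun j ↦ ?_
    have h := hle n (k - n + j) ω
    rwa [← add_assoc, Nat.add_sub_cancel' hnk] at h

lemma isLocalizingSequence_mono_filtration {𝓖 : Filtration (Time T) m} (h : 𝓕 ≤ 𝓖)
    {τ : ℕ → Ω → WithTop (Time T)} (hτ : IsLocalizingSequence 𝓕 τ P) :
    IsLocalizingSequence 𝓖 τ P :=
  ⟨⟨fun n ↦ isStoppingTime_mono_filtration h (hτ.isStoppingTime n), hτ.tendsto_top⟩, hτ.mono⟩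

lemma isLocalizingSequence_piecewise_bot {τ : ℕ → Ω → WithTop (Time T)}
    (hτ : IsLocalizingSequence 𝓕 τ P) {R : ℕ → Set Ω} [∀ n, DecidablePred (· ∈ R n)]
    (hRm : ∀ n, MeasurableSet[𝓕 ⊥] (R n)) (hR : Monotone R) (hR_univ : ⋃ n, R n = univ) :
    IsLocalizingSequence 𝓕 (fun n ↦ (R n).piecewise (τ n) fun _ ↦ ⊥) P := by
  refine ⟨⟨fun n ↦ (hτ.isStoppingTime n).piecewise_of_le (isStoppingTime_const 𝓕 ⊥)
    (fun _ ↦ bot_le) (fun _ ↦ le_rfl) (hRm n), ?_⟩, ?_⟩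
  · filter_upwards [hτ.tendsto_top] with ω hω
    obtain ⟨N, hN⟩ := mem_iUnion.1 (hR_univ.symm ▸ mem_univ ω)
    refine hω.congr' ((eventually_ge_atTop N).mono fun n hn ↦ ?_)
    exact (piecewise_eq_of_mem _ _ _ (hR hn hN)).symm
  · filter_upwards [hτ.mono] with ω hω n k hnk
    by_cases hn : ω ∈ R n
    · simpa only [piecewise_eq_of_mem _ _ _ hn, piecewise_eq_of_mem _ _ _ (hR hnk hn)] using hω hnk
    · simp only [piecewise_eq_of_notMem _ _ _ hn, bot_le]

lemma exists_isLocalizingSequence_setLIntegral_lt_top [IsFiniteMeasure P] {L : Ω → ℝ}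
    {Q : Time T → Ω → ProbabilityMeasure ℝ} {C : Time T → Ω → ℝ} {α : Time T → ℝ → Ω → ℝ}
    (h𝓕 : UsualConditions 𝓕 P) (hL : Measurable L)
    (hQ : IsCadlagLaw 𝓕 P L Q) (hC : IsIncreasing 𝓕 C)
    (hα : Measurable[𝓕.predictable.prod (borel ℝ)] fun p : (Time T × Ω) × ℝ ↦ α p.1.1 p.2 p.1.2)
    (hint : ∀ a : ℝ, ∀ᵐ ω ∂P, ∫⁻ s, ∫⁻ x in Ioi a, ‖α s x ω‖ₑ ∂(leftLaw Q s ω)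
      ∂(stieltjes fun u ↦ C u ω) < ∞) (a : ℕ → ℝ) :
    ∃ I : ℕ → Ω → WithTop (Time T), IsLocalizingSequence 𝓕 I P ∧
      ∀ n, ∫⁻ ω in {ω | a n < L ω}, ∫⁻ s in Ioc ⊥ (stopAt (I n) ⊤ ω), ‖α s (L ω) ω‖ₑ
        ∂(stieltjes fun u ↦ C u ω) ∂P < ∞ := by
  choose S hS hSP hSfin using fun n ↦ exists_isStoppingTime_setLIntegral_lt_top h𝓕 hL hQ hC hα
    (hint (a n)) (ε := 2⁻¹ ^ n) (by simp)
  have hsum : ∑' n, P {ω | S n ω < ⊤} ≠ ∞ :=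
    ((ENNReal.tsum_le_tsum hSP).trans_lt
      (tsum_geometric_lt_top.2 (by simp [ENNReal.inv_lt_one]))).ne
  obtain ⟨I, hI, hIS⟩ := exists_isLocalizingSequence_le (P := P) h𝓕.rightCont hS
    ((ae_eventually_notMem hsum).mono fun ω hω ↦ hω.mono fun n hn ↦ not_lt_top_iff.1 hn)
  refine ⟨I, hI, fun n ↦ (lintegral_mono fun ω ↦ lintegral_mono_set ?_).trans_lt (hSfin n)⟩
  exact Ioc_subset_Ioc_right (stopAt_mono_left (hIS n ω) ⊤)

end

/-! ### The compensated process -/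

lemma IsCadlag.sub {f g : Time T → ℝ} (hf : IsCadlag f) (hg : IsCadlag g) :
    IsCadlag fun t ↦ f t - g t := fun t ↦ by
  obtain ⟨l, hl⟩ := (hf t).2
  obtain ⟨l', hl'⟩ := (hg t).2
  exact ⟨(hf t).1.sub (hg t).1, _, hl.sub hl'⟩

section

variable {𝓕 : Filtration (Time T) m} {P : Measure Ω} [IsFiniteMeasure P] {L : Ω → ℝ}
  {Q : Time T → Ω → ProbabilityMeasure ℝ} {C M : Time T → Ω → ℝ} {α : Time T → ℝ → Ω → ℝ}

theorem isLocalMartingale_compensated (h𝓕 : UsualConditions 𝓕 P) (hL : Measurable L)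
    (hQ : IsCadlagLaw 𝓕 P L Q) (hC : IsIncreasing 𝓕 C)
    (hα : Measurable[𝓕.predictable.prod (borel ℝ)] fun p : (Time T × Ω) × ℝ ↦ α p.1.1 p.2 p.1.2)
    (hint : ∀ a : ℝ, ∀ᵐ ω ∂P, ∫⁻ s, ∫⁻ x in Ioi a, ‖α s x ω‖ₑ ∂(leftLaw Q s ω)
      ∂(stieltjes fun u ↦ C u ω) < ∞) (hM : IsLocalMartingale 𝓕 P M)
    (htail : ∀ a : ℝ, IsLocalMartingale 𝓕 P fun t ω ↦
      tail Q a t ω * M t ω - tailIntegral Q C α a t ω) :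
    IsLocalMartingale (enlarge 𝓕 L hL) P (compensated M C α L) := by
  classical
  obtain ⟨hMc, τ, hτ, hMτ⟩ := hM
  refine ⟨?_, ?_⟩
  · filter_upwards [hMc, ae_integrable_drift h𝓕 hL hQ hC hα hint] with ω hMω hDω
    exact hMω.sub (isCadlag_setIntegral hDω)
  have hMr : ∀ᵐ ω ∂P, RightContinuous fun t ↦ M t ω := hMc.mono fun _ hω ↦ hω.rightContinuous
  obtain ⟨I, hI, hIfin⟩ := exists_isLocalizingSequence_setLIntegral_lt_top h𝓕 hL hQ hC hα hint
    fun n ↦ -(n : ℝ)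
  have hσ := hτ.min hI
  refine ⟨_, isLocalizingSequence_piecewise_bot
    (isLocalizingSequence_mono_filtration (le_enlarge hL) hσ)
    (fun n ↦ measurable_enlarge hL ⊥ measurableSet_Ioi) (monotone_neg_nat_lt L)
    (iUnion_neg_nat_lt L), fun n ↦ ?_⟩
  rw [stoppedProcess_indicator, funext (stopped_piecewise_bot _ _ _)]
  refine martingale_indicator_stopped_compensated h𝓕 hL hQ hC hα hint hMr htail
    (hσ.isStoppingTime n) (martingale_stopped_of_le h𝓕 hMr (hσ.isStoppingTime n)
      (fun ω ↦ min_le_left _ _) (hMτ n)) ?_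
  refine (lintegral_mono fun ω ↦ lintegral_mono_set ?_).trans_lt (hIfin n)
  exact Ioc_subset_Ioc_right (stopAt_mono_left (min_le_right (τ n ω) (I n ω)) ⊤)

theorem martingale_compensated (h𝓕 : UsualConditions 𝓕 P) (hL : Measurable L)
    (hQ : IsCadlagLaw 𝓕 P L Q) (hC : IsIncreasing 𝓕 C)
    (hα : Measurable[𝓕.predictable.prod (borel ℝ)] fun p : (Time T × Ω) × ℝ ↦ α p.1.1 p.2 p.1.2)
    (hint : ∀ a : ℝ, ∀ᵐ ω ∂P, ∫⁻ s, ∫⁻ x in Ioi a, ‖α s x ω‖ₑ ∂(leftLaw Q s ω)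
      ∂(stieltjes fun u ↦ C u ω) < ∞)
    (hMc : ∀ᵐ ω ∂P, RightContinuous fun t ↦ M t ω)
    (htail : ∀ a : ℝ, IsLocalMartingale 𝓕 P fun t ω ↦
      tail Q a t ω * M t ω - tailIntegral Q C α a t ω) (hM : Martingale M 𝓕 P)
    (hfin : ∫⁻ ω, ∫⁻ s, ‖α s (L ω) ω‖ₑ ∂(stieltjes fun u ↦ C u ω) ∂P < ∞) :
    Martingale (compensated M C α L) (enlarge 𝓕 L hL) P := by
  have hσ : IsStoppingTime 𝓕 fun _ ↦ ⊤ := (isLocalizingSequence_const_top 𝓕 P).isStoppingTime 0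
  have hM_top : Martingale (stopped (fun _ ↦ ⊤) M) 𝓕 P := by rwa [stopped_top]
  have hfin_on : ∀ R : Set Ω, ∫⁻ ω in R, ∫⁻ s in Ioc ⊥ (stopAt (fun _ ↦ ⊤) ⊤ ω), ‖α s (L ω) ω‖ₑ
      ∂(stieltjes fun u ↦ C u ω) ∂P < ∞ := fun R ↦ (setLIntegral_le_lintegral R _).trans_lt
    ((lintegral_mono fun ω ↦ setLIntegral_le_lintegral _ _).trans_lt hfin)
  refine martingale_of_indicator (fun n ↦ measurableSet_lt measurable_const hL)
    (monotone_neg_nat_lt L) (iUnion_neg_nat_lt L) (fun t ↦ ?_) fun n ↦ ?_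
  · rw [← integrableOn_univ, ← stopped_top (compensated M C α L)]
    exact integrableOn_stopped_compensated hL hC hα hσ hM_top (hfin_on univ) t
  · simpa only [stopped_top] using martingale_indicator_stopped_compensated (b := -(n : ℝ)) h𝓕 hL
      hQ hC hα hint hMc htail hσ hM_top (hfin_on _)

end

/-! ### Indistinguishable processes -/

section

variable {𝓕 : Filtration (Time T) m} {P : Measure Ω}

lemma IsLocalMartingale.congr (h𝓕 : UsualConditions 𝓕 P) {X Y : Time T → Ω → ℝ}
    (hX : IsLocalMartingale 𝓕 P X) (hXY : ∀ᵐ ω ∂P, ∀ t, X t ω = Y t ω) :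
    IsLocalMartingale 𝓕 P Y := by
  obtain ⟨hc, τ, hτ, h⟩ := hX
  refine ⟨?_, τ, hτ, fun n ↦ ?_⟩
  · filter_upwards [hc, hXY] with ω hω hXYω
    simpa only [hXYω] using hω
  · refine h𝓕.martingale_congr (h n) fun t ↦ ?_
    filter_upwards [hXY] with ω hω
    simp only [stoppedProcess, indicator, hω]
    congr

lemma exists_isIncreasing (h𝓕 : UsualConditions 𝓕 P) {C : Time T → Ω → ℝ}
    (hC : IsStronglyPredictable 𝓕 C) (hC_zero : ∀ᵐ ω ∂P, C ⊥ ω = 0)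
    (hC_mono : ∀ᵐ ω ∂P, Monotone fun t ↦ C t ω)
    (hC_rightCont : ∀ᵐ ω ∂P, RightContinuous fun t ↦ C t ω) :
    ∃ C', IsIncreasing 𝓕 C' ∧ ∀ᵐ ω ∂P, ∀ t, C t ω = C' t ω := by
  let G : Set Ω := {ω | C ⊥ ω = 0 ∧ Monotone (fun t ↦ C t ω) ∧ RightContinuous fun t ↦ C t ω}
  have hG : ∀ᵐ ω ∂P, ω ∈ G := by
    filter_upwards [hC_zero, hC_mono, hC_rightCont] with ω h0 hmono hr using ⟨h0, hmono, hr⟩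
  have hGm : MeasurableSet[𝓕 ⊥] G :=
    MeasurableSet.compl_iff.1 (h𝓕.null Gᶜ (ae_iff.1 hG))
  refine ⟨fun t ↦ G.indicator (C t), ⟨?_, fun ω ↦ ?_, fun ω ↦ ?_, fun ω ↦ ?_⟩, ?_⟩
  · exact hC.measurable.indicator (measurableSet_snd_predictable hGm)
  · exact indicator_apply_eq_zero.2 fun hω ↦ hω.1
  · by_cases hω : ω ∈ G
    · simpa only [indicator_of_mem hω] using hω.2.1
    · simpa only [indicator_of_notMem hω] using monotone_const
  · by_cases hω : ω ∈ G
    · simpa only [indicator_of_mem hω] using hω.2.2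
    · simpa only [indicator_of_notMem hω] using fun t ↦ continuousWithinAt_const
  · filter_upwards [hG] with ω hω t
    rw [indicator_of_mem hω]

lemma leftLaw_congr {Q Q' : Time T → Ω → ProbabilityMeasure ℝ} {ω : Ω}
    (h : ∀ t, Q t ω = Q' t ω) (t : Time T) : leftLaw Q t ω = leftLaw Q' t ω := by
  simp only [leftLaw, h]

end

end Enlargement

end

theorem mainTheorem3_general {Ω : Type*} {m : MeasurableSpace Ω} (P : Measure Ω)
    [IsFiniteMeasure P] (T : ℝ≥0)
    (𝓕 : Filtration (Enlargement.Time T) m) (h𝓕 : Enlargement.UsualConditions 𝓕 P)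
    (L : Ω → ℝ) (hL : Measurable L)
    (Q : Enlargement.Time T → Ω → ProbabilityMeasure ℝ)
    (hQ : Enlargement.IsRegularConditionalLaw 𝓕 P L Q)
    (M C : Enlargement.Time T → Ω → ℝ)
    (hM : Enlargement.IsLocalMartingale 𝓕 P M)
    (hC : IsStronglyPredictable 𝓕 C) (hC_zero : ∀ᵐ ω ∂P, C ⊥ ω = 0)
    (hC_mono : ∀ᵐ ω ∂P, Monotone fun t ↦ C t ω)
    (hC_rightCont : ∀ᵐ ω ∂P, Enlargement.RightContinuous fun t ↦ C t ω)
    (α : Enlargement.Time T → ℝ → Ω → ℝ)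
    (hα : Measurable[𝓕.predictable.prod (borel ℝ)]
      fun p : (Enlargement.Time T × Ω) × ℝ ↦ α p.1.1 p.2 p.1.2)
    (hint : ∀ a : ℝ, ∀ᵐ ω ∂P,
      ∫⁻ s, ∫⁻ x in Ioi a, ‖α s x ω‖ₑ ∂(Enlargement.leftLaw Q s ω)
        ∂(Enlargement.stieltjes fun u ↦ C u ω) < ∞)
    (htail : ∀ a : ℝ, Enlargement.IsLocalMartingale 𝓕 P fun t ω ↦
      Enlargement.tail Q a t ω * M t ω - Enlargement.tailIntegral Q C α a t ω) :
    (∀ᵐ ω ∂P, Integrable (fun s ↦ α s (L ω) ω) (Enlargement.stieltjes fun u ↦ C u ω)) ∧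
    Enlargement.IsLocalMartingale (Enlargement.enlarge 𝓕 L hL) P
      (Enlargement.compensated M C α L) ∧
    (Martingale M 𝓕 P →
      ∫⁻ ω, ∫⁻ s, ‖α s (L ω) ω‖ₑ ∂(Enlargement.stieltjes fun u ↦ C u ω) ∂P < ∞ →
      Martingale (Enlargement.compensated M C α L) (Enlargement.enlarge 𝓕 L hL) P) := by
  obtain ⟨Q', hQ', hQQ'⟩ := hQ.exists_isCadlagLaw h𝓕 hL
  obtain ⟨C', hC', hCC'⟩ := Enlargement.exists_isIncreasing h𝓕 hC hC_zero hC_mono hC_rightCont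
  have hint' : ∀ a : ℝ, ∀ᵐ ω ∂P, ∫⁻ s, ∫⁻ x in Ioi a, ‖α s x ω‖ₑ ∂(Enlargement.leftLaw Q' s ω)
      ∂(Enlargement.stieltjes fun u ↦ C' u ω) < ∞ := fun a ↦ by
    filter_upwards [hint a, hQQ', hCC'] with ω hω hQω hCω
    simpa only [← Enlargement.leftLaw_congr hQω, ← hCω] using hω
  have htail' : ∀ a : ℝ, Enlargement.IsLocalMartingale 𝓕 P fun t ω ↦
      Enlargement.tail Q' a t ω * M t ω - Enlargement.tailIntegral Q' C' α a t ω := fun a ↦ by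
    refine (htail a).congr h𝓕 ?_
    filter_upwards [hQQ', hCC'] with ω hQω hCω t
    simp only [Enlargement.tail, Enlargement.tailIntegral, Enlargement.leftLaw_congr hQω, hQω, hCω]
  have hcomp : ∀ᵐ ω ∂P, ∀ t, Enlargement.compensated M C' α L t ω
      = Enlargement.compensated M C α L t ω :=
    hCC'.mono fun ω hω t ↦ by simp only [Enlargement.compensated, hω]
  refine ⟨?_, (Enlargement.isLocalMartingale_compensated h𝓕 hL hQ' hC' hα hint' hM htail').congr
    (h𝓕.enlarge hL) hcomp, fun hM' hfin ↦ (h𝓕.enlarge hL).martingale_congr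
    (Enlargement.martingale_compensated h𝓕 hL hQ' hC' hα hint'
      (hM.1.mono fun ω hω t ↦ (hω t).1) htail' hM' ?_) fun t ↦ hcomp.mono fun ω hω ↦ hω t⟩
  · filter_upwards [Enlargement.ae_integrable_drift h𝓕 hL hQ' hC' hα hint', hCC'] with ω hω hCω
    simpa only [hCω] using hω
  · refine (lintegral_congr_ae (hCC'.mono fun ω hω ↦ ?_)).trans_lt hfin
    simp only [hω]

theorem mainTheorem3 {Ω : Type*} {m : MeasurableSpace Ω} (P : Measure Ω) [IsProbabilityMeasure P]
    (T : ℝ≥0) (hT : 0 < T)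
    (𝓕 : Filtration (Enlargement.Time T) m) (h𝓕 : Enlargement.UsualConditions 𝓕 P)
    (L : Ω → ℝ) (hL : Measurable L)
    (Q : Enlargement.Time T → Ω → ProbabilityMeasure ℝ)
    (hQ : Enlargement.IsRegularConditionalLaw 𝓕 P L Q)
    (M C : Enlargement.Time T → Ω → ℝ)
    (hM : Enlargement.IsLocalMartingale 𝓕 P M)
    (hC : Enlargement.IsPredictableQuadraticVariation 𝓕 P M C)
    (α : Enlargement.Time T → ℝ → Ω → ℝ)
    -- `α` is measurable for the product of the predictable and the Borel σ-algebras
    (hα : Measurable[𝓕.predictable.prod (borel ℝ)]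
      fun p : (Enlargement.Time T × Ω) × ℝ ↦ α p.1.1 p.2 p.1.2)
    -- the integrals `∫_0^t ∫_a^∞ α_s^x Q_{s-}(dx) d⟨M, M⟩_s` converge absolutely
    (hint : ∀ a : ℝ, ∀ᵐ ω ∂P,
      ∫⁻ s, ∫⁻ x in Ioi a, ‖α s x ω‖ₑ ∂(Enlargement.leftLaw Q s ω)
        ∂(Enlargement.stieltjes fun u ↦ C u ω) < ∞)
    -- and they represent `⟨∫_a^∞ Q(·, dx), M⟩`
    (hbracket : ∀ a : ℝ, ∃ A : Enlargement.Time T → Ω → ℝ,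
      Enlargement.IsPredictableCovariation 𝓕 P (Enlargement.tail Q a) M A ∧
      ∀ᵐ ω ∂P, ∀ t, A t ω = Enlargement.tailIntegral Q C α a t ω) :
    (∀ᵐ ω ∂P, Integrable (fun s ↦ α s (L ω) ω) (Enlargement.stieltjes fun u ↦ C u ω)) ∧
    Enlargement.IsLocalMartingale (Enlargement.enlarge 𝓕 L hL) P
      (Enlargement.compensated M C α L) ∧
    (Martingale M 𝓕 P →
      ∫⁻ ω, ∫⁻ s, ‖α s (L ω) ω‖ₑ ∂(Enlargement.stieltjes fun u ↦ C u ω) ∂P < ∞ →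
      Martingale (Enlargement.compensated M C α L) (Enlargement.enlarge 𝓕 L hL) P) := by
  refine mainTheorem3_general P T 𝓕 h𝓕 L hL Q hQ M C hM hC.predictable hC.zero hC.mono
    (hC.cadlag.mono fun ω hω t ↦ (hω t).1) α hα hint fun a ↦ ?_
  obtain ⟨A, hA, hAt⟩ := hbracket a
  exact hA.localMartingale.congr h𝓕 (hAt.mono fun ω hω t ↦ by rw [hω])
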